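/- Let $G$ be a finite group; all rings and monoids are commutative and unital. **Definitions.** A *semi-Mackey functor* $M=(M^*,M_*)$ on $G$ is a contravariant functor $M^*$ and a covariant functor $M_*$ from finite $G$-sets to sets with the same values $M(X)$, such that $M^*$ sends finite coproducts to products and $M^*(f)M_*(y)=M_*(x)M^*(f')$ for every pull-back square with sides $f'\colon X'\to Y'$, $x\colon X'\to X$, $y\colon Y'\to Y$, $f\colon X\to Y$. Then the $M(X)$ are commutative monoids (written multiplicatively), and morphisms are families of monoid homomorphisms commuting with $M^*(f)$ and $M_*(f)$. $M$ is a *Mackey functor* if all $M(X)$ are groups; $\mathrm{Mack}_G\subset\mathrm{SMack}_G$ are the resulting categories. A *Tambara functor* $T=(T^*,T_+,T_\bullet)$ consists of semi-Mackey functors $(T^*,T_+)$ and $T^\mu=(T^*,T_\bullet)$ such that $T_\bullet(f)T_+(p)=T_+(q)T_\bullet(\rho)T^*(\lambda)$ for every exponential diagram $X\xleftarrow{p}A\xleftarrow{\lambda}Z\xrightarrow{\rho}B\xrightarrow{q}Y$ over $f\colon X\to Y$, and such that the resulting semi-rings $T(X)$ are rings. (A diagram is exponential if it is isomorphic to the canonical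 one, in which $B=\Pi_f(A)$ is the set of pairs $(y,\sigma)$ with $y\in Y$ and $\sigma$ a section of $p$ over $f^{-1}(y)$, $Z=X\times_YB$ and $\lambda(x,(y,\sigma))=\sigma(x)$.) Morphisms are families of ring homomorphisms commuting with all $f^*,f_+,f_\bullet$; the category is $\mathrm{Tam}_G$. The functor $(-)^\mu\colon\mathrm{Tam}_G\to\mathrm{SMack}_G$ has a left adjoint $M\mapsto\Omega[M]$, and $\Omega=\Omega[0]$ is the Burnside Tambara functor, the initial object of $\mathrm{Tam}_G$. The tensor product $T\otimes_\Omega S$ is the Tambara functor whose value at $X$ consists of the classes $[t\otimes s]_{(A,p)}$ with $p\colon A\to X$, $t\in T(A)$, $s\in S(A)$, modulo $[a^*t'\otimes s]_{(A,p'a)}=[t'\otimes a_+s]_{(A',p')}$ and $[a_+t\otimes s']_{(A',p')}=[t\otimes a^*s']_{(A,p'a)}$ for $a\colon A\to A'$, $p'\colon A'\to X$; sums are given by disjoint unions and $f^*$, $f_+$, $f_\bullet$ by pull-back, by composition with $f$, and by exponential diagrams. It is the coproduct of $T$ and $S$ in $\mathrm{Tam}_G$. A *Hopf Tambara functor* is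 a Tambara functor $H$ with morphisms $\Delta\colon H\to H\otimes_\Omega H$, $\varepsilon\colon H\to\Omega$, $\eta\colon H\to H$ in $\mathrm{Tam}_G$ such that $(\Delta\otimes\mathrm{id})\Delta=(\mathrm{id}\otimes\Delta)\Delta$, $(\varepsilon\otimes\mathrm{id})\Delta=\mathrm{id}=(\mathrm{id}\otimes\varepsilon)\Delta$ and $\nabla(\eta\otimes\mathrm{id})\Delta=\iota\varepsilon=\nabla(\mathrm{id}\otimes\eta)\Delta$ up to the canonical isomorphisms, where $\nabla\colon H\otimes_\Omega H\to H$ is the multiplication and $\iota\colon\Omega\to H$ the unique morphism. Morphisms are the morphisms of Tambara functors that commute with $\Delta,\varepsilon,\eta$; the category is $\mathrm{Hopf}_G$. For a Mackey functor $M$, $\Omega[M]$ is a Hopf Tambara functor, functorially in $M$, with $\Delta_M\colon\Omega[M]\to\Omega[M\oplus M]\cong\Omega[M]\otimes_\Omega\Omega[M]$, $\varepsilon_M\colon\Omega[M]\to\Omega[0]=\Omega$ and $\eta_M\colon\Omega[M]\to\Omega[M]$ induced by the diagonal $M\to M\oplus M$, by $M\to0$ and by the inverse $M\to M$. An element $m\in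 H(X)$ is *group-like* if $\Delta_X(m)=[m\otimes m]_{(X,\mathrm{id}_X)}$ and $\varepsilon_X(m)=1$; put $\mathcal M_H(X)=\{m\in H(X)\mid m\text{ is group-like}\}$. **Theorem.** 1. The sets $\mathcal M_H(X)$ form a Mackey functor $\mathcal M_H$, and $H\mapsto\mathcal M_H$ is a functor $\mathcal M\colon\mathrm{Hopf}_G\to\mathrm{Mack}_G$, such that the inclusions $\mathcal M_H\hookrightarrow H^\mu$ are morphisms of semi-Mackey functors, natural in $H\in\mathrm{Hopf}_G$. 2. For Mackey functors $M$ there is an inclusion (a morphism of Mackey functors with injective components) $M\hookrightarrow\mathcal M_{\Omega[M]}$, natural in $M\in\mathrm{Mack}_G$, whose composite with $\mathcal M_{\Omega[M]}\hookrightarrow\Omega[M]^\mu$ is the unit $M\to\Omega[M]^\mu$ of the adjunction $\Omega[-]\dashv(-)^\mu$. 3. For Hopf Tambara functors $H$ there is a morphism of Tambara functors $\Omega[\mathcal M_H]\to H$, natural in $H\in\mathrm{Hopf}_G$, namely the one that corresponds to the inclusion $\mathcal M_H\hookrightarrow H^\mu$ under this adjunction. -/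

import Mathlib

universe u

open CategoryTheory

noncomputable section

/-- A finite `G`-set. -/
structure FinGSet (G : Type u) [Group G] where
  carrier : Type u
  [action : MulAction G carrier]
  [fin : Finite carrier]

attribute [instance] FinGSet.action FinGSet.fin

instance FinGSet.instCoeSort (G : Type u) [Group G] : CoeSort (FinGSet G) (Type u) :=
  ⟨FinGSet.carrier⟩

namespace FinGSet

variable {G : Type u} [Group G]

/-- The disjoint union of two finite `G`-sets. -/
def sum (X Y : FinGSet G) : FinGSet G := ⟨X ⊕ Y⟩

def inl (X Y : FinGSet G) : X →[G] sum X Y := ⟨Sum.inl, fun _ _ => rfl⟩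

def inr (X Y : FinGSet G) : Y →[G] sum X Y := ⟨Sum.inr, fun _ _ => rfl⟩

/-- The map out of a disjoint union. -/
def copair {X Y Z : FinGSet G} (f : X →[G] Z) (g : Y →[G] Z) : sum X Y →[G] Z :=
  ⟨Sum.elim f g, by
    rintro m (x | y)
    · exact map_smul f m x
    · exact map_smul g m y⟩

/-- The canonical pull-back `X ×_Y B`. -/
def pb {X Y B : FinGSet G} (f : X →[G] Y) (q : B →[G] Y) : FinGSet G where
  carrier := {z : X × B // f z.1 = q z.2}
  action :=
    { smul := fun g z => ⟨g • z.1, by simp [z.2]⟩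
      one_smul := fun z => Subtype.ext (one_smul G z.1)
      mul_smul := fun g h z => Subtype.ext (mul_smul g h z.1) }

def pbFst {X Y B : FinGSet G} (f : X →[G] Y) (q : B →[G] Y) : pb f q →[G] X :=
  ⟨fun z => z.1.1, fun _ _ => rfl⟩

def pbSnd {X Y B : FinGSet G} (f : X →[G] Y) (q : B →[G] Y) : pb f q →[G] B :=
  ⟨fun z => z.1.2, fun _ _ => rfl⟩

/-- The square with `f' : X' → Y'` on top, `x : X' → X` on the left, `y : Y' → Y` on the right and
`f : X → Y` at the bottom is a pull-back of finite `G`-sets. -/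
def IsPullbackSq {X' Y' X Y : FinGSet G} (f' : X' →[G] Y') (x : X' →[G] X) (y : Y' →[G] Y)
    (f : X →[G] Y) : Prop :=
  (∀ z, f (x z) = y (f' z)) ∧ ∀ a b, f a = y b → ∃! z, x z = a ∧ f' z = b

/-- The underlying set of `Π_f(A)`: pairs of `y : Y` and a section `σ` of `p` over the
fibre of `f` at `y`. -/
structure PiSet {X Y A : FinGSet G} (f : X →[G] Y) (p : A →[G] X) where
  pt : Y
  sec : {x : X // f x = pt} → A
  sec_spec : ∀ x, p (sec x) = x.1

theorem PiSet.ext' {X Y A : FinGSet G} {f : X →[G] Y} {p : A →[G] X} {s t : PiSet f p}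
    (h : s.pt = t.pt) (h' : ∀ x hs ht, s.sec ⟨x, hs⟩ = t.sec ⟨x, ht⟩) : s = t := by
  obtain ⟨y, σ, hσ⟩ := s
  obtain ⟨y', τ, hτ⟩ := t
  obtain rfl : y = y' := h
  obtain rfl : σ = τ := funext fun x => h' x.1 x.2 x.2
  rfl

/-- The `G`-set `Π_f(A)`, with `g` acting by `(y, σ) ↦ (g y, x ↦ g σ(g⁻¹ x))`. -/
def piObj {X Y A : FinGSet G} (f : X →[G] Y) (p : A →[G] X) : FinGSet G where
  carrier := PiSet f p
  action :=
    { smul := fun g s =>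
        { pt := g • s.pt
          sec := fun x => g • s.sec ⟨g⁻¹ • x.1, by simp [x.2]⟩
          sec_spec := fun x => by simp [s.sec_spec] }
      one_smul := fun s => PiSet.ext' (one_smul G s.pt) fun x hs ht => by
        change (1 : G) • s.sec _ = _
        simp
      mul_smul := fun g h s => PiSet.ext' (mul_smul g h s.pt) fun x hs ht => by
        change (g * h) • s.sec _ = g • (h • s.sec _)
        simp [mul_smul] }
  fin := by
    have : Finite (Σ y : Y, ({x : X // f x = y} → A)) := inferInstance
    refine Finite.of_injective
      (fun s : PiSet f p => (⟨s.pt, s.sec⟩ : Σ y : Y, ({x : X // f x = y} → A))) ?_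
    rintro ⟨y, σ, hσ⟩ ⟨y', τ, hτ⟩ h
    cases h
    rfl

/-- `π : Π_f(A) → Y`. -/
def piProj {X Y A : FinGSet G} (f : X →[G] Y) (p : A →[G] X) : piObj f p →[G] Y :=
  ⟨fun s => PiSet.pt s, fun _ _ => rfl⟩

/-- `e : X ×_Y Π_f(A) → A`. -/
def piEval {X Y A : FinGSet G} (f : X →[G] Y) (p : A →[G] X) :
    pb f (piProj f p) →[G] A :=
  ⟨fun z => PiSet.sec z.1.2 ⟨z.1.1, z.2⟩, fun g z => by
    change g • PiSet.sec z.1.2 ⟨g⁻¹ • (g • z.1.1), _⟩ = _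
    simp⟩

/-- `X ←p- A ←l- Z -r→ B -q→ Y` is an exponential diagram over `f : X → Y`: it is isomorphic to
the canonical one. -/
def IsExponential {X Y A Z B : FinGSet G} (f : X →[G] Y) (p : A →[G] X) (l : Z →[G] A)
    (r : Z →[G] B) (q : B →[G] Y) : Prop :=
  ∃ (φ : B →[G] piObj f p) (ψ : Z →[G] pb f (piProj f p)),
    Function.Bijective φ ∧ Function.Bijective ψ ∧
    (∀ b, piProj f p (φ b) = q b) ∧ (∀ z, pbSnd f (piProj f p) (ψ z) = φ (r z)) ∧
    ∀ z, piEval f p (ψ z) = l z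

/-- The empty `G`-set. -/
def empty (G : Type u) [Group G] : FinGSet G where
  carrier := PEmpty
  action := { smul := fun _ x => x, one_smul := fun _ => rfl, mul_smul := fun _ _ _ => rfl }

instance : IsEmpty (empty G) := inferInstanceAs (IsEmpty PEmpty)

def fromEmpty (X : FinGSet G) : empty G →[G] X := ⟨fun x => x.elim, fun _ x => x.elim⟩

theorem pb_isPullbackSq {X Y B : FinGSet G} (f : X →[G] Y) (q : B →[G] Y) :
    IsPullbackSq (pbSnd f q) (pbFst f q) q f := by
  refine ⟨fun z => z.2, fun a b h => ⟨⟨(a, b), h⟩, ⟨rfl, rfl⟩, ?_⟩⟩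
  rintro ⟨⟨a', b'⟩, h'⟩ ⟨h1, h2⟩
  exact Subtype.ext (Prod.ext h1 h2)

theorem pb_ext {X Y B : FinGSet G} {f : X →[G] Y} {q : B →[G] Y} {z w : pb f q}
    (h1 : pbFst f q z = pbFst f q w) (h2 : pbSnd f q z = pbSnd f q w) : z = w :=
  Subtype.ext (Prod.ext h1 h2)

/-- The map into a canonical pull-back. -/
def pbLift {X Y B Z : FinGSet G} (f : X →[G] Y) (q : B →[G] Y) (a : Z →[G] X) (b : Z →[G] B)
    (h : ∀ z, f (a z) = q (b z)) : Z →[G] pb f q :=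
  ⟨fun z => ⟨(a z, b z), h z⟩, fun g z =>
    Subtype.ext (Prod.ext (map_smul a g z) (map_smul b g z))⟩

theorem IsPullbackSq.ext {X' Y' X Y : FinGSet G} {f' : X' →[G] Y'} {x : X' →[G] X}
    {y : Y' →[G] Y} {f : X →[G] Y} (h : IsPullbackSq f' x y f) {z w : X'}
    (h1 : x z = x w) (h2 : f' z = f' w) : z = w :=
  (h.2 (x w) (f' w) (h.1 w)).unique ⟨h1, h2⟩ ⟨rfl, rfl⟩

theorem IsPullbackSq.symm {X' Y' X Y : FinGSet G} {f' : X' →[G] Y'} {x : X' →[G] X}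
    {y : Y' →[G] Y} {f : X →[G] Y} (h : IsPullbackSq f' x y f) : IsPullbackSq x f' f y :=
  ⟨fun z => (h.1 z).symm, fun a b e => by
    obtain ⟨z, ⟨h1, h2⟩, h3⟩ := h.2 b a e.symm
    exact ⟨z, ⟨h2, h1⟩, fun w hw => h3 w ⟨hw.2, hw.1⟩⟩⟩

theorem IsPullbackSq.pbLift_bijective {X' Y' X Y : FinGSet G} {f' : X' →[G] Y'} {x : X' →[G] X}
    {y : Y' →[G] Y} {f : X →[G] Y} (h : IsPullbackSq f' x y f) :
    Function.Bijective (pbLift f y x f' h.1) := by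
  refine ⟨fun z w e => h.ext ?_ ?_, fun z => ?_⟩
  · exact congrArg (pbFst f y) e
  · exact congrArg (pbSnd f y) e
  · obtain ⟨w, ⟨h1, h2⟩, -⟩ := h.2 _ _ z.2
    exact ⟨w, pb_ext h1 h2⟩

theorem isPullbackSq_of_bijective {X' Y' X Y : FinGSet G} {f' : X' →[G] Y'} {x : X' →[G] X}
    {y : Y' →[G] Y} {f : X →[G] Y} (h : ∀ z, f (x z) = y (f' z)) (hx : Function.Bijective x)
    (hy : Function.Bijective y) : IsPullbackSq f' x y f := by
  refine ⟨h, fun a b e => ?_⟩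
  obtain ⟨z, rfl⟩ := hx.2 a
  exact ⟨z, ⟨rfl, hy.1 (by rw [← h, e])⟩, fun w hw => hx.1 hw.1⟩

/-- A pointwise description of exponential diagrams. -/
theorem isExponential_iff {X Y A Z B : FinGSet G} {f : X →[G] Y} {p : A →[G] X} {l : Z →[G] A}
    {r : Z →[G] B} {q : B →[G] Y} :
    IsExponential f p l r q ↔
      IsPullbackSq r (p.comp l) q f ∧
      (∀ b b', q b = q b' →
        (∀ z z', r z = b → r z' = b' → p (l z) = p (l z') → l z = l z') → b = b') ∧
      (∀ y (σ : {x : X // f x = y} → A), (∀ x, p (σ x) = x.1) →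
        ∃ b, q b = y ∧ ∀ z, r z = b → ∀ hx : f (p (l z)) = y, l z = σ ⟨p (l z), hx⟩) := by
  constructor
  · rintro ⟨φ, ψ, hφ, hψ, h1, h2, h3⟩
    have hl : ∀ z, p (l z) = pbFst f (piProj f p) (ψ z) := fun z => by
      rw [← h3]; exact PiSet.sec_spec _ _
    have hpb : IsPullbackSq r (p.comp l) q f := by
      refine ⟨fun z => ?_, fun x b hx => ?_⟩
      · change f (p (l z)) = _
        rw [hl, ← h1, ← h2]
        exact (ψ z).2
      · obtain ⟨z, hz⟩ := hψ.2 ⟨(x, φ b), by rw [h1]; exact hx⟩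
        refine ⟨z, ⟨?_, ?_⟩, fun w hw => ?_⟩
        · change p (l z) = x
          rw [hl, hz]; rfl
        · apply hφ.1
          rw [← h2, hz]; rfl
        · apply hψ.1
          rw [hz]
          refine pb_ext ?_ ?_
          · rw [← hl]; exact hw.1
          · rw [h2, hw.2]; rfl
    refine ⟨hpb, fun b b' hb h => hφ.1 (PiSet.ext' ?_ ?_), fun y σ hσ => ?_⟩
    · exact (h1 b).trans (hb.trans (h1 b').symm)
    · intro x hs ht
      obtain ⟨z, ⟨z1, z2⟩, -⟩ := hpb.2 x b (hs.trans (h1 b))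
      obtain ⟨z', ⟨z1', z2'⟩, -⟩ := hpb.2 x b' (ht.trans (h1 b'))
      have key := h z z' z2 z2' (z1.trans z1'.symm)
      have e : ψ z = ⟨(x, φ b), hs⟩ :=
        pb_ext (by rw [← hl]; exact z1) (by rw [h2, z2]; rfl)
      have e' : ψ z' = ⟨(x, φ b'), ht⟩ :=
        pb_ext (by rw [← hl]; exact z1') (by rw [h2, z2']; rfl)
      rw [← h3, ← h3, e, e'] at key
      exact key
    · obtain ⟨b, hb⟩ := hφ.2 (⟨y, σ, hσ⟩ : PiSet f p)
      refine ⟨b, by rw [← h1, hb]; rfl, fun z hz hx => ?_⟩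
      have e : ψ z = ⟨(p (l z), (⟨y, σ, hσ⟩ : PiSet f p)), hx⟩ :=
        pb_ext (by rw [← hl]; rfl) (by rw [h2, hz, hb]; rfl)
      conv_lhs => rw [← h3, e]
      rfl
  · rintro ⟨hpb, hinj, hsurj⟩
    choose ev hev1 hev2 using fun (x : X) (b : B) (h : f x = q b) => (hpb.2 x b h).exists
    have hpl : ∀ x b h, p (l (ev x b h)) = x := hev1
    let φ : B →[G] piObj f p :=
      ⟨fun b => (⟨q b, fun x => l (ev x.1 b x.2), fun x => hpl _ _ _⟩ : PiSet f p), fun g b => by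
        refine PiSet.ext' (map_smul q g b) fun x hs ht => ?_
        change l (ev x (g • b) _) = g • l (ev (g⁻¹ • x) b _)
        rw [← map_smul]
        congr 1
        refine hpb.ext ?_ ?_
        · rw [hev1, map_smul, hev1, smul_inv_smul]
        · rw [hev2, map_smul, hev2]⟩
    have hφ : Function.Bijective φ := by
      refine ⟨fun b b' h => ?_, fun s => ?_⟩
      · refine hinj b b' (congrArg (fun s => PiSet.pt s) h) fun z z' hz hz' hzz => ?_
        have hx : f (p (l z)) = q b := by rw [← hz]; exact hpb.1 z
        have hx' : f (p (l z)) = q b' := by rw [hzz, ← hz']; exact hpb.1 z'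
        have e1 : z = ev (p (l z)) b hx := hpb.ext (by rw [hev1]; rfl) (by rw [hev2, hz])
        have e2 : z' = ev (p (l z)) b' hx' := hpb.ext (by rw [hev1, hzz]; rfl) (by rw [hev2, hz'])
        have key : ∀ (s t : PiSet f p), s = t → ∀ x hs ht, s.sec ⟨x, hs⟩ = t.sec ⟨x, ht⟩ := by
          rintro s t rfl x hs ht; rfl
        conv_lhs => rw [e1]
        conv_rhs => rw [e2]
        exact key _ _ h _ hx hx'
      · obtain ⟨b, hb, hz⟩ := hsurj s.pt s.sec s.sec_spec
        refine ⟨b, PiSet.ext' hb fun x hs ht => ?_⟩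
        change l (ev x b _) = _
        have e := hpl x b hs
        rw [hz (ev x b hs) (hev2 _ _ _) (by rw [e]; exact ht)]
        congr 2
    refine ⟨φ, pbLift f (piProj f p) (p.comp l) (φ.comp r) hpb.1, hφ, ⟨fun z w h => ?_, fun z => ?_⟩,
      fun b => rfl, fun z => rfl, fun z => ?_⟩
    · exact hpb.ext (congrArg (pbFst f (piProj f p)) h)
        (hφ.1 (congrArg (pbSnd f (piProj f p)) h))
    · obtain ⟨b, hb⟩ := hφ.2 (pbSnd f (piProj f p) z)
      have hx : f (pbFst f (piProj f p) z) = q b := by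
        refine z.2.trans ?_
        change piProj f p (pbSnd f (piProj f p) z) = _
        rw [← hb]; rfl
      refine ⟨ev _ b hx, pb_ext (hev1 _ _ _) ?_⟩
      change φ (r (ev _ b hx)) = _
      rw [hev2, hb]
    · change l (ev (p (l z)) (r z) (hpb.1 z)) = l z
      congr 1
      exact hpb.ext (hev1 _ _ _) (hev2 _ _ _)

theorem canonical_isExponential {X Y A : FinGSet G} (f : X →[G] Y) (p : A →[G] X) :
    IsExponential f p (piEval f p) (pbSnd f (piProj f p)) (piProj f p) :=
  ⟨MulActionHom.id G, MulActionHom.id G, Function.bijective_id, Function.bijective_id,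
    fun _ => rfl, fun _ => rfl, fun _ => rfl⟩

end FinGSet

namespace FinGSet

variable {G : Type u} [Group G]

theorem IsExponential.isPullbackSq {X Y A Z B : FinGSet G} {f : X →[G] Y} {p : A →[G] X}
    {l : Z →[G] A} {r : Z →[G] B} {q : B →[G] Y} (h : IsExponential f p l r q) :
    IsPullbackSq r (p.comp l) q f :=
  (isExponential_iff.1 h).1

theorem IsExponential.inj {X Y A Z B : FinGSet G} {f : X →[G] Y} {p : A →[G] X}
    {l : Z →[G] A} {r : Z →[G] B} {q : B →[G] Y} (h : IsExponential f p l r q) {b b' : B}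
    (hb : q b = q b')
    (hz : ∀ z z', r z = b → r z' = b' → p (l z) = p (l z') → l z = l z') : b = b' :=
  (isExponential_iff.1 h).2.1 b b' hb hz

theorem IsExponential.surj {X Y A Z B : FinGSet G} {f : X →[G] Y} {p : A →[G] X}
    {l : Z →[G] A} {r : Z →[G] B} {q : B →[G] Y} (h : IsExponential f p l r q) (y : Y)
    (σ : ∀ x : X, f x = y → A) (hσ : ∀ x hx, p (σ x hx) = x) :
    ∃ b, q b = y ∧ ∀ z x hx, r z = b → p (l z) = x → l z = σ x hx := by
  obtain ⟨b, h1, h2⟩ := (isExponential_iff.1 h).2.2 y (fun x => σ x.1 x.2) fun x => hσ x.1 x.2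
  refine ⟨b, h1, ?_⟩
  rintro z x hx hz rfl
  exact h2 z hz hx

theorem IsExponential.of {X Y A Z B : FinGSet G} {f : X →[G] Y} {p : A →[G] X}
    {l : Z →[G] A} {r : Z →[G] B} {q : B →[G] Y} (h1 : IsPullbackSq r (p.comp l) q f)
    (h2 : ∀ b b', q b = q b' →
      (∀ z z', r z = b → r z' = b' → p (l z) = p (l z') → l z = l z') → b = b')
    (h3 : ∀ y (σ : ∀ x : X, f x = y → A), (∀ x hx, p (σ x hx) = x) →
      ∃ b, q b = y ∧ ∀ z x hx, r z = b → p (l z) = x → l z = σ x hx) :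
    IsExponential f p l r q := by
  refine isExponential_iff.2 ⟨h1, h2, fun y σ hσ => ?_⟩
  obtain ⟨b, hb, hz⟩ := h3 y (fun x hx => σ ⟨x, hx⟩) fun x hx => hσ ⟨x, hx⟩
  exact ⟨b, hb, fun z h hx => hz z _ hx h rfl⟩

theorem IsPullbackSq.exists {X' Y' X Y : FinGSet G} {f' : X' →[G] Y'} {x : X' →[G] X}
    {y : Y' →[G] Y} {f : X →[G] Y} (h : IsPullbackSq f' x y f) (a : X) (b : Y')
    (e : f a = y b) : ∃ z, x z = a ∧ f' z = b :=
  (h.2 a b e).exists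

theorem IsPullbackSq.exists_lift {X' Y' X Y W : FinGSet G} {f' : X' →[G] Y'} {x : X' →[G] X}
    {y : Y' →[G] Y} {f : X →[G] Y} (h : IsPullbackSq f' x y f) (a : W →[G] X) (b : W →[G] Y')
    (e : ∀ w, f (a w) = y (b w)) :
    ∃ c : W →[G] X', (∀ w, x (c w) = a w) ∧ ∀ w, f' (c w) = b w := by
  choose c h1 h2 using fun w => h.exists (a w) (b w) (e w)
  refine ⟨⟨c, fun g w => h.ext ?_ ?_⟩, h1, h2⟩
  · rw [h1, map_smul, map_smul, h1]; rfl
  · rw [h2, map_smul, map_smul, h2]; rfl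

theorem isExponential_id {X A : FinGSet G} (p : A →[G] X) :
    IsExponential (MulActionHom.id G) p (MulActionHom.id G) (MulActionHom.id G) p := by
  refine IsExponential.of ⟨fun _ => rfl, fun a b h => ⟨b, ⟨h.symm, rfl⟩, fun w hw => hw.2⟩⟩ ?_ ?_
  · intro b b' hb h
    exact h b b' rfl rfl hb
  · intro y σ hσ
    refine ⟨σ y rfl, hσ _ _, ?_⟩
    have key : ∀ x hx, x = y → σ y rfl = σ x hx := by
      rintro x hx rfl
      rfl
    rintro z x hx rfl h
    exact key x hx hx

theorem isExponential_map_id {X Y : FinGSet G} (f : X →[G] Y) :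
    IsExponential f (MulActionHom.id G) (MulActionHom.id G) f (MulActionHom.id G) := by
  refine IsExponential.of ⟨fun _ => rfl, fun a b h => ⟨a, ⟨rfl, h⟩, fun w hw => hw.1⟩⟩ ?_ ?_
  · intro b b' hb _
    exact hb
  · intro y σ hσ
    refine ⟨y, rfl, ?_⟩
    rintro z x hx _ rfl
    exact (hσ _ _).symm

theorem IsExponential.comp {X Y W A Z Z' B C V : FinGSet G} {f : X →[G] Y} {g : Y →[G] W}
    {p : A →[G] X} {l : Z →[G] A} {r : Z →[G] B} {q : B →[G] Y} {l' : Z' →[G] B}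
    {r' : Z' →[G] C} {q' : C →[G] W} {v : V →[G] Z} {v' : V →[G] Z'}
    (hf : IsExponential f p l r q) (hg : IsExponential g q l' r' q')
    (hv : IsPullbackSq v' v l' r) :
    IsExponential (g.comp f) p (l.comp v) (r'.comp v') q' := by
  have hf1 := hf.isPullbackSq
  have hg1 := hg.isPullbackSq
  have c1 : ∀ z, f (p (l z)) = q (r z) := hf1.1
  have c2 : ∀ z, g (q (l' z)) = q' (r' z) := hg1.1
  refine IsExponential.of ⟨fun w => ?_, fun a c h => ?_⟩ ?_ ?_
  · change g (f (p (l (v w)))) = q' (r' (v' w))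
    rw [c1, hv.1, c2]
  · obtain ⟨z', h1, h2⟩ := hg1.exists (f a) c h
    obtain ⟨z, h3, h4⟩ := hf1.exists a (l' z') h1.symm
    obtain ⟨w, h5, h6⟩ := hv.exists z z' h4
    refine ⟨w, ⟨?_, ?_⟩, ?_⟩
    · change p (l (v w)) = a
      rw [h5]; exact h3
    · change r' (v' w) = c
      rw [h6]; exact h2
    · rintro w' ⟨e1, e2⟩
      have e1' : p (l (v w')) = a := e1
      have e3 : v' w' = z' := by
        refine hg1.ext ?_ (Eq.trans e2 h2.symm)
        rw [h1]
        change q (l' (v' w')) = f a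
        rw [← hv.1, ← c1, e1']
      refine hv.ext ?_ (by rw [e3, h6])
      rw [h5]
      refine hf1.ext (Eq.trans e1 h3.symm) ?_
      rw [hv.1, e3, h4]
  · intro c c' hc h
    refine hg.inj hc fun z z' hz hz' hzz => hf.inj hzz fun y y' hy hy' hyy => ?_
    obtain ⟨w, rfl, rfl⟩ := hv.exists y z hy
    obtain ⟨w', rfl, rfl⟩ := hv.exists y' z' hy'
    exact h w w' hz hz' hyy
  · intro w σ hσ
    choose b hb1 hb2 using fun (y : Y) (hy : g y = w) =>
      hf.surj y (fun x hx => σ x (by rw [← hy, ← hx]; rfl)) fun x hx => hσ _ _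
    obtain ⟨c, hc1, hc2⟩ := hg.surj w b hb1
    refine ⟨c, hc1, ?_⟩
    rintro u x hx hu rfl
    have e : g (q (l' (v' u))) = w := by
      rw [c2, ← hc1]
      exact congrArg q' hu
    refine hb2 (q (l' (v' u))) e (v u) (p (l (v u))) ?_ ?_ rfl
    · rw [← hv.1, ← c1]
    · rw [hv.1]
      exact hc2 (v' u) _ e hu rfl

theorem IsExponential.trans {X Y A Z B C C' W D : FinGSet G} {f : X →[G] Y} {p : A →[G] X}
    {l : Z →[G] A} {r : Z →[G] B} {q : B →[G] Y} {c : C →[G] A} {cl : C' →[G] C}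
    {c' : C' →[G] Z} {l' : W →[G] C'} {r' : W →[G] D} {q' : D →[G] B}
    (hf : IsExponential f p l r q) (hc : IsPullbackSq cl c' c l)
    (hr : IsExponential r c' l' r' q') :
    IsExponential f (p.comp c) (cl.comp l') r' (q.comp q') := by
  have hf1 := hf.isPullbackSq
  have hr1 := hr.isPullbackSq
  have c1 : ∀ z, f (p (l z)) = q (r z) := hf1.1
  have c2 : ∀ z, r (c' (l' z)) = q' (r' z) := hr1.1
  have c3 : ∀ w, c (cl (l' w)) = l (c' (l' w)) := fun w => (hc.1 _).symm
  refine IsExponential.of ⟨fun w => ?_, fun a d h => ?_⟩ ?_ ?_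
  · change f (p (c (cl (l' w)))) = q (q' (r' w))
    rw [c3, c1, c2]
  · obtain ⟨z, h1, h2⟩ := hf1.exists a (q' d) h
    obtain ⟨w, h3, h4⟩ := hr1.exists z d h2
    have h3' : c' (l' w) = z := h3
    refine ⟨w, ⟨?_, h4⟩, ?_⟩
    · change p (c (cl (l' w))) = a
      rw [c3, h3']; exact h1
    · rintro w' ⟨e1, e2⟩
      refine hr1.ext ?_ (e2.trans h4.symm)
      refine Eq.trans (hf1.ext ?_ ?_) h3.symm
      · rw [h1]
        change p (l (c' (l' w'))) = a
        rw [← c3]; exact e1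
      · rw [h2]
        change r (c' (l' w')) = q' d
        rw [c2, e2]
  · intro d d' hd h
    have key : ∀ w w', r' w = d → r' w' = d' → p (l (c' (l' w))) = p (l (c' (l' w'))) →
        cl (l' w) = cl (l' w') := fun w w' hw hw' e =>
      h w w' hw hw' (by
        change p (c (cl (l' w))) = p (c (cl (l' w')))
        rw [c3, c3, e])
    have hq : q' d = q' d' := by
      refine hf.inj hd fun z z' hz hz' hzz => ?_
      obtain ⟨w, rfl, hw⟩ := hr1.exists z d hz
      obtain ⟨w', rfl, hw'⟩ := hr1.exists z' d' hz'
      change l (c' (l' w)) = l (c' (l' w'))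
      rw [← c3, ← c3, key w w' hw hw' hzz]
    exact hr.inj hq fun w w' hw hw' e => hc.ext e (key w w' hw hw' (by rw [e]))
  · intro y σ hσ
    obtain ⟨b, hb1, hb2⟩ := hf.surj y (fun x hx => c (σ x hx)) hσ
    have hy : ∀ z, r z = b → f (p (l z)) = y := fun z hz => by rw [c1, hz, hb1]
    choose τ ht1 ht2 using fun (z : Z) (hz : r z = b) =>
      hc.exists z (σ (p (l z)) (hy z hz)) (hb2 z _ (hy z hz) hz rfl)
    obtain ⟨d, hd1, hd2⟩ := hr.surj b τ ht1
    refine ⟨d, (congrArg q hd1).trans hb1, ?_⟩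
    rintro w x hx hw rfl
    have e : r (c' (l' w)) = b := by rw [c2, hw, hd1]
    change cl (l' w) = _
    rw [hd2 w _ e hw rfl, ht2]
    congr 1
    exact congrArg p (c3 w).symm

theorem IsExponential.baseChange {X Y A Z B X' Y' A' Z' B' : FinGSet G} {f : X →[G] Y}
    {p : A →[G] X} {l : Z →[G] A} {r : Z →[G] B} {q : B →[G] Y} {f' : X' →[G] Y'}
    {p' : A' →[G] X'} {l' : Z' →[G] A'} {r' : Z' →[G] B'} {q' : B' →[G] Y'} {x : X' →[G] X}
    {y : Y' →[G] Y} {a : A' →[G] A} {b : B' →[G] B} {z : Z' →[G] Z}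
    (hf : IsExponential f p l r q) (h : IsPullbackSq f' x y f) (ha : IsPullbackSq a p' p x)
    (hb : IsPullbackSq b q' q y) (hz : IsPullbackSq z r' r b)
    (h1 : ∀ w, a (l' w) = l (z w)) (h2 : ∀ w, f' (p' (l' w)) = q' (r' w)) :
    IsExponential f' p' l' r' q' := by
  have hf1 := hf.isPullbackSq
  have c1 : ∀ z, f (p (l z)) = q (r z) := hf1.1
  have c2 : ∀ w, x (p' (l' w)) = p (l (z w)) := fun w => by rw [ha.1, h1]
  have hpb : IsPullbackSq r' (p'.comp l') q' f' := by
    refine ⟨h2, fun s t e => ?_⟩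
    obtain ⟨v, hv1, hv2⟩ := hf1.exists (x s) (b t) (by rw [h.1, e, hb.1])
    have hv1' : p (l v) = x s := hv1
    obtain ⟨w, rfl, rfl⟩ := hz.exists t v hv2.symm
    refine ⟨w, ⟨h.ext ?_ ?_, rfl⟩, ?_⟩
    · exact (c2 w).trans hv1'
    · rw [e]; exact h2 w
    · rintro w' ⟨e1, e2⟩
      refine hz.ext e2 (hf1.ext ?_ ?_)
      · refine Eq.trans ?_ hv1'.symm
        rw [← e1]; exact (c2 w').symm
      · rw [← hz.1, ← hz.1, e2]
  refine IsExponential.of hpb ?_ ?_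
  · intro s s' hs hss
    refine hb.ext hs (hf.inj ?_ fun v v' hv hv' hvv => ?_)
    · rw [← hb.1, ← hb.1, hs]
    · obtain ⟨w, rfl, rfl⟩ := hz.exists s v hv.symm
      obtain ⟨w', rfl, rfl⟩ := hz.exists s' v' hv'.symm
      rw [← h1, ← h1]
      refine congrArg a (hss w w' rfl rfl (h.ext ?_ ?_))
      · rw [c2, c2, hvv]
      · rw [h2, h2, hs]
  · intro t σ hσ
    have hex : ∀ s (hs : f s = y t), ∃ m : A, p m = s ∧ ∀ s' hs', x s' = s →
        a (σ s' hs') = m := by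
      intro s hs
      obtain ⟨s', rfl, h5⟩ := h.exists s t hs
      refine ⟨a (σ s' h5), by rw [← ha.1, hσ], ?_⟩
      intro s'' hs'' e
      have : s'' = s' := h.ext e (hs''.trans h5.symm)
      subst this
      rfl
    choose τ ht1 ht2 using hex
    obtain ⟨c, hc1, hc2⟩ := hf.surj (y t) τ ht1
    obtain ⟨d, rfl, rfl⟩ := hb.exists t c hc1.symm
    refine ⟨d, rfl, ?_⟩
    rintro w s hs rfl rfl
    refine ha.ext (hσ _ _).symm ?_
    have e : f (p (l (z w))) = y (q' (r' w)) := by rw [c1, ← hz.1, hb.1]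
    rw [h1, hc2 (z w) _ e (hz.1 w).symm rfl]
    exact (ht2 _ _ _ hs (c2 w)).symm

theorem IsExponential.prod {X Y A Z B A' Z' B' P D W : FinGSet G} {f : X →[G] Y}
    {p : A →[G] X} {l : Z →[G] A} {r : Z →[G] B} {q : B →[G] Y}
    {p' : A' →[G] X} {l' : Z' →[G] A'} {r' : Z' →[G] B'} {q' : B' →[G] Y}
    {a : P →[G] A} {a' : P →[G] A'} {d : D →[G] B} {d' : D →[G] B'} {z : W →[G] Z}
    {z' : W →[G] Z'} {ρ : W →[G] D} {lam : W →[G] P}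
    (h : IsExponential f p l r q) (h' : IsExponential f p' l' r' q')
    (hP : IsPullbackSq a' a p' p) (hD : IsPullbackSq d' d q' q) (hz : IsPullbackSq z ρ r d)
    (hz' : IsPullbackSq z' ρ r' d') (h1 : ∀ w, a (lam w) = l (z w))
    (h2 : ∀ w, a' (lam w) = l' (z' w)) :
    IsExponential f (p.comp a) lam ρ (q.comp d) := by
  have hp := h.isPullbackSq
  have hp' := h'.isPullbackSq
  have c1 : ∀ z, f (p (l z)) = q (r z) := hp.1
  have c2 : ∀ w, p (a (lam w)) = p (l (z w)) := fun w => by rw [h1]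
  have c3 : ∀ w, p (a (lam w)) = p' (l' (z' w)) := fun w => by rw [hP.1, h2]
  refine IsExponential.of ⟨fun w => ?_, fun s t e => ?_⟩ ?_ ?_
  · change f (p (a (lam w))) = q (d (ρ w))
    rw [c2, c1, hz.1]
  · obtain ⟨v, hv1, hv2⟩ := hp.exists s (d t) e
    obtain ⟨w, rfl, rfl⟩ := hz.exists t v hv2.symm
    refine ⟨w, ⟨(c2 w).trans hv1, rfl⟩, ?_⟩
    rintro w' ⟨e1, e2⟩
    refine hz.ext e2 (hp.ext ?_ ?_)
    · exact ((c2 w').symm.trans e1).trans hv1.symm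
    · rw [← hz.1, ← hz.1, e2]
  · intro t t' ht hw
    have key : ∀ w w', ρ w = t → ρ w' = t' → p (a (lam w)) = p (a (lam w')) →
        lam w = lam w' := hw
    refine hD.ext (h.inj ht fun v v' hv hv' hvv => ?_)
      (h'.inj ?_ fun v v' hv hv' hvv => ?_)
    · obtain ⟨w, rfl, rfl⟩ := hz.exists t v hv.symm
      obtain ⟨w', rfl, rfl⟩ := hz.exists t' v' hv'.symm
      rw [← h1, ← h1, key w w' rfl rfl (by rw [c2, c2, hvv])]
    · rw [← hD.1, ← hD.1]; exact ht
    · obtain ⟨w, rfl, rfl⟩ := hz'.exists t v hv.symm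
      obtain ⟨w', rfl, rfl⟩ := hz'.exists t' v' hv'.symm
      rw [← h2, ← h2, key w w' rfl rfl (by rw [c3, c3, hvv])]
  · intro y σ hσ
    obtain ⟨b, hb1, hb2⟩ := h.surj y (fun x hx => a (σ x hx)) hσ
    obtain ⟨b', hb1', hb2'⟩ := h'.surj y (fun x hx => a' (σ x hx)) fun x hx => by
      rw [← hP.1]; exact hσ x hx
    obtain ⟨t, rfl, rfl⟩ := hD.exists b b' (hb1.trans hb1'.symm)
    refine ⟨t, hb1, ?_⟩
    rintro w x hx rfl rfl
    refine hP.ext ?_ ?_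
    · rw [h1]
      exact hb2 (z w) _ hx (hz.1 w).symm (c2 w).symm
    · rw [h2]
      exact hb2' (z' w) _ hx (hz'.1 w).symm (c3 w).symm

end FinGSet

open FinGSet

/-- A semi-Mackey functor, with its commutative monoids written multiplicatively: `res` is the
contravariant part and `tr` the covariant one. -/
structure SemiMackey (G : Type u) [Group G] where
  obj : FinGSet G → Type (u + 1)
  [monoid : ∀ X, CommMonoid (obj X)]
  res : ∀ {X Y : FinGSet G}, (X →[G] Y) → (obj Y →* obj X)
  tr : ∀ {X Y : FinGSet G}, (X →[G] Y) → (obj X →* obj Y)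
  res_id : ∀ {X : FinGSet G} (m : obj X), res (MulActionHom.id G) m = m
  res_comp : ∀ {X Y Z : FinGSet G} (g : Y →[G] Z) (f : X →[G] Y) m, res (g.comp f) m = res f (res g m)
  tr_id : ∀ {X : FinGSet G} (m : obj X), tr (MulActionHom.id G) m = m
  tr_comp : ∀ {X Y Z : FinGSet G} (g : Y →[G] Z) (f : X →[G] Y) m, tr (g.comp f) m = tr g (tr f m)
  additive_empty : ∀ X : FinGSet G, IsEmpty X → Subsingleton (obj X)
  additive_sum : ∀ X Y : FinGSet G,
    Function.Bijective fun m : obj (sum X Y) => (res (inl X Y) m, res (inr X Y) m)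
  mackey : ∀ {X' Y' X Y : FinGSet G} {f' : X' →[G] Y'} {x : X' →[G] X} {y : Y' →[G] Y}
    {f : X →[G] Y}, IsPullbackSq f' x y f → ∀ m, res f (tr y m) = tr x (res f' m)

/-- A Tambara functor: `res` is the restriction, `tr` the additive transfer, `nm` the
multiplicative transfer. -/
structure Tambara (G : Type u) [Group G] where
  obj : FinGSet G → Type (u + 1)
  [ring : ∀ X, CommRing (obj X)]
  res : ∀ {X Y : FinGSet G}, (X →[G] Y) → (obj Y →+* obj X)
  tr : ∀ {X Y : FinGSet G}, (X →[G] Y) → (obj X →+ obj Y)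
  nm : ∀ {X Y : FinGSet G}, (X →[G] Y) → (obj X →* obj Y)
  res_id : ∀ {X : FinGSet G} (t : obj X), res (MulActionHom.id G) t = t
  res_comp : ∀ {X Y Z : FinGSet G} (g : Y →[G] Z) (f : X →[G] Y) t, res (g.comp f) t = res f (res g t)
  tr_id : ∀ {X : FinGSet G} (t : obj X), tr (MulActionHom.id G) t = t
  tr_comp : ∀ {X Y Z : FinGSet G} (g : Y →[G] Z) (f : X →[G] Y) t, tr (g.comp f) t = tr g (tr f t)
  nm_id : ∀ {X : FinGSet G} (t : obj X), nm (MulActionHom.id G) t = t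
  nm_comp : ∀ {X Y Z : FinGSet G} (g : Y →[G] Z) (f : X →[G] Y) t, nm (g.comp f) t = nm g (nm f t)
  additive_empty : ∀ X : FinGSet G, IsEmpty X → Subsingleton (obj X)
  additive_sum : ∀ X Y : FinGSet G,
    Function.Bijective fun t : obj (sum X Y) => (res (inl X Y) t, res (inr X Y) t)
  mackey_tr : ∀ {X' Y' X Y : FinGSet G} {f' : X' →[G] Y'} {x : X' →[G] X} {y : Y' →[G] Y}
    {f : X →[G] Y}, IsPullbackSq f' x y f → ∀ t, res f (tr y t) = tr x (res f' t)
  mackey_nm : ∀ {X' Y' X Y : FinGSet G} {f' : X' →[G] Y'} {x : X' →[G] X} {y : Y' →[G] Y}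
    {f : X →[G] Y}, IsPullbackSq f' x y f → ∀ t, res f (nm y t) = nm x (res f' t)
  distributive : ∀ {X Y A Z B : FinGSet G} {f : X →[G] Y} {p : A →[G] X} {l : Z →[G] A}
    {r : Z →[G] B} {q : B →[G] Y}, IsExponential f p l r q →
    ∀ t, nm f (tr p t) = tr q (nm r (res l t))

attribute [instance] SemiMackey.monoid Tambara.ring

namespace SemiMackey

variable {G : Type u} [Group G]

/-- A morphism of semi-Mackey functors. -/
@[ext]
structure Hom (M N : SemiMackey G) where
  app : ∀ X, M.obj X →* N.obj X
  res : ∀ {X Y : FinGSet G} (f : X →[G] Y) m, app X (M.res f m) = N.res f (app Y m)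
  tr : ∀ {X Y : FinGSet G} (f : X →[G] Y) m, app Y (M.tr f m) = N.tr f (app X m)

instance : Category (SemiMackey G) where
  Hom := Hom
  id M := ⟨fun _ => MonoidHom.id _, fun _ _ => rfl, fun _ _ => rfl⟩
  comp φ ψ := ⟨fun X => (ψ.app X).comp (φ.app X), fun f m => by simp [φ.res, ψ.res],
    fun f m => by simp [φ.tr, ψ.tr]⟩

theorem hom_ext {M N : SemiMackey G} {φ ψ : M ⟶ N} (h : ∀ X m, φ.app X m = ψ.app X m) : φ = ψ :=
  Hom.ext (funext fun X => MonoidHom.ext (h X))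

@[simp] theorem id_app (M : SemiMackey G) (X : FinGSet G) (m : M.obj X) :
    Hom.app (𝟙 M) X m = m := rfl

@[simp] theorem comp_app {M N P : SemiMackey G} (φ : M ⟶ N) (ψ : N ⟶ P) (X : FinGSet G)
    (m : M.obj X) : Hom.app (φ ≫ ψ) X m = ψ.app X (φ.app X m) := rfl

/-- A semi-Mackey functor is a Mackey functor if all its monoids are groups. -/
def isMackey (G : Type u) [Group G] : ObjectProperty (SemiMackey G) :=
  fun M => ∀ (X : FinGSet G) (m : M.obj X), IsUnit m

end SemiMackey

/-- The category of Mackey functors (written multiplicatively). -/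
abbrev Mackey (G : Type u) [Group G] : Type (u + 2) := (SemiMackey.isMackey G).FullSubcategory

namespace Tambara

variable {G : Type u} [Group G]

/-- A morphism of Tambara functors. -/
@[ext]
structure Hom (T S : Tambara G) where
  app : ∀ X, T.obj X →+* S.obj X
  res : ∀ {X Y : FinGSet G} (f : X →[G] Y) t, app X (T.res f t) = S.res f (app Y t)
  tr : ∀ {X Y : FinGSet G} (f : X →[G] Y) t, app Y (T.tr f t) = S.tr f (app X t)
  nm : ∀ {X Y : FinGSet G} (f : X →[G] Y) t, app Y (T.nm f t) = S.nm f (app X t)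

instance : Category (Tambara G) where
  Hom := Hom
  id T := ⟨fun _ => RingHom.id _, fun _ _ => rfl, fun _ _ => rfl, fun _ _ => rfl⟩
  comp φ ψ := ⟨fun X => (ψ.app X).comp (φ.app X), fun f m => by simp [φ.res, ψ.res],
    fun f m => by simp [φ.tr, ψ.tr], fun f m => by simp [φ.nm, ψ.nm]⟩

theorem hom_ext {T S : Tambara G} {φ ψ : T ⟶ S} (h : ∀ X t, φ.app X t = ψ.app X t) : φ = ψ :=
  Hom.ext (funext fun X => RingHom.ext (h X))

@[simp] theorem id_app (T : Tambara G) (X : FinGSet G) (t : T.obj X) :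
    Hom.app (𝟙 T) X t = t := rfl

@[simp] theorem comp_app {T S R : Tambara G} (φ : T ⟶ S) (ψ : S ⟶ R) (X : FinGSet G)
    (t : T.obj X) : Hom.app (φ ≫ ψ) X t = ψ.app X (φ.app X t) := rfl

/-- The multiplicative part of a Tambara functor. -/
def mul (T : Tambara G) : SemiMackey G where
  obj := T.obj
  res f := T.res f
  tr f := T.nm f
  res_id := T.res_id
  res_comp := T.res_comp
  tr_id := T.nm_id
  tr_comp := T.nm_comp
  additive_empty := T.additive_empty
  additive_sum := T.additive_sum
  mackey := T.mackey_nm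

/-- The functor taking the multiplicative part. -/
def mulFunctor (G : Type u) [Group G] : Tambara G ⥤ SemiMackey G where
  obj := mul
  map φ := ⟨fun X => (φ.app X).toMonoidHom, φ.res, φ.nm⟩
  map_id _ := rfl
  map_comp _ _ := rfl

section Lemmas

variable (T : Tambara G)

theorem tr_res_of_bijective {X Y : FinGSet G} {e : X →[G] Y} (he : Function.Bijective e)
    (t : T.obj Y) : T.tr e (T.res e t) = t := by
  have h : IsPullbackSq e e (MulActionHom.id G) (MulActionHom.id G : Y →[G] Y) :=
    isPullbackSq_of_bijective (fun _ => rfl) he Function.bijective_id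
  have := T.mackey_tr h t
  rw [T.tr_id, T.res_id] at this
  exact this.symm

theorem res_nm_of_bijective {X' Y' X Y : FinGSet G} {f' : X' →[G] Y'} {x : X' →[G] X}
    {y : Y' →[G] Y} {f : X →[G] Y} (h : ∀ z, f (x z) = y (f' z)) (hx : Function.Bijective x)
    (hy : Function.Bijective y) (t : T.obj X) : T.res y (T.nm f t) = T.nm f' (T.res x t) :=
  T.mackey_nm (isPullbackSq_of_bijective h hx hy).symm t

theorem isPullbackSq_inl (X Y : FinGSet G) :
    IsPullbackSq (MulActionHom.id G) (MulActionHom.id G) (inl X Y) (inl X Y) :=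
  ⟨fun _ => rfl, fun a _ h => ⟨a, ⟨rfl, Sum.inl_injective h⟩, fun _ hw => hw.1⟩⟩

theorem isPullbackSq_inr (X Y : FinGSet G) :
    IsPullbackSq (MulActionHom.id G) (MulActionHom.id G) (inr X Y) (inr X Y) :=
  ⟨fun _ => rfl, fun a _ h => ⟨a, ⟨rfl, Sum.inr_injective h⟩, fun _ hw => hw.1⟩⟩

theorem isPullbackSq_inl_inr (X Y : FinGSet G) :
    IsPullbackSq (fromEmpty Y) (fromEmpty X) (inr X Y) (inl X Y) :=
  ⟨fun z => z.elim, fun _ _ h => (Sum.inl_ne_inr h).elim⟩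

theorem res_inl_tr_inl {X Y : FinGSet G} (t : T.obj X) :
    T.res (inl X Y) (T.tr (inl X Y) t) = t := by
  rw [T.mackey_tr (isPullbackSq_inl X Y), T.tr_id, T.res_id]

theorem res_inr_tr_inr {X Y : FinGSet G} (t : T.obj Y) :
    T.res (inr X Y) (T.tr (inr X Y) t) = t := by
  rw [T.mackey_tr (isPullbackSq_inr X Y), T.tr_id, T.res_id]

theorem res_inl_nm_inl {X Y : FinGSet G} (t : T.obj X) :
    T.res (inl X Y) (T.nm (inl X Y) t) = t := by
  rw [T.mackey_nm (isPullbackSq_inl X Y), T.nm_id, T.res_id]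

theorem res_inr_nm_inr {X Y : FinGSet G} (t : T.obj Y) :
    T.res (inr X Y) (T.nm (inr X Y) t) = t := by
  rw [T.mackey_nm (isPullbackSq_inr X Y), T.nm_id, T.res_id]

theorem eq_zero_of_empty {X : FinGSet G} [h : IsEmpty X] (t : T.obj X) : t = 0 :=
  (T.additive_empty X h).elim _ _

theorem eq_one_of_empty {X : FinGSet G} [h : IsEmpty X] (t : T.obj X) : t = 1 :=
  (T.additive_empty X h).elim _ _

theorem res_inl_tr_inr {X Y : FinGSet G} (t : T.obj Y) :
    T.res (inl X Y) (T.tr (inr X Y) t) = 0 := by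
  rw [T.mackey_tr (isPullbackSq_inl_inr X Y), eq_zero_of_empty T (T.res _ t), map_zero]

theorem res_inr_tr_inl {X Y : FinGSet G} (t : T.obj X) :
    T.res (inr X Y) (T.tr (inl X Y) t) = 0 := by
  rw [T.mackey_tr (isPullbackSq_inl_inr X Y).symm, eq_zero_of_empty T (T.res _ t), map_zero]

theorem res_inl_nm_inr {X Y : FinGSet G} (t : T.obj Y) :
    T.res (inl X Y) (T.nm (inr X Y) t) = 1 := by
  rw [T.mackey_nm (isPullbackSq_inl_inr X Y), eq_one_of_empty T (T.res _ t), map_one]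

theorem res_inr_nm_inl {X Y : FinGSet G} (t : T.obj X) :
    T.res (inr X Y) (T.nm (inl X Y) t) = 1 := by
  rw [T.mackey_nm (isPullbackSq_inl_inr X Y).symm, eq_one_of_empty T (T.res _ t), map_one]

theorem sum_ext {X Y : FinGSet G} {t s : T.obj (sum X Y)}
    (h1 : T.res (inl X Y) t = T.res (inl X Y) s) (h2 : T.res (inr X Y) t = T.res (inr X Y) s) :
    t = s :=
  (T.additive_sum X Y).1 (Prod.ext h1 h2)

/-- The element of `T(X ⨿ Y)` with given restrictions to `X` and `Y`. -/
def pair {X Y : FinGSet G} (t : T.obj X) (s : T.obj Y) : T.obj (sum X Y) :=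
  T.tr (inl X Y) t + T.tr (inr X Y) s

@[simp] theorem res_inl_pair {X Y : FinGSet G} (t : T.obj X) (s : T.obj Y) :
    T.res (inl X Y) (T.pair t s) = t := by
  rw [pair, map_add, res_inl_tr_inl, res_inl_tr_inr, add_zero]

@[simp] theorem res_inr_pair {X Y : FinGSet G} (t : T.obj X) (s : T.obj Y) :
    T.res (inr X Y) (T.pair t s) = s := by
  rw [pair, map_add, res_inr_tr_inr, res_inr_tr_inl, zero_add]

theorem pair_eq_nm {X Y : FinGSet G} (t : T.obj X) (s : T.obj Y) :
    T.pair t s = T.nm (inl X Y) t * T.nm (inr X Y) s := by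
  apply sum_ext
  · rw [res_inl_pair, map_mul, res_inl_nm_inl, res_inl_nm_inr, mul_one]
  · rw [res_inr_pair, map_mul, res_inr_nm_inr, res_inr_nm_inl, one_mul]

theorem copair_comp_inl {X Y Z : FinGSet G} (f : X →[G] Z) (g : Y →[G] Z) :
    (copair f g).comp (inl X Y) = f := rfl

theorem copair_comp_inr {X Y Z : FinGSet G} (f : X →[G] Z) (g : Y →[G] Z) :
    (copair f g).comp (inr X Y) = g := rfl

theorem tr_copair_pair {X Y Z : FinGSet G} (f : X →[G] Z) (g : Y →[G] Z) (t : T.obj X)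
    (s : T.obj Y) : T.tr (copair f g) (T.pair t s) = T.tr f t + T.tr g s := by
  rw [pair, map_add, ← T.tr_comp, ← T.tr_comp, copair_comp_inl, copair_comp_inr]

theorem nm_copair_pair {X Y Z : FinGSet G} (f : X →[G] Z) (g : Y →[G] Z) (t : T.obj X)
    (s : T.obj Y) : T.nm (copair f g) (T.pair t s) = T.nm f t * T.nm g s := by
  rw [pair_eq_nm, map_mul, ← T.nm_comp, ← T.nm_comp, copair_comp_inl, copair_comp_inr]

theorem res_copair {X Y Z : FinGSet G} (f : X →[G] Z) (g : Y →[G] Z) (t : T.obj Z) :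
    T.res (copair f g) t = T.pair (T.res f t) (T.res g t) := by
  apply sum_ext
  · rw [res_inl_pair, ← T.res_comp, copair_comp_inl]
  · rw [res_inr_pair, ← T.res_comp, copair_comp_inr]

/-- The map `f ⨿ g`. -/
def sumMap {X Y X' Y' : FinGSet G} (f : X →[G] X') (g : Y →[G] Y') : sum X Y →[G] sum X' Y' :=
  copair ((inl X' Y').comp f) ((inr X' Y').comp g)

theorem tr_sumMap_pair {X Y X' Y' : FinGSet G} (f : X →[G] X') (g : Y →[G] Y') (t : T.obj X)
    (s : T.obj Y) : T.tr (sumMap f g) (T.pair t s) = T.pair (T.tr f t) (T.tr g s) := by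
  rw [sumMap, tr_copair_pair, T.tr_comp, T.tr_comp, pair]

theorem res_sumMap_pair {X Y X' Y' : FinGSet G} (f : X →[G] X') (g : Y →[G] Y') (t : T.obj X')
    (s : T.obj Y') : T.res (sumMap f g) (T.pair t s) = T.pair (T.res f t) (T.res g s) := by
  rw [sumMap, res_copair, T.res_comp, T.res_comp, res_inl_pair, res_inr_pair]

/-- Frobenius reciprocity. -/
theorem frobenius {X Y : FinGSet G} (f : X →[G] Y) (x : T.obj X) (y : T.obj Y) :
    T.tr f (x * T.res f y) = T.tr f x * y := by
  have h : IsExponential (copair (MulActionHom.id G) (MulActionHom.id G : Y →[G] Y))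
      (sumMap f (MulActionHom.id G)) (sumMap (MulActionHom.id G) f)
      (copair (MulActionHom.id G) (MulActionHom.id G : X →[G] X)) f := by
    rw [isExponential_iff]
    refine ⟨⟨?_, ?_⟩, ?_, ?_⟩
    · rintro (z | z) <;> rfl
    · rintro (a | a) b (h : a = f b)
      · subst h
        refine ⟨Sum.inl b, ⟨rfl, rfl⟩, ?_⟩
        rintro (w | w) ⟨h1, h2⟩
        · exact congrArg Sum.inl h2
        · exact (Sum.inr_ne_inl h1).elim
      · subst h
        refine ⟨Sum.inr b, ⟨rfl, rfl⟩, ?_⟩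
        rintro (w | w) ⟨h1, h2⟩
        · exact (Sum.inl_ne_inr h1).elim
        · exact congrArg Sum.inr h2
    · intro b b' hb h
      exact Sum.inl_injective
        (h (Sum.inl b) (Sum.inl b') rfl rfl (congrArg Sum.inl hb))
    · intro y σ hσ
      have h1 := hσ ⟨Sum.inl y, rfl⟩
      have h2 := hσ ⟨Sum.inr y, rfl⟩
      rcases e : σ ⟨Sum.inl y, rfl⟩ with b | b
      · rw [e] at h1
        have hb : f b = y := Sum.inl_injective h1
        refine ⟨b, hb, ?_⟩
        subst hb
        rintro (z | z) hz hx
        · obtain rfl : z = b := hz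
          exact e.symm
        · obtain rfl : z = b := hz
          rcases e' : σ ⟨Sum.inr (f z), rfl⟩ with c | c
          · rw [e'] at h2
            exact (Sum.inl_ne_inr h2).elim
          · rw [e'] at h2
            have : c = f z := Sum.inr_injective h2
            subst this
            exact e'.symm
      · rw [e] at h1
        exact (Sum.inr_ne_inl h1).elim
  have := T.distributive h (T.pair x y)
  rw [tr_sumMap_pair, nm_copair_pair, res_sumMap_pair, nm_copair_pair] at this
  simp only [T.nm_id, T.res_id, T.tr_id] at this
  exact this.symm

theorem frobenius' {X Y : FinGSet G} (f : X →[G] Y) (x : T.obj X) (y : T.obj Y) :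
    T.tr f (T.res f y * x) = y * T.tr f x := by
  rw [mul_comm, frobenius, mul_comm]

end Lemmas

end Tambara

namespace Tambara

variable {G : Type u} [Group G] (T S : Tambara G)

/-- Representatives `t ⊗ s` over `p : A → X`, with `t ∈ T(A)` and `s ∈ S(A)`, of elements of the
tensor product at `X`. -/
structure TensorRep (X : FinGSet G) where
  src : FinGSet G
  map : src →[G] X
  left : T.obj src
  right : S.obj src

/-- The relations `a^*(t) ⊗ s ∼ t ⊗ a_+(s)` and `a_+(t) ⊗ s ∼ t ⊗ a^*(s)` for the morphisms
`a : (A → X) ⟶ (A' → X)` of finite `G`-sets over `X`. -/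
inductive TensorRel {X : FinGSet G} : TensorRep T S X → TensorRep T S X → Prop
  | left {A A' : FinGSet G} (a : A →[G] A') (p : A' →[G] X) (t : T.obj A') (s : S.obj A) :
      TensorRel ⟨A, p.comp a, T.res a t, s⟩ ⟨A', p, t, S.tr a s⟩
  | right {A A' : FinGSet G} (a : A →[G] A') (p : A' →[G] X) (t : T.obj A) (s : S.obj A') :
      TensorRel ⟨A, p.comp a, t, S.res a s⟩ ⟨A', p, T.tr a t, s⟩

/-- The value at `X` of the tensor product of `T` and `S` over the Burnside functor. Every element
is of the form `[t ⊗ s]` for a single `t ⊗ s` over some `p : A → X`, the sum being given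
by disjoint unions, and the bilinearity of `⊗` and the existence of negatives are consequences
of the two relations. -/
def TensorObj (X : FinGSet G) : Type (u + 1) := Quot (TensorRel T S (X := X))

namespace TensorObj

variable {T S}

/-- The element `[t ⊗ s]_{(A, p)}`. -/
def mk {X A : FinGSet G} (p : A →[G] X) (t : T.obj A) (s : S.obj A) : TensorObj T S X :=
  Quot.mk _ ⟨A, p, t, s⟩

theorem ind {X : FinGSet G} {P : TensorObj T S X → Prop}
    (h : ∀ (A : FinGSet G) (p : A →[G] X) t s, P (mk p t s)) (x : TensorObj T S X) : P x :=
  Quot.ind (fun r => h r.src r.map r.left r.right) x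

theorem glueL {X A A' : FinGSet G} (a : A →[G] A') {p : A →[G] X} {p' : A' →[G] X} {t : T.obj A}
    {s : S.obj A} {t' : T.obj A'} {s' : S.obj A'} (hp : ∀ x, p' (a x) = p x)
    (ht : T.res a t' = t) (hs : S.tr a s = s') : mk p t s = mk p' t' s' := by
  subst ht hs
  obtain rfl : p'.comp a = p := MulActionHom.ext hp
  exact Quot.sound (TensorRel.left a p' t' s)

theorem glueR {X A A' : FinGSet G} (a : A →[G] A') {p : A →[G] X} {p' : A' →[G] X} {t : T.obj A}
    {s : S.obj A} {t' : T.obj A'} {s' : S.obj A'} (hp : ∀ x, p' (a x) = p x)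
    (ht : T.tr a t = t') (hs : S.res a s' = s) : mk p t s = mk p' t' s' := by
  subst ht hs
  obtain rfl : p'.comp a = p := MulActionHom.ext hp
  exact Quot.sound (TensorRel.right a p' t s')

theorem glueIso {X A A' : FinGSet G} (a : A →[G] A') (ha : Function.Bijective a) {p : A →[G] X}
    {p' : A' →[G] X} {t : T.obj A} {s : S.obj A} {t' : T.obj A'} {s' : S.obj A'}
    (hp : ∀ x, p' (a x) = p x) (ht : T.res a t' = t) (hs : S.res a s' = s) :
    mk p t s = mk p' t' s' :=
  glueL a hp ht (by rw [← hs, tr_res_of_bijective S ha])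

/-- The symmetry of the tensor product. -/
def swap {X : FinGSet G} : TensorObj T S X → TensorObj S T X :=
  Quot.lift (fun r => mk r.map r.right r.left) (by
    rintro _ _ (⟨a, p, t, s⟩ | ⟨a, p, t, s⟩)
    · exact glueR a (fun _ => rfl) rfl rfl
    · exact glueL a (fun _ => rfl) rfl rfl)

/-- The restriction `f^*`, through canonical pull-backs. -/
def res {X Y : FinGSet G} (f : X →[G] Y) : TensorObj T S Y → TensorObj T S X :=
  Quot.lift (fun r => mk (pbFst f r.map) (T.res (pbSnd f r.map) r.left)
    (S.res (pbSnd f r.map) r.right)) (by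
    have key : ∀ (T S : Tambara G) {A A' : FinGSet G} (a : A →[G] A') (p : A' →[G] Y)
        (t : T.obj A') (s : S.obj A),
        mk (T := T) (S := S) (pbFst f (p.comp a)) (T.res (pbSnd f (p.comp a)) (T.res a t))
          (S.res (pbSnd f (p.comp a)) s) =
        mk (pbFst f p) (T.res (pbSnd f p) t) (S.res (pbSnd f p) (S.tr a s)) := by
      intro T S A A' a p t s
      let b : pb f (p.comp a) →[G] pb f p :=
        pbLift f p (pbFst f (p.comp a)) (a.comp (pbSnd f (p.comp a))) fun z => z.2
      have hb : IsPullbackSq (pbSnd f (p.comp a)) b a (pbSnd f p) := by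
        refine ⟨fun _ => rfl, fun z c h => ⟨⟨(z.1.1, c), ?_⟩, ⟨?_, rfl⟩, ?_⟩⟩
        · exact z.2.trans (congrArg p h)
        · exact pb_ext rfl h.symm
        · rintro w ⟨rfl, rfl⟩
          rfl
      refine glueL b (fun _ => rfl) ?_ (S.mackey_tr hb s).symm
      rw [← T.res_comp, ← T.res_comp]
      rfl
    rintro _ _ (⟨a, p, t, s⟩ | ⟨a, p, t, s⟩)
    · exact key T S a p t s
    · exact congrArg swap (key S T a p s t))

/-- The additive transfer `f_+`. -/
def tr {X Y : FinGSet G} (f : X →[G] Y) : TensorObj T S X → TensorObj T S Y :=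
  Quot.lift (fun r => mk (f.comp r.map) r.left r.right) (by
    rintro _ _ (⟨a, p, t, s⟩ | ⟨a, p, t, s⟩)
    · exact glueL a (fun _ => rfl) rfl rfl
    · exact glueR a (fun _ => rfl) rfl rfl)

/-- The multiplicative transfer `f_•`, through canonical exponential diagrams. -/
def nm {X Y : FinGSet G} (f : X →[G] Y) : TensorObj T S X → TensorObj T S Y :=
  Quot.lift (fun r => mk (piProj f r.map)
    (T.nm (pbSnd f (piProj f r.map)) (T.res (piEval f r.map) r.left))
    (S.nm (pbSnd f (piProj f r.map)) (S.res (piEval f r.map) r.right))) (by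
    have key : ∀ (T S : Tambara G) {A A' : FinGSet G} (a : A →[G] A') (p : A' →[G] X)
        (t : T.obj A') (s : S.obj A),
        mk (T := T) (S := S) (piProj f (p.comp a))
          (T.nm (pbSnd f (piProj f (p.comp a))) (T.res (piEval f (p.comp a)) (T.res a t)))
          (S.nm (pbSnd f (piProj f (p.comp a))) (S.res (piEval f (p.comp a)) s)) =
        mk (piProj f p)
          (T.nm (pbSnd f (piProj f p)) (T.res (piEval f p) t))
          (S.nm (pbSnd f (piProj f p)) (S.res (piEval f p) (S.tr a s))) := by
      intro T S A A' a p t s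
      let α : piObj f (p.comp a) →[G] piObj f p :=
        ⟨fun σ => (⟨PiSet.pt σ, fun x => a (PiSet.sec σ x), fun x => PiSet.sec_spec σ x⟩ :
          PiSet f p), fun g σ => PiSet.ext' rfl fun x _ _ => map_smul a g _⟩
      let β : pb f (piProj f (p.comp a)) →[G] pb f (piProj f p) :=
        pbLift f (piProj f p) (pbFst f (piProj f (p.comp a)))
          (α.comp (pbSnd f (piProj f (p.comp a)))) fun z => z.2
      have hβ : IsPullbackSq β (pbSnd f (piProj f (p.comp a))) (pbSnd f (piProj f p)) α := by
        refine ⟨fun _ => rfl, fun σ z h => ⟨⟨(z.1.1, σ), ?_⟩, ⟨rfl, ?_⟩, ?_⟩⟩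
        · exact z.2.trans (congrArg (piProj f p) h).symm
        · exact pb_ext rfl h
        · rintro w ⟨rfl, rfl⟩
          rfl
      let lam : pb f (piProj f (p.comp a)) →[G] pb (piEval f p) a :=
        pbLift (piEval f p) a β (piEval f (p.comp a)) fun _ => rfl
      have hexp : IsExponential (pbSnd f (piProj f p)) (pbFst (piEval f p) a) lam
          (pbSnd f (piProj f (p.comp a))) α := by
        rw [isExponential_iff]
        refine ⟨hβ.symm, ?_, ?_⟩
        · intro σ τ hστ h
          have h0 : PiSet.pt σ = PiSet.pt τ := congrArg (piProj f p) hστ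
          refine PiSet.ext' h0 fun x hs ht => ?_
          have := h ⟨(x, σ), hs⟩ ⟨(x, τ), ht⟩ rfl rfl (pb_ext rfl hστ)
          exact congrArg (pbSnd (piEval f p) a) this
        · intro τ w hw
          have hw1 : ∀ x hx, pbFst (piEval f p) a (w ⟨⟨(x, τ), hx⟩, rfl⟩) = ⟨(x, τ), hx⟩ :=
            fun x hx => hw _
          have hw2 : ∀ z h, a (pbSnd (piEval f p) a (w ⟨z, h⟩)) = piEval f p z := fun z h => by
            exact (w ⟨z, h⟩).2.symm.trans (congrArg (piEval f p) (hw ⟨z, h⟩))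
          let σ : PiSet f (p.comp a) :=
            ⟨PiSet.pt τ, fun x => pbSnd (piEval f p) a (w ⟨⟨(x.1, τ), x.2⟩, rfl⟩), fun x => by
              exact (congrArg p (hw2 _ _)).trans (PiSet.sec_spec τ x)⟩
          have hσ : α σ = τ := PiSet.ext' rfl fun x hs ht => by
            exact hw2 _ _
          refine ⟨σ, hσ, ?_⟩
          rintro ⟨⟨x, ρ⟩, hx⟩ (rfl : ρ = σ) hz
          have e : pbFst (piEval f p) a (lam ⟨(x, σ), hx⟩) = ⟨(x, τ), hx⟩ := pb_ext rfl hσ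
          refine pb_ext (hw ⟨_, hz⟩).symm ?_
          change pbSnd (piEval f p) a (w ⟨⟨(x, τ), _⟩, rfl⟩) = _
          congr 3
          exact e.symm
      refine glueL α (fun _ => rfl) ?_ ?_
      · rw [T.mackey_nm hβ, ← T.res_comp, ← T.res_comp]
        rfl
      · rw [S.mackey_tr (pb_isPullbackSq (piEval f p) a), S.distributive hexp, ← S.res_comp]
        rfl
    rintro _ _ (⟨a, p, t, s⟩ | ⟨a, p, t, s⟩)
    · exact key T S a p t s
    · exact congrArg swap (key S T a p s t))

end TensorObj

end Tambara

namespace Tambara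

variable {G : Type u} [Group G] {T S : Tambara G}

namespace TensorObj

theorem res_mk {X Y B P : FinGSet G} {f : X →[G] Y} {q : B →[G] Y} {a : P →[G] X}
    {b : P →[G] B} (h : IsPullbackSq b a q f) (t : T.obj B) (s : S.obj B) :
    res f (mk q t s) = mk a (T.res b t) (S.res b s) :=
  (glueIso (pbLift f q a b h.1) h.pbLift_bijective (fun _ => rfl) (T.res_comp _ _ t).symm
    (S.res_comp _ _ s).symm).symm

theorem tr_mk {X Y A : FinGSet G} (f : X →[G] Y) (p : A →[G] X) (t : T.obj A) (s : S.obj A) :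
    tr f (mk p t s) = mk (f.comp p) t s := rfl

theorem nm_mk {X Y A Z B : FinGSet G} {f : X →[G] Y} {p : A →[G] X} {l : Z →[G] A}
    {r : Z →[G] B} {q : B →[G] Y} (h : IsExponential f p l r q) (t : T.obj A) (s : S.obj A) :
    nm f (mk p t s) = mk q (T.nm r (T.res l t)) (S.nm r (S.res l s)) := by
  obtain ⟨φ, ψ, hφ, hψ, h1, h2, h3⟩ := h
  obtain rfl : (piEval f p).comp ψ = l := MulActionHom.ext h3
  refine (glueIso φ hφ h1 ?_ ?_).symm
  · rw [res_nm_of_bijective T h2 hψ hφ, T.res_comp]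
  · rw [res_nm_of_bijective S h2 hψ hφ, S.res_comp]

/-- The sum of two elements, through the disjoint union. -/
def add {X : FinGSet G} : TensorObj T S X → TensorObj T S X → TensorObj T S X :=
  Quot.lift₂ (fun r r' => mk (copair r.map r'.map) (T.pair r.left r'.left)
    (S.pair r.right r'.right)) (by
      rintro r _ _ (⟨a, p, t, s⟩ | ⟨a, p, t, s⟩)
      · refine glueL (sumMap (MulActionHom.id G) a) ?_ ?_ ?_
        · rintro (x | x) <;> rfl
        · rw [res_sumMap_pair, T.res_id]
        · rw [tr_sumMap_pair, S.tr_id]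
      · refine glueR (sumMap (MulActionHom.id G) a) ?_ ?_ ?_
        · rintro (x | x) <;> rfl
        · rw [tr_sumMap_pair, T.tr_id]
        · rw [res_sumMap_pair, S.res_id]) (by
      rintro _ _ r (⟨a, p, t, s⟩ | ⟨a, p, t, s⟩)
      · refine glueL (sumMap a (MulActionHom.id G)) ?_ ?_ ?_
        · rintro (x | x) <;> rfl
        · rw [res_sumMap_pair, T.res_id]
        · rw [tr_sumMap_pair, S.tr_id]
      · refine glueR (sumMap a (MulActionHom.id G)) ?_ ?_ ?_
        · rintro (x | x) <;> rfl
        · rw [tr_sumMap_pair, T.tr_id]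
        · rw [res_sumMap_pair, S.res_id])

/-- The negative of an element. -/
def neg {X : FinGSet G} : TensorObj T S X → TensorObj T S X :=
  Quot.lift (fun r => mk r.map r.left (-r.right)) (by
    rintro _ _ (⟨a, p, t, s⟩ | ⟨a, p, t, s⟩)
    · exact glueL a (fun _ => rfl) rfl (map_neg _ _)
    · exact glueR a (fun _ => rfl) rfl (map_neg _ _))

theorem mul_comm_aux {X A B : FinGSet G} (p : A →[G] X) (q : B →[G] X) (t : T.obj A)
    (s : S.obj A) (t' : T.obj B) (s' : S.obj B) :
    mk (p.comp (pbFst p q)) (T.res (pbFst p q) t * T.res (pbSnd p q) t')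
      (S.res (pbFst p q) s * S.res (pbSnd p q) s') =
    mk (q.comp (pbFst q p)) (T.res (pbFst q p) t' * T.res (pbSnd q p) t)
      (S.res (pbFst q p) s' * S.res (pbSnd q p) s) := by
  have h : IsPullbackSq (pbFst p q) (pbSnd p q) p q := (pb_isPullbackSq p q).symm
  refine glueIso (pbLift q p (pbSnd p q) (pbFst p q) h.1) h.pbLift_bijective ?_ ?_ ?_
  · exact fun z => z.2.symm
  · rw [map_mul, ← T.res_comp, ← T.res_comp, mul_comm]
    rfl
  · rw [map_mul, ← S.res_comp, ← S.res_comp, mul_comm]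
    rfl

theorem mul_aux (T S : Tambara G) {X A B B' : FinGSet G} (p : A →[G] X) (a : B →[G] B')
    (q : B' →[G] X) (t : T.obj A) (s : S.obj A) (t' : T.obj B') (s' : S.obj B) :
    mk (p.comp (pbFst p (q.comp a)))
      (T.res (pbFst p (q.comp a)) t * T.res (pbSnd p (q.comp a)) (T.res a t'))
      (S.res (pbFst p (q.comp a)) s * S.res (pbSnd p (q.comp a)) s') =
    mk (p.comp (pbFst p q)) (T.res (pbFst p q) t * T.res (pbSnd p q) t')
      (S.res (pbFst p q) s * S.res (pbSnd p q) (S.tr a s')) := by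
  let b : pb p (q.comp a) →[G] pb p q :=
    pbLift p q (pbFst p (q.comp a)) (a.comp (pbSnd p (q.comp a))) fun z => z.2
  have hb : IsPullbackSq (pbSnd p (q.comp a)) b a (pbSnd p q) := by
    refine ⟨fun _ => rfl, fun z c h => ⟨⟨(z.1.1, c), ?_⟩, ⟨?_, rfl⟩, ?_⟩⟩
    · exact z.2.trans (congrArg q h)
    · exact pb_ext rfl h.symm
    · rintro w ⟨rfl, rfl⟩
      rfl
  have e : (pbFst p q).comp b = pbFst p (q.comp a) := rfl
  refine glueL b (fun _ => rfl) ?_ ?_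
  · rw [map_mul, ← T.res_comp, ← T.res_comp, ← T.res_comp]
    rfl
  · rw [S.mackey_tr hb, ← e, S.res_comp, frobenius']

/-- The product of two elements, through the canonical pull-back. -/
def mul {X : FinGSet G} : TensorObj T S X → TensorObj T S X → TensorObj T S X :=
  Quot.lift₂ (fun r r' => mk (r.map.comp (pbFst r.map r'.map))
    (T.res (pbFst r.map r'.map) r.left * T.res (pbSnd r.map r'.map) r'.left)
    (S.res (pbFst r.map r'.map) r.right * S.res (pbSnd r.map r'.map) r'.right)) (by
      rintro r _ _ (⟨a, p, t, s⟩ | ⟨a, p, t, s⟩)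
      · exact mul_aux T S r.map a p r.left r.right t s
      · exact congrArg swap (mul_aux S T r.map a p r.right r.left s t)) (by
      rintro _ _ r (⟨a, p, t, s⟩ | ⟨a, p, t, s⟩)
      · refine (mul_comm_aux _ _ _ _ _ _).trans (Eq.trans ?_ (mul_comm_aux _ _ _ _ _ _))
        exact mul_aux T S r.map a p r.left r.right t s
      · refine (mul_comm_aux _ _ _ _ _ _).trans (Eq.trans ?_ (mul_comm_aux _ _ _ _ _ _))
        exact congrArg swap (mul_aux S T r.map a p r.right r.left s t))

instance (X : FinGSet G) : Add (TensorObj T S X) := ⟨add⟩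
instance (X : FinGSet G) : Neg (TensorObj T S X) := ⟨neg⟩
instance (X : FinGSet G) : Mul (TensorObj T S X) := ⟨mul⟩
instance (X : FinGSet G) : Zero (TensorObj T S X) := ⟨mk (MulActionHom.id G) 1 0⟩
instance (X : FinGSet G) : One (TensorObj T S X) := ⟨mk (MulActionHom.id G) 1 1⟩

theorem zero_def (X : FinGSet G) : (0 : TensorObj T S X) = mk (MulActionHom.id G) 1 0 := rfl
theorem one_def (X : FinGSet G) : (1 : TensorObj T S X) = mk (MulActionHom.id G) 1 1 := rfl

theorem mk_add_mk {X A B : FinGSet G} (p : A →[G] X) (q : B →[G] X) (t : T.obj A)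
    (s : S.obj A) (t' : T.obj B) (s' : S.obj B) :
    mk p t s + mk q t' s' = mk (copair p q) (T.pair t t') (S.pair s s') := rfl

theorem mk_add {X A : FinGSet G} (p : A →[G] X) (t : T.obj A) (s s' : S.obj A) :
    mk p t s + mk p t s' = mk p t (s + s') := by
  refine glueL (copair (MulActionHom.id G) (MulActionHom.id G : A →[G] A)) ?_ ?_ ?_
  · rintro (x | x) <;> rfl
  · rw [res_copair, T.res_id]
  · rw [tr_copair_pair, S.tr_id, S.tr_id]

theorem neg_mk {X A : FinGSet G} (p : A →[G] X) (t : T.obj A) (s : S.obj A) :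
    -mk p t s = mk p t (-s) := rfl

theorem mk_zero {X A : FinGSet G} (p : A →[G] X) (t : T.obj A) :
    mk p t (0 : S.obj A) = 0 := by
  have h : ∀ {A : FinGSet G} (p : A →[G] X) (t : T.obj A),
      mk (fromEmpty X) 0 0 = mk p t (0 : S.obj A) := fun {A} p t =>
    glueL (fromEmpty A) (fun x => x.elim) (eq_zero_of_empty T _) (map_zero _)
  exact (h p t).symm.trans (h _ 1)

theorem mk_mul_mk {X A B P : FinGSet G} {p : A →[G] X} {q : B →[G] X} {a : P →[G] A}
    {b : P →[G] B} (h : IsPullbackSq b a q p) (t : T.obj A)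
    (s : S.obj A) (t' : T.obj B) (s' : S.obj B) :
    mk p t s * mk q t' s' =
      mk (p.comp a) (T.res a t * T.res b t') (S.res a s * S.res b s') := by
  refine (glueIso (pbLift p q a b h.1) h.pbLift_bijective (fun _ => rfl) ?_ ?_).symm
  · rw [map_mul, ← T.res_comp, ← T.res_comp]
    rfl
  · rw [map_mul, ← S.res_comp, ← S.res_comp]
    rfl

theorem common {X : FinGSet G} (x y : TensorObj T S X) :
    ∃ (A : FinGSet G) (p : A →[G] X) (t : T.obj A) (s s' : S.obj A),
      x = mk p t s ∧ y = mk p t s' := by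
  induction x using ind with | _ A p t s
  induction y using ind with | _ B q t' s'
  exact ⟨sum A B, copair p q, T.pair t t', S.tr (inl A B) s, S.tr (inr A B) s',
    glueL (inl A B) (fun _ => rfl) (res_inl_pair T _ _) rfl,
    glueL (inr A B) (fun _ => rfl) (res_inr_pair T _ _) rfl⟩

theorem common_three {X : FinGSet G} (x y z : TensorObj T S X) :
    ∃ (A : FinGSet G) (p : A →[G] X) (t : T.obj A) (s s' s'' : S.obj A),
      x = mk p t s ∧ y = mk p t s' ∧ z = mk p t s'' := by
  obtain ⟨A, p, t, s, s', rfl, rfl⟩ := common x y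
  induction z using ind with | _ B q t' s''
  exact ⟨sum A B, copair p q, T.pair t t', S.tr (inl A B) s, S.tr (inl A B) s',
    S.tr (inr A B) s'',
    glueL (inl A B) (fun _ => rfl) (res_inl_pair T _ _) rfl,
    glueL (inl A B) (fun _ => rfl) (res_inl_pair T _ _) rfl,
    glueL (inr A B) (fun _ => rfl) (res_inr_pair T _ _) rfl⟩

theorem mul_comm' {X : FinGSet G} (x y : TensorObj T S X) : x * y = y * x := by
  induction x using ind with | _ A p t s
  induction y using ind with | _ B q t' s'
  exact mul_comm_aux p q t s t' s'

theorem mul_add' {X : FinGSet G} (x y z : TensorObj T S X) : x * (y + z) = x * y + x * z := by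
  obtain ⟨B, q, t', s', s'', rfl, rfl⟩ := common y z
  induction x using ind with | _ A p t s
  rw [mk_add, mk_mul_mk (pb_isPullbackSq p q), mk_mul_mk (pb_isPullbackSq p q),
    mk_mul_mk (pb_isPullbackSq p q), mk_add, map_add, mul_add]

theorem one_mul' {X : FinGSet G} (x : TensorObj T S X) : 1 * x = x := by
  induction x using ind with | _ A p t s
  have h : IsPullbackSq (MulActionHom.id G) p p (MulActionHom.id G) :=
    ⟨fun _ => rfl, fun a b h => ⟨b, ⟨h.symm, rfl⟩, fun w hw => hw.2⟩⟩
  rw [one_def, mk_mul_mk h, map_one, map_one, one_mul, one_mul, T.res_id, S.res_id]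
  rfl

theorem mul_assoc' {X : FinGSet G} (x y z : TensorObj T S X) : x * y * z = x * (y * z) := by
  induction x using ind with | _ A p t s
  induction y using ind with | _ B q t' s'
  induction z using ind with | _ C r t'' s''
  have h1 := pb_isPullbackSq p q
  have h2 := pb_isPullbackSq q r
  have h3 := pb_isPullbackSq (p.comp (pbFst p q)) r
  let d : pb (p.comp (pbFst p q)) r →[G] pb q r :=
    pbLift q r ((pbSnd p q).comp (pbFst (p.comp (pbFst p q)) r))
      (pbSnd (p.comp (pbFst p q)) r) fun z => (h1.1 _).symm.trans z.2
  have h4 : IsPullbackSq d ((pbFst p q).comp (pbFst (p.comp (pbFst p q)) r))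
      (q.comp (pbFst q r)) p := by
    refine ⟨fun z => h1.1 _, fun a b h => ⟨⟨(⟨(a, b.1.1), h⟩, b.1.2), ?_⟩, ⟨rfl, rfl⟩, ?_⟩⟩
    · exact h.trans b.2
    · rintro w ⟨rfl, rfl⟩
      rfl
  rw [mk_mul_mk h1, mk_mul_mk h2, mk_mul_mk h3, mk_mul_mk h4]
  simp only [map_mul, ← T.res_comp, ← S.res_comp, mul_assoc]
  rfl

instance (X : FinGSet G) : CommRing (TensorObj T S X) where
  add_assoc x y z := by
    obtain ⟨A, p, t, s, s', s'', rfl, rfl, rfl⟩ := common_three x y z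
    simp only [mk_add, add_assoc]
  zero_add x := by
    induction x using ind with | _ A p t s
    rw [← mk_zero p t, mk_add, zero_add]
  add_zero x := by
    induction x using ind with | _ A p t s
    rw [← mk_zero p t, mk_add, add_zero]
  add_comm x y := by
    obtain ⟨A, p, t, s, s', rfl, rfl⟩ := common x y
    rw [mk_add, mk_add, add_comm]
  neg_add_cancel x := by
    induction x using ind with | _ A p t s
    rw [neg_mk, mk_add, neg_add_cancel, mk_zero]
  mul_assoc := mul_assoc'
  one_mul := one_mul'
  mul_one x := by rw [mul_comm', one_mul']
  left_distrib := mul_add'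
  right_distrib x y z := by rw [mul_comm', mul_add', mul_comm' z, mul_comm' z]
  mul_comm := mul_comm'
  zero_mul x := by
    induction x using ind with | _ A p t s
    rw [mul_comm', zero_def, mk_mul_mk (pb_isPullbackSq p _), map_zero, mul_zero]
    exact mk_zero _ _
  mul_zero x := by
    induction x using ind with | _ A p t s
    rw [zero_def, mk_mul_mk (pb_isPullbackSq p _), map_zero, mul_zero]
    exact mk_zero _ _
  nsmul := nsmulRec
  zsmul := zsmulRec

end TensorObj

end Tambara

namespace Tambara

variable {G : Type u} [Group G] {T S : Tambara G}

theorem res_res_eq (T : Tambara G) {W A C B : FinGSet G} {g : W →[G] A} {f : A →[G] C}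
    {k : W →[G] B} {h : B →[G] C} (e : ∀ w, f (g w) = h (k w)) (t : T.obj C) :
    T.res g (T.res f t) = T.res k (T.res h t) := by
  rw [← T.res_comp, ← T.res_comp]
  congr 2
  exact MulActionHom.ext e

theorem tr_tr_eq (T : Tambara G) {W A C B : FinGSet G} {g : W →[G] A} {f : A →[G] C}
    {k : W →[G] B} {h : B →[G] C} (e : ∀ w, f (g w) = h (k w)) (t : T.obj W) :
    T.tr f (T.tr g t) = T.tr h (T.tr k t) := by
  rw [← T.tr_comp, ← T.tr_comp]
  congr 2
  exact MulActionHom.ext e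

namespace TensorObj

theorem mk_congr {X A : FinGSet G} {p p' : A →[G] X} {t t' : T.obj A} {s s' : S.obj A}
    (hp : ∀ w, p w = p' w) (ht : t = t') (hs : s = s') : mk p t s = mk p' t' s' := by
  subst ht hs
  congr 1
  exact MulActionHom.ext hp

theorem res_add {X Y : FinGSet G} (f : X →[G] Y) (x y : TensorObj T S Y) :
    res f (x + y) = res f x + res f y := by
  obtain ⟨B, q, t, s, s', rfl, rfl⟩ := common x y
  have h := pb_isPullbackSq f q
  rw [mk_add, res_mk h, res_mk h, res_mk h, mk_add, map_add]

theorem res_mul {X Y : FinGSet G} (f : X →[G] Y) (x y : TensorObj T S Y) :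
    res f (x * y) = res f x * res f y := by
  induction x using ind with | _ A p t s
  induction y using ind with | _ B q t' s'
  have h := pb_isPullbackSq p q
  have hp := pb_isPullbackSq f p
  have hq := pb_isPullbackSq f q
  have h' := pb_isPullbackSq f (p.comp (pbFst p q))
  obtain ⟨a, ha1, ha2⟩ := hp.exists_lift (pbFst f (p.comp (pbFst p q)))
    ((pbFst p q).comp (pbSnd f (p.comp (pbFst p q)))) h'.1
  obtain ⟨b, hb1, hb2⟩ := hq.exists_lift (pbFst f (p.comp (pbFst p q)))
    ((pbSnd p q).comp (pbSnd f (p.comp (pbFst p q)))) fun w => (h'.1 w).trans (h.1 _)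
  have hab : IsPullbackSq b a (pbFst f q) (pbFst f p) := by
    refine ⟨fun w => (ha1 w).trans (hb1 w).symm, fun u v e => ?_⟩
    have e1 : f (pbFst f p u) = p (pbSnd f p u) := hp.1 u
    have e2 : f (pbFst f q v) = q (pbSnd f q v) := hq.1 v
    obtain ⟨c, hc1, hc2⟩ := h.exists (pbSnd f p u) (pbSnd f q v) (by rw [← e1, ← e2, e])
    obtain ⟨w, hw1, hw2⟩ := h'.exists (pbFst f p u) c (by rw [e1, ← hc1]; rfl)
    refine ⟨w, ⟨hp.ext ?_ ?_, hq.ext ?_ ?_⟩, ?_⟩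
    · rw [ha1, hw1]
    · rw [ha2, ← hc1, ← hw2]; rfl
    · rw [hb1, hw1, e]
    · rw [hb2, ← hc2, ← hw2]; rfl
    · rintro w' ⟨e3, e4⟩
      refine h'.ext ?_ (h.ext ?_ ?_)
      · rw [hw1, ← ha1, e3]
      · rw [hw2, hc1, ← e3, ha2]; rfl
      · rw [hw2, hc2, ← e4, hb2]; rfl
  rw [mk_mul_mk h, res_mk h', res_mk hp, res_mk hq, mk_mul_mk hab]
  refine mk_congr (fun w => (ha1 w).symm) ?_ ?_
  · rw [map_mul, T.res_res_eq (h := pbFst p q) ha2, T.res_res_eq (h := pbSnd p q) hb2]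
  · rw [map_mul, S.res_res_eq (h := pbFst p q) ha2, S.res_res_eq (h := pbSnd p q) hb2]

theorem res_one {X Y : FinGSet G} (f : X →[G] Y) : res f (1 : TensorObj T S Y) = 1 := by
  have h : IsPullbackSq f (MulActionHom.id G) (MulActionHom.id G) f :=
    ⟨fun _ => rfl, fun a b h => ⟨a, ⟨rfl, h⟩, fun w hw => hw.1⟩⟩
  rw [one_def, res_mk h, map_one, map_one, one_def]

theorem res_zero {X Y : FinGSet G} (f : X →[G] Y) : res f (0 : TensorObj T S Y) = 0 := by
  rw [zero_def, res_mk (pb_isPullbackSq f _), map_zero, mk_zero, zero_def]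

theorem tr_add {X Y : FinGSet G} (f : X →[G] Y) (x y : TensorObj T S X) :
    tr f (x + y) = tr f x + tr f y := by
  obtain ⟨B, q, t, s, s', rfl, rfl⟩ := common x y
  rw [mk_add, tr_mk, tr_mk, tr_mk, mk_add]

theorem tr_zero {X Y : FinGSet G} (f : X →[G] Y) : tr f (0 : TensorObj T S X) = 0 :=
  mk_zero _ _

theorem nm_one {X Y : FinGSet G} (f : X →[G] Y) : nm f (1 : TensorObj T S X) = 1 := by
  rw [one_def, nm_mk (isExponential_map_id f), T.res_id, S.res_id, map_one, map_one, one_def]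

end TensorObj

end Tambara

namespace Tambara

variable {G : Type u} [Group G] {T S : Tambara G}

namespace TensorObj

theorem nm_mul {X Y : FinGSet G} (f : X →[G] Y) (x y : TensorObj T S X) :
    nm f (x * y) = nm f x * nm f y := by
  induction x using ind with | _ A p t s
  induction y using ind with | _ B q t' s'
  have h := canonical_isExponential f p
  have h' := canonical_isExponential f q
  have hP := pb_isPullbackSq p q
  have hD := pb_isPullbackSq (piProj f p) (piProj f q)
  have hz := (pb_isPullbackSq (pbSnd f (piProj f p)) (pbFst (piProj f p) (piProj f q))).symm
  obtain ⟨z', hz1, hz2⟩ := h'.isPullbackSq.exists_lift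
    ((p.comp (piEval f p)).comp (pbFst (pbSnd f (piProj f p)) (pbFst (piProj f p) (piProj f q))))
    ((pbSnd (piProj f p) (piProj f q)).comp
      (pbSnd (pbSnd f (piProj f p)) (pbFst (piProj f p) (piProj f q)))) (fun w => by
        refine (h.isPullbackSq.1 _).trans (Eq.trans ?_ (hD.1 _))
        exact congrArg (piProj f p) (hz.1 w).symm)
  have hz' : IsPullbackSq z' (pbSnd (pbSnd f (piProj f p)) (pbFst (piProj f p) (piProj f q)))
      (pbSnd f (piProj f q)) (pbSnd (piProj f p) (piProj f q)) := by
    refine ⟨fun w => (hz2 w).symm, fun d v e => ?_⟩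
    have e1 := h'.isPullbackSq.1 v
    obtain ⟨u, hu1, hu2⟩ := h.isPullbackSq.exists (q (piEval f q v))
      (pbFst (piProj f p) (piProj f q) d) (by rw [hD.1, e]; exact e1)
    obtain ⟨w, rfl, rfl⟩ := hz.exists d u hu2.symm
    refine ⟨w, ⟨rfl, h'.isPullbackSq.ext ?_ ?_⟩, ?_⟩
    · exact (hz1 w).trans hu1
    · rw [hz2]; exact e
    · rintro w' ⟨e2, rfl⟩
      refine hz.ext e2 (h.isPullbackSq.ext ?_ ?_)
      · exact (hz1 w').symm.trans hu1.symm
      · rw [← hz.1, ← hz.1, e2]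
  obtain ⟨lam, hl1, hl2⟩ := hP.exists_lift
    ((piEval f p).comp (pbFst (pbSnd f (piProj f p)) (pbFst (piProj f p) (piProj f q))))
    ((piEval f q).comp z') fun w => (hz1 w).symm
  have hexp := h.prod h' hP hD hz hz' hl1 hl2
  rw [mk_mul_mk hP, nm_mk h, nm_mk h', mk_mul_mk hD, nm_mk hexp]
  refine mk_congr (fun _ => rfl) ?_ ?_
  · rw [T.mackey_nm hz, T.mackey_nm hz', map_mul, map_mul,
      T.res_res_eq (h := piEval f p) hl1, T.res_res_eq (h := piEval f q) hl2]
  · rw [S.mackey_nm hz, S.mackey_nm hz', map_mul, map_mul,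
      S.res_res_eq (h := piEval f p) hl1, S.res_res_eq (h := piEval f q) hl2]

theorem res_id {X : FinGSet G} (x : TensorObj T S X) : res (MulActionHom.id G) x = x := by
  induction x using ind with | _ A p t s
  have h : IsPullbackSq (MulActionHom.id G) p p (MulActionHom.id G) :=
    ⟨fun _ => rfl, fun a b h => ⟨b, ⟨h.symm, rfl⟩, fun w hw => hw.2⟩⟩
  rw [res_mk h, T.res_id, S.res_id]

theorem res_comp {X Y Z : FinGSet G} (g : Y →[G] Z) (f : X →[G] Y) (x : TensorObj T S Z) :
    res (g.comp f) x = res f (res g x) := by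
  induction x using ind with | _ A p t s
  have h1 := pb_isPullbackSq g p
  have h2 := pb_isPullbackSq f (pbFst g p)
  have h : IsPullbackSq ((pbSnd g p).comp (pbSnd f (pbFst g p))) (pbFst f (pbFst g p)) p
      (g.comp f) := by
    refine ⟨fun w => (congrArg g (h2.1 w)).trans (h1.1 _), fun a b e => ?_⟩
    obtain ⟨u, hu1, hu2⟩ := h1.exists (f a) b e
    obtain ⟨w, rfl, rfl⟩ := h2.exists a u hu1.symm
    refine ⟨w, ⟨rfl, hu2⟩, ?_⟩
    rintro w' ⟨e1, e2⟩
    refine h2.ext e1 (h1.ext ?_ (Eq.trans e2 hu2.symm))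
    rw [← h2.1, ← h2.1, e1]
  rw [res_mk h, res_mk h1, res_mk h2, T.res_comp, S.res_comp]

theorem nm_id {X : FinGSet G} (x : TensorObj T S X) : nm (MulActionHom.id G) x = x := by
  induction x using ind with | _ A p t s
  rw [nm_mk (isExponential_id p), T.res_id, T.nm_id, S.res_id, S.nm_id]

theorem nm_comp {X Y Z : FinGSet G} (g : Y →[G] Z) (f : X →[G] Y) (x : TensorObj T S X) :
    nm (g.comp f) x = nm g (nm f x) := by
  induction x using ind with | _ A p t s
  have hf := canonical_isExponential f p
  have hg := canonical_isExponential g (piProj f p)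
  have hv := (pb_isPullbackSq (pbSnd f (piProj f p)) (piEval g (piProj f p)))
  rw [nm_mk (hf.comp hg hv), nm_mk hf, nm_mk hg, T.mackey_nm hv.symm, S.mackey_nm hv.symm,
    T.res_comp, S.res_comp, T.nm_comp, S.nm_comp]

end TensorObj

end Tambara

namespace Tambara

variable {G : Type u} [Group G] {T S : Tambara G}

namespace TensorObj

theorem mackey_tr {X' Y' X Y : FinGSet G} {f' : X' →[G] Y'} {x : X' →[G] X} {y : Y' →[G] Y}
    {f : X →[G] Y} (h : IsPullbackSq f' x y f) (m : TensorObj T S Y') :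
    res f (tr y m) = tr x (res f' m) := by
  induction m using ind with | _ A p t s
  have h1 := pb_isPullbackSq f' p
  have h2 : IsPullbackSq (pbSnd f' p) (x.comp (pbFst f' p)) (y.comp p) f := by
    refine ⟨fun w => (h.1 _).trans (congrArg y (h1.1 w)), fun a b e => ?_⟩
    obtain ⟨u, hu1, hu2⟩ := h.exists a (p b) e
    obtain ⟨w, rfl, rfl⟩ := h1.exists u b hu2
    refine ⟨w, ⟨hu1, rfl⟩, ?_⟩
    rintro w' ⟨e1, e2⟩
    refine h1.ext (h.ext (Eq.trans e1 hu1.symm) ?_) e2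
    rw [h1.1, h1.1, e2]
  rw [tr_mk, res_mk h2, res_mk h1, tr_mk]

theorem mackey_nm {X' Y' X Y : FinGSet G} {f' : X' →[G] Y'} {x : X' →[G] X} {y : Y' →[G] Y}
    {f : X →[G] Y} (h : IsPullbackSq f' x y f) (m : TensorObj T S Y') :
    res f (nm y m) = nm x (res f' m) := by
  induction m using ind with | _ A p t s
  have hy := canonical_isExponential y p
  have ha := pb_isPullbackSq f' p
  have hb := pb_isPullbackSq f (piProj y p)
  have hz := pb_isPullbackSq (pbSnd f (piProj y p)) (pbSnd y (piProj y p))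
  obtain ⟨v, hv1, hv2⟩ := h.exists_lift
    ((pbFst f (piProj y p)).comp (pbFst (pbSnd f (piProj y p)) (pbSnd y (piProj y p))))
    ((p.comp (piEval y p)).comp (pbSnd (pbSnd f (piProj y p)) (pbSnd y (piProj y p))))
    (fun w => (hb.1 _).trans ((congrArg (piProj y p) (hz.1 w)).trans
      (hy.isPullbackSq.1 _).symm))
  obtain ⟨l, hl1, hl2⟩ := ha.exists_lift v
    ((piEval y p).comp (pbSnd (pbSnd f (piProj y p)) (pbSnd y (piProj y p)))) hv2
  have hexp := hy.baseChange h.symm ha hb hz hl2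
    (fun w => (congrArg x (hl1 w)).trans (hv1 w))
  rw [res_mk ha, nm_mk hexp, nm_mk hy, res_mk hb, T.mackey_nm hz, S.mackey_nm hz,
    T.res_res_eq (h := piEval y p) hl2, S.res_res_eq (h := piEval y p) hl2]

theorem distributive {X Y A Z B : FinGSet G} {f : X →[G] Y} {p : A →[G] X} {l : Z →[G] A}
    {r : Z →[G] B} {q : B →[G] Y} (h : IsExponential f p l r q) (m : TensorObj T S A) :
    nm f (tr p m) = tr q (nm r (res l m)) := by
  induction m using ind with | _ C c t s
  have hc := pb_isPullbackSq l c
  have hr := canonical_isExponential r (pbFst l c)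
  rw [tr_mk, nm_mk (h.trans hc hr), res_mk hc, nm_mk hr, tr_mk, T.res_comp, S.res_comp]

theorem subsingleton (X : FinGSet G) (h : IsEmpty X) : Subsingleton (TensorObj T S X) := by
  refine ⟨fun x y => ?_⟩
  have key : ∀ x : TensorObj T S X, x = 0 := fun x => by
    induction x using ind with | _ A p t s
    have : IsEmpty A := ⟨fun a => h.elim (p a)⟩
    rw [eq_zero_of_empty S s, mk_zero]
  rw [key x, key y]

theorem eq_add (X Y : FinGSet G) (x : TensorObj T S (sum X Y)) :
    x = tr (inl X Y) (res (inl X Y) x) + tr (inr X Y) (res (inr X Y) x) := by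
  induction x using ind with | _ A p t s
  have h1 := pb_isPullbackSq (inl X Y) p
  have h2 := pb_isPullbackSq (inr X Y) p
  rw [res_mk h1, res_mk h2, tr_mk, tr_mk, mk_add_mk]
  refine (glueIso (copair (pbSnd (inl X Y) p) (pbSnd (inr X Y) p)) ⟨?_, ?_⟩ ?_ ?_ ?_).symm
  · rintro (a | a) (b | b) (e : pbSnd _ p a = pbSnd _ p b)
    · refine congrArg Sum.inl (h1.ext (Sum.inl_injective (β := Y) ?_) e)
      exact (h1.1 a).trans ((congrArg p e).trans (h1.1 b).symm)
    · exact (Sum.inl_ne_inr ((h1.1 a).trans ((congrArg p e).trans (h2.1 b).symm))).elim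
    · exact (Sum.inr_ne_inl ((h2.1 a).trans ((congrArg p e).trans (h1.1 b).symm))).elim
    · refine congrArg Sum.inr (h2.ext (Sum.inr_injective (α := X) ?_) e)
      exact (h2.1 a).trans ((congrArg p e).trans (h2.1 b).symm)
  · intro a
    rcases e : p a with x | y
    · obtain ⟨w, -, hw⟩ := h1.exists x a e.symm
      exact ⟨Sum.inl w, hw⟩
    · obtain ⟨w, -, hw⟩ := h2.exists y a e.symm
      exact ⟨Sum.inr w, hw⟩
  · rintro (a | a)
    · exact (h1.1 a).symm
    · exact (h2.1 a).symm
  · rw [res_copair]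
  · rw [res_copair]

theorem tr_id {X : FinGSet G} (x : TensorObj T S X) : tr (MulActionHom.id G) x = x := by
  induction x using ind with | _ A p t s
  rfl

theorem tr_comp {X Y Z : FinGSet G} (g : Y →[G] Z) (f : X →[G] Y) (x : TensorObj T S X) :
    tr (g.comp f) x = tr g (tr f x) := by
  induction x using ind with | _ A p t s
  rfl

theorem additive_sum (X Y : FinGSet G) :
    Function.Bijective fun t : TensorObj T S (sum X Y) =>
      (res (inl X Y) t, res (inr X Y) t) := by
  have h0 : ∀ z : TensorObj T S (empty G), z = 0 := fun z =>
    (subsingleton (empty G) inferInstance).elim _ _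
  refine ⟨fun x y h => ?_, fun z => ⟨tr (inl X Y) z.1 + tr (inr X Y) z.2, Prod.ext ?_ ?_⟩⟩
  · have e1 := congrArg Prod.fst h
    have e2 := congrArg Prod.snd h
    dsimp only at e1 e2
    rw [eq_add X Y x, eq_add X Y y, e1, e2]
  · change res _ _ = _
    rw [res_add, mackey_tr (isPullbackSq_inl X Y), mackey_tr (isPullbackSq_inl_inr X Y),
      h0 (res _ z.2), tr_zero, add_zero, res_id, tr_id]
  · change res _ _ = _
    rw [res_add, mackey_tr (isPullbackSq_inr X Y), mackey_tr (isPullbackSq_inl_inr X Y).symm,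
      h0 (res _ z.1), tr_zero, zero_add, res_id, tr_id]

end TensorObj

/-- The tensor product over the Burnside functor of two Tambara functors. -/
def tensor (T S : Tambara G) : Tambara G where
  obj := TensorObj T S
  res f :=
    { toFun := TensorObj.res f
      map_one' := TensorObj.res_one f
      map_mul' := TensorObj.res_mul f
      map_zero' := TensorObj.res_zero f
      map_add' := TensorObj.res_add f }
  tr f :=
    { toFun := TensorObj.tr f
      map_zero' := TensorObj.tr_zero f
      map_add' := TensorObj.tr_add f }
  nm f :=
    { toFun := TensorObj.nm f
      map_one' := TensorObj.nm_one f
      map_mul' := TensorObj.nm_mul f }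
  res_id := TensorObj.res_id
  res_comp := TensorObj.res_comp
  tr_id := TensorObj.tr_id
  tr_comp := TensorObj.tr_comp
  nm_id := TensorObj.nm_id
  nm_comp := TensorObj.nm_comp
  additive_empty := TensorObj.subsingleton
  additive_sum := TensorObj.additive_sum
  mackey_tr := TensorObj.mackey_tr
  mackey_nm := TensorObj.mackey_nm
  distributive := TensorObj.distributive

/-- The element `[t ⊗ s]_{(A, p)}` of `(T ⊗ S)(X)`. -/
def tmk (T S : Tambara G) {X A : FinGSet G} (p : A →[G] X) (t : T.obj A) (s : S.obj A) :
    (tensor T S).obj X :=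
  TensorObj.mk p t s

theorem tmk_eq_tr (T S : Tambara G) {X A : FinGSet G} (p : A →[G] X) (t : T.obj A) (s : S.obj A) :
    tmk T S p t s = (tensor T S).tr p (tmk T S (MulActionHom.id G) t s) := rfl

theorem tensor_ind (T S : Tambara G) {X : FinGSet G} {P : (tensor T S).obj X → Prop}
    (h : ∀ (A : FinGSet G) (p : A →[G] X) t s, P (tmk T S p t s)) (x : (tensor T S).obj X) :
    P x :=
  TensorObj.ind h x


theorem isPullbackSq_id_map {X Y : FinGSet G} (f : X →[G] Y) :
    IsPullbackSq f (MulActionHom.id G) (MulActionHom.id G) f :=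
  ⟨fun _ => rfl, fun a _ h => ⟨a, ⟨rfl, h⟩, fun _ hw => hw.1⟩⟩

/-- The morphism `t ↦ [t ⊗ 1]`. -/
def tensorInl (T S : Tambara G) : T ⟶ tensor T S where
  app X :=
    { toFun t := tmk T S (MulActionHom.id G) t 1
      map_one' := rfl
      map_mul' t t' := by
        refine Eq.trans ?_ (TensorObj.mk_mul_mk (isPullbackSq_id_map _) _ _ _ _).symm
        rw [T.res_id, T.res_id, map_one, mul_one]
        rfl
      map_zero' := by
        refine (TensorObj.glueR (fromEmpty X) (p := fromEmpty X) (t := 0) (s := 0) ?_ ?_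
          ?_).symm.trans (TensorObj.mk_zero _ _)
        · exact fun x => x.elim
        · exact map_zero _
        · exact eq_zero_of_empty S _
      map_add' t t' := by
        refine (TensorObj.glueR (copair (MulActionHom.id G) (MulActionHom.id G : X →[G] X))
          ?_ ?_ ?_).symm
        · rintro (x | x) <;> rfl
        · rw [tr_copair_pair, T.tr_id, T.tr_id]
        · rw [res_copair, S.res_id] }
  res f t := ((TensorObj.res_mk (isPullbackSq_id_map f) t 1).trans
    (TensorObj.mk_congr (fun _ => rfl) rfl (map_one _))).symm
  tr f t := (TensorObj.glueR f (fun _ => rfl) rfl (map_one _)).symm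
  nm f t := ((TensorObj.nm_mk (isExponential_map_id f) t 1).trans
    (TensorObj.mk_congr (fun _ => rfl) (congrArg _ (T.res_id t))
      ((congrArg _ (map_one _)).trans (map_one _)))).symm

/-- The morphism `s ↦ [1 ⊗ s]`. -/
def tensorInr (T S : Tambara G) : S ⟶ tensor T S where
  app X :=
    { toFun s := tmk T S (MulActionHom.id G) 1 s
      map_one' := rfl
      map_mul' t t' := by
        refine Eq.trans ?_ (TensorObj.mk_mul_mk (isPullbackSq_id_map _) _ _ _ _).symm
        rw [S.res_id, S.res_id, map_one, mul_one]
        rfl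
      map_zero' := rfl
      map_add' t t' := (TensorObj.mk_add _ _ _ _).symm }
  res f t := ((TensorObj.res_mk (isPullbackSq_id_map f) 1 t).trans
    (TensorObj.mk_congr (fun _ => rfl) (map_one _) rfl)).symm
  tr f t := (TensorObj.glueL f (fun _ => rfl) (map_one _) rfl).symm
  nm f t := ((TensorObj.nm_mk (isExponential_map_id f) 1 t).trans
    (TensorObj.mk_congr (fun _ => rfl) ((congrArg _ (map_one _)).trans (map_one _))
      (congrArg _ (S.res_id t)))).symm

theorem tmk_eq_mul (T S : Tambara G) {X A : FinGSet G} (p : A →[G] X) (t : T.obj A)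
    (s : S.obj A) :
    tmk T S p t s =
      (tensor T S).tr p ((tensorInl T S).app A t * (tensorInr T S).app A s) := by
  rw [tmk_eq_tr]
  congr 1
  refine Eq.trans ?_ (TensorObj.mk_mul_mk (isPullbackSq_id_map _) _ _ _ _).symm
  refine TensorObj.mk_congr (fun _ => rfl) ?_ ?_
  · rw [T.res_id, map_one, mul_one]
  · rw [S.res_id, S.res_id, one_mul]

theorem tr_mul_tr (T : Tambara G) {X A B P : FinGSet G} {p : A →[G] X} {q : B →[G] X}
    {a : P →[G] A} {b : P →[G] B} (h : IsPullbackSq b a q p) (x : T.obj A) (y : T.obj B) :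
    T.tr p x * T.tr q y = T.tr (p.comp a) (T.res a x * T.res b y) := by
  rw [← frobenius, T.mackey_tr h, T.tr_comp, frobenius']

/-- The morphism out of the tensor product given by two morphisms. -/
def tensorDesc {T S R : Tambara G} (φ : T ⟶ R) (ψ : S ⟶ R) : tensor T S ⟶ R where
  app X :=
    { toFun := Quot.lift (fun r : TensorRep T S X =>
          R.tr r.map (φ.app r.src r.left * ψ.app r.src r.right)) (by
        rintro _ _ (⟨a, p, t, s⟩ | ⟨a, p, t, s⟩)
        · dsimp only
          rw [R.tr_comp, φ.res, frobenius', ψ.tr]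
        · dsimp only
          rw [R.tr_comp, ψ.res, frobenius, φ.tr])
      map_one' := by
        change R.tr _ (φ.app X 1 * ψ.app X 1) = 1
        rw [map_one, map_one, mul_one, R.tr_id]
      map_mul' x y := by
        induction x using tensor_ind with | _ A p t s
        induction y using tensor_ind with | _ B q t' s'
        change R.tr _ (φ.app _ (_ * _) * ψ.app _ (_ * _)) = R.tr p _ * R.tr q _
        rw [tr_mul_tr R (pb_isPullbackSq p q)]
        simp only [map_mul, φ.res, ψ.res]
        congr 1
        exact mul_mul_mul_comm _ _ _ _
      map_zero' := by
        change R.tr _ (φ.app X 1 * ψ.app X 0) = 0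
        rw [map_zero, mul_zero, map_zero]
      map_add' x y := by
        obtain ⟨A, p, t, s, s', rfl, rfl⟩ := TensorObj.common x y
        refine (congrArg _ (TensorObj.mk_add p t s s')).trans ?_
        change R.tr p (φ.app A t * ψ.app A (s + s')) =
          R.tr p (φ.app A t * ψ.app A s) + R.tr p (φ.app A t * ψ.app A s')
        rw [map_add, mul_add, map_add] }
  res f x := by
    induction x using tensor_ind with | _ A p t s
    change R.tr (pbFst f p) (φ.app (pb f p) (T.res (pbSnd f p) t) *
      ψ.app (pb f p) (S.res (pbSnd f p) s)) = R.res f (R.tr p (φ.app A t * ψ.app A s))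
    rw [R.mackey_tr (pb_isPullbackSq f p), map_mul (R.res _), φ.res, ψ.res]
  tr f x := by
    induction x using tensor_ind with | _ A p t s
    exact R.tr_comp _ _ _
  nm f x := by
    induction x using tensor_ind with | _ A p t s
    change R.tr (piProj f p)
      (φ.app (piObj f p) (T.nm (pbSnd f (piProj f p)) (T.res (piEval f p) t)) *
        ψ.app (piObj f p) (S.nm (pbSnd f (piProj f p)) (S.res (piEval f p) s))) =
      R.nm f (R.tr p (φ.app A t * ψ.app A s))
    rw [R.distributive (canonical_isExponential f p), map_mul (R.res _), map_mul (R.nm _), φ.nm,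
      ψ.nm, φ.res, ψ.res]

theorem tensorDesc_tmk {T S R : Tambara G} (φ : T ⟶ R) (ψ : S ⟶ R) {X A : FinGSet G}
    (p : A →[G] X) (t : T.obj A) (s : S.obj A) :
    (tensorDesc φ ψ).app X (tmk T S p t s) = R.tr p (φ.app A t * ψ.app A s) := rfl

theorem tensorInl_desc {T S R : Tambara G} (φ : T ⟶ R) (ψ : S ⟶ R) :
    tensorInl T S ≫ tensorDesc φ ψ = φ := hom_ext fun X t => by
  change R.tr _ (φ.app X t * ψ.app X 1) = _
  rw [map_one, mul_one, R.tr_id]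

theorem tensorInr_desc {T S R : Tambara G} (φ : T ⟶ R) (ψ : S ⟶ R) :
    tensorInr T S ≫ tensorDesc φ ψ = ψ := hom_ext fun X t => by
  change R.tr _ (φ.app X 1 * ψ.app X t) = _
  rw [map_one, one_mul, R.tr_id]

theorem tensor_hom_ext {T S R : Tambara G} {φ ψ : tensor T S ⟶ R}
    (h1 : tensorInl T S ≫ φ = tensorInl T S ≫ ψ) (h2 : tensorInr T S ≫ φ = tensorInr T S ≫ ψ) :
    φ = ψ := hom_ext fun X x => by
  induction x using tensor_ind with | _ A p t s
  have e1 : φ.app A _ = ψ.app A _ := congrArg (fun χ : T ⟶ R => χ.app A t) h1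
  have e2 : φ.app A _ = ψ.app A _ := congrArg (fun χ : S ⟶ R => χ.app A s) h2
  rw [tmk_eq_mul, φ.tr, ψ.tr, map_mul (φ.app A), map_mul (ψ.app A), e1, e2]

/-- The tensor product is the coproduct in the category of Tambara functors. -/
def tensorIsColimit (T S : Tambara G) :
    Limits.IsColimit (Limits.BinaryCofan.mk (tensorInl T S) (tensorInr T S)) :=
  Limits.BinaryCofan.IsColimit.mk _ tensorDesc tensorInl_desc tensorInr_desc
    fun φ ψ _ h1 h2 => tensor_hom_ext (h1.trans (tensorInl_desc φ ψ).symm)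
      (h2.trans (tensorInr_desc φ ψ).symm)

/-- The tensor product `[t ⊗ s] ↦ [φ(t) ⊗ ψ(s)]` of two morphisms. -/
def tensorMap {T S T' S' : Tambara G} (φ : T ⟶ T') (ψ : S ⟶ S') : tensor T S ⟶ tensor T' S' :=
  tensorDesc (φ ≫ tensorInl T' S') (ψ ≫ tensorInr T' S')

theorem tensorMap_tmk {T S T' S' : Tambara G} (φ : T ⟶ T') (ψ : S ⟶ S') {X A : FinGSet G}
    (p : A →[G] X) (t : T.obj A) (s : S.obj A) :
    (tensorMap φ ψ).app X (tmk T S p t s) = tmk T' S' p (φ.app A t) (ψ.app A s) := by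
  rw [tensorMap, tensorDesc_tmk, tmk_eq_mul]
  rfl

/-- The associativity isomorphism of the tensor product. -/
def tensorAssoc (T S R : Tambara G) : tensor (tensor T S) R ⟶ tensor T (tensor S R) :=
  tensorDesc (tensorDesc (tensorInl T (tensor S R)) (tensorInl S R ≫ tensorInr T (tensor S R)))
    (tensorInr S R ≫ tensorInr T (tensor S R))

end Tambara

/-- Formal expressions in the operations of a Tambara functor, with generators the elements
of a semi-Mackey functor `M`. -/
inductive FreeTerm {G : Type u} [Group G] (M : SemiMackey G) : FinGSet G → Type (u + 1)
  | of {X : FinGSet G} (m : M.obj X) : FreeTerm M X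
  | zero {X : FinGSet G} : FreeTerm M X
  | one {X : FinGSet G} : FreeTerm M X
  | neg {X : FinGSet G} (a : FreeTerm M X) : FreeTerm M X
  | add {X : FinGSet G} (a b : FreeTerm M X) : FreeTerm M X
  | mul {X : FinGSet G} (a b : FreeTerm M X) : FreeTerm M X
  | res {X Y : FinGSet G} (f : X →[G] Y) (a : FreeTerm M Y) : FreeTerm M X
  | tr {X Y : FinGSet G} (f : X →[G] Y) (a : FreeTerm M X) : FreeTerm M Y
  | nm {X Y : FinGSet G} (f : X →[G] Y) (a : FreeTerm M X) : FreeTerm M Y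

/-- The relations that hold in every Tambara functor with a morphism of semi-Mackey functors
from `M` to its multiplicative part. -/
inductive FreeRel {G : Type u} [Group G] (M : SemiMackey G) :
    ∀ {X : FinGSet G}, FreeTerm M X → FreeTerm M X → Prop
  | neg_congr {X : FinGSet G} {a a' : FreeTerm M X} : FreeRel M a a' →
      FreeRel M (FreeTerm.neg a) (FreeTerm.neg a')
  | add_congr_left {X : FinGSet G} {a a' : FreeTerm M X} (b : FreeTerm M X) : FreeRel M a a' →
      FreeRel M (FreeTerm.add a b) (FreeTerm.add a' b)
  | add_congr_right {X : FinGSet G} {b b' : FreeTerm M X} (a : FreeTerm M X) : FreeRel M b b' →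
      FreeRel M (FreeTerm.add a b) (FreeTerm.add a b')
  | mul_congr_left {X : FinGSet G} {a a' : FreeTerm M X} (b : FreeTerm M X) : FreeRel M a a' →
      FreeRel M (FreeTerm.mul a b) (FreeTerm.mul a' b)
  | mul_congr_right {X : FinGSet G} {b b' : FreeTerm M X} (a : FreeTerm M X) : FreeRel M b b' →
      FreeRel M (FreeTerm.mul a b) (FreeTerm.mul a b')
  | res_congr {X Y : FinGSet G} (f : X →[G] Y) {a a' : FreeTerm M Y} : FreeRel M a a' →
      FreeRel M (FreeTerm.res f a) (FreeTerm.res f a')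
  | tr_congr {X Y : FinGSet G} (f : X →[G] Y) {a a' : FreeTerm M X} : FreeRel M a a' →
      FreeRel M (FreeTerm.tr f a) (FreeTerm.tr f a')
  | nm_congr {X Y : FinGSet G} (f : X →[G] Y) {a a' : FreeTerm M X} : FreeRel M a a' →
      FreeRel M (FreeTerm.nm f a) (FreeTerm.nm f a')
  | add_assoc {X : FinGSet G} (a b c : FreeTerm M X) :
      FreeRel M (FreeTerm.add (FreeTerm.add a b) c) (FreeTerm.add a (FreeTerm.add b c))
  | zero_add {X : FinGSet G} (a : FreeTerm M X) : FreeRel M (FreeTerm.add FreeTerm.zero a) a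
  | neg_add {X : FinGSet G} (a : FreeTerm M X) :
      FreeRel M (FreeTerm.add (FreeTerm.neg a) a) FreeTerm.zero
  | add_comm {X : FinGSet G} (a b : FreeTerm M X) : FreeRel M (FreeTerm.add a b) (FreeTerm.add b a)
  | mul_assoc {X : FinGSet G} (a b c : FreeTerm M X) :
      FreeRel M (FreeTerm.mul (FreeTerm.mul a b) c) (FreeTerm.mul a (FreeTerm.mul b c))
  | one_mul {X : FinGSet G} (a : FreeTerm M X) : FreeRel M (FreeTerm.mul FreeTerm.one a) a
  | mul_comm {X : FinGSet G} (a b : FreeTerm M X) : FreeRel M (FreeTerm.mul a b) (FreeTerm.mul b a)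
  | mul_add {X : FinGSet G} (a b c : FreeTerm M X) :
      FreeRel M (FreeTerm.mul a (FreeTerm.add b c))
        (FreeTerm.add (FreeTerm.mul a b) (FreeTerm.mul a c))
  | res_add {X Y : FinGSet G} (f : X →[G] Y) (a b : FreeTerm M Y) :
      FreeRel M (FreeTerm.res f (FreeTerm.add a b))
        (FreeTerm.add (FreeTerm.res f a) (FreeTerm.res f b))
  | res_mul {X Y : FinGSet G} (f : X →[G] Y) (a b : FreeTerm M Y) :
      FreeRel M (FreeTerm.res f (FreeTerm.mul a b))
        (FreeTerm.mul (FreeTerm.res f a) (FreeTerm.res f b))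
  | res_one {X Y : FinGSet G} (f : X →[G] Y) : FreeRel M (FreeTerm.res f FreeTerm.one) FreeTerm.one
  | tr_add {X Y : FinGSet G} (f : X →[G] Y) (a b : FreeTerm M X) :
      FreeRel M (FreeTerm.tr f (FreeTerm.add a b))
        (FreeTerm.add (FreeTerm.tr f a) (FreeTerm.tr f b))
  | nm_mul {X Y : FinGSet G} (f : X →[G] Y) (a b : FreeTerm M X) :
      FreeRel M (FreeTerm.nm f (FreeTerm.mul a b))
        (FreeTerm.mul (FreeTerm.nm f a) (FreeTerm.nm f b))
  | nm_one {X Y : FinGSet G} (f : X →[G] Y) : FreeRel M (FreeTerm.nm f FreeTerm.one) FreeTerm.one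
  | res_id {X : FinGSet G} (a : FreeTerm M X) : FreeRel M (FreeTerm.res (MulActionHom.id G) a) a
  | res_comp {X Y Z : FinGSet G} (g : Y →[G] Z) (f : X →[G] Y) (a : FreeTerm M Z) :
      FreeRel M (FreeTerm.res (g.comp f) a) (FreeTerm.res f (FreeTerm.res g a))
  | tr_id {X : FinGSet G} (a : FreeTerm M X) : FreeRel M (FreeTerm.tr (MulActionHom.id G) a) a
  | tr_comp {X Y Z : FinGSet G} (g : Y →[G] Z) (f : X →[G] Y) (a : FreeTerm M X) :
      FreeRel M (FreeTerm.tr (g.comp f) a) (FreeTerm.tr g (FreeTerm.tr f a))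
  | nm_id {X : FinGSet G} (a : FreeTerm M X) : FreeRel M (FreeTerm.nm (MulActionHom.id G) a) a
  | nm_comp {X Y Z : FinGSet G} (g : Y →[G] Z) (f : X →[G] Y) (a : FreeTerm M X) :
      FreeRel M (FreeTerm.nm (g.comp f) a) (FreeTerm.nm g (FreeTerm.nm f a))
  | additive_empty {X : FinGSet G} (h : IsEmpty X) (a : FreeTerm M X) :
      FreeRel M a FreeTerm.zero
  | additive_sum {X Y : FinGSet G} (a : FreeTerm M (sum X Y)) :
      FreeRel M a
        (FreeTerm.add (FreeTerm.tr (inl X Y) (FreeTerm.res (inl X Y) a))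
          (FreeTerm.tr (inr X Y) (FreeTerm.res (inr X Y) a)))
  | mackey_tr {X' Y' X Y : FinGSet G} {f' : X' →[G] Y'} {x : X' →[G] X} {y : Y' →[G] Y}
      {f : X →[G] Y} (h : IsPullbackSq f' x y f) (a : FreeTerm M Y') :
      FreeRel M (FreeTerm.res f (FreeTerm.tr y a)) (FreeTerm.tr x (FreeTerm.res f' a))
  | mackey_nm {X' Y' X Y : FinGSet G} {f' : X' →[G] Y'} {x : X' →[G] X} {y : Y' →[G] Y}
      {f : X →[G] Y} (h : IsPullbackSq f' x y f) (a : FreeTerm M Y') :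
      FreeRel M (FreeTerm.res f (FreeTerm.nm y a)) (FreeTerm.nm x (FreeTerm.res f' a))
  | distributive {X Y A Z B : FinGSet G} {f : X →[G] Y} {p : A →[G] X} {l : Z →[G] A}
      {r : Z →[G] B} {q : B →[G] Y} (h : IsExponential f p l r q) (a : FreeTerm M A) :
      FreeRel M (FreeTerm.nm f (FreeTerm.tr p a)) (FreeTerm.tr q (FreeTerm.nm r (FreeTerm.res l a)))
  | of_one {X : FinGSet G} : FreeRel M (FreeTerm.of (1 : M.obj X)) FreeTerm.one
  | of_mul {X : FinGSet G} (m n : M.obj X) :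
      FreeRel M (FreeTerm.of (m * n)) (FreeTerm.mul (FreeTerm.of m) (FreeTerm.of n))
  | of_res {X Y : FinGSet G} (f : X →[G] Y) (m : M.obj Y) :
      FreeRel M (FreeTerm.of (M.res f m)) (FreeTerm.res f (FreeTerm.of m))
  | of_tr {X Y : FinGSet G} (f : X →[G] Y) (m : M.obj X) :
      FreeRel M (FreeTerm.of (M.tr f m)) (FreeTerm.nm f (FreeTerm.of m))

namespace Tambara

variable {G : Type u} [Group G]

/-- The value at `X` of the Tambara functor `Ω[M]`. -/
def FreeObj (M : SemiMackey G) (X : FinGSet G) : Type (u + 1) :=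
  Quot (FreeRel M (X := X))

namespace FreeObj

variable {M : SemiMackey G}

/-- The class of an expression. -/
def mk {X : FinGSet G} (a : FreeTerm M X) : FreeObj M X := Quot.mk _ a

def res {X Y : FinGSet G} (f : X →[G] Y) : FreeObj M Y → FreeObj M X :=
  Quot.map (FreeTerm.res f) fun _ _ h => FreeRel.res_congr f h

def tr {X Y : FinGSet G} (f : X →[G] Y) : FreeObj M X → FreeObj M Y :=
  Quot.map (FreeTerm.tr f) fun _ _ h => FreeRel.tr_congr f h

def nm {X Y : FinGSet G} (f : X →[G] Y) : FreeObj M X → FreeObj M Y :=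
  Quot.map (FreeTerm.nm f) fun _ _ h => FreeRel.nm_congr f h

instance (X : FinGSet G) : Zero (FreeObj M X) := ⟨mk FreeTerm.zero⟩
instance (X : FinGSet G) : One (FreeObj M X) := ⟨mk FreeTerm.one⟩
instance (X : FinGSet G) : Neg (FreeObj M X) :=
  ⟨Quot.map FreeTerm.neg fun _ _ h => FreeRel.neg_congr h⟩
instance (X : FinGSet G) : Add (FreeObj M X) :=
  ⟨Quot.map₂ FreeTerm.add (fun a _ _ h => FreeRel.add_congr_right a h)
    fun _ _ b h => FreeRel.add_congr_left b h⟩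
instance (X : FinGSet G) : Mul (FreeObj M X) :=
  ⟨Quot.map₂ FreeTerm.mul (fun a _ _ h => FreeRel.mul_congr_right a h)
    fun _ _ b h => FreeRel.mul_congr_left b h⟩

theorem add_comm' {X : FinGSet G} (x y : FreeObj M X) : x + y = y + x := by
  induction x using Quot.ind with | _ a
  induction y using Quot.ind with | _ b
  exact Quot.sound (FreeRel.add_comm a b)

theorem zero_add' {X : FinGSet G} (x : FreeObj M X) : 0 + x = x := by
  induction x using Quot.ind with | _ a
  exact Quot.sound (FreeRel.zero_add a)

theorem mul_comm' {X : FinGSet G} (x y : FreeObj M X) : x * y = y * x := by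
  induction x using Quot.ind with | _ a
  induction y using Quot.ind with | _ b
  exact Quot.sound (FreeRel.mul_comm a b)

theorem one_mul' {X : FinGSet G} (x : FreeObj M X) : 1 * x = x := by
  induction x using Quot.ind with | _ a
  exact Quot.sound (FreeRel.one_mul a)

theorem mul_add' {X : FinGSet G} (x y z : FreeObj M X) : x * (y + z) = x * y + x * z := by
  induction x using Quot.ind with | _ a
  induction y using Quot.ind with | _ b
  induction z using Quot.ind with | _ c
  exact Quot.sound (FreeRel.mul_add a b c)

instance (X : FinGSet G) : AddCommGroup (FreeObj M X) where
  add_assoc x y z := by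
    induction x using Quot.ind with | _ a
    induction y using Quot.ind with | _ b
    induction z using Quot.ind with | _ c
    exact Quot.sound (FreeRel.add_assoc a b c)
  zero_add := zero_add'
  add_zero x := by rw [add_comm', zero_add']
  neg_add_cancel x := by
    induction x using Quot.ind with | _ a
    exact Quot.sound (FreeRel.neg_add a)
  add_comm := add_comm'
  nsmul := nsmulRec
  zsmul := zsmulRec

theorem mul_zero' {X : FinGSet G} (x : FreeObj M X) : x * 0 = 0 := by
  have h := mul_add' x 0 0
  rwa [add_zero, left_eq_add] at h

instance (X : FinGSet G) : CommRing (FreeObj M X) where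
  mul_assoc x y z := by
    induction x using Quot.ind with | _ a
    induction y using Quot.ind with | _ b
    induction z using Quot.ind with | _ c
    exact Quot.sound (FreeRel.mul_assoc a b c)
  one_mul := one_mul'
  mul_one x := by rw [mul_comm', one_mul']
  left_distrib := mul_add'
  right_distrib x y z := by rw [mul_comm', mul_add', mul_comm' z, mul_comm' z]
  mul_comm := mul_comm'
  zero_mul x := by rw [mul_comm', mul_zero']
  mul_zero := mul_zero'
  neg_add_cancel := neg_add_cancel
  zsmul := zsmulRec

theorem res_add {X Y : FinGSet G} (f : X →[G] Y) (x y : FreeObj M Y) :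
    res f (x + y) = res f x + res f y := by
  induction x using Quot.ind with | _ a
  induction y using Quot.ind with | _ b
  exact Quot.sound (FreeRel.res_add f a b)

theorem res_mul {X Y : FinGSet G} (f : X →[G] Y) (x y : FreeObj M Y) :
    res f (x * y) = res f x * res f y := by
  induction x using Quot.ind with | _ a
  induction y using Quot.ind with | _ b
  exact Quot.sound (FreeRel.res_mul f a b)

theorem tr_add {X Y : FinGSet G} (f : X →[G] Y) (x y : FreeObj M X) :
    tr f (x + y) = tr f x + tr f y := by
  induction x using Quot.ind with | _ a
  induction y using Quot.ind with | _ b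
  exact Quot.sound (FreeRel.tr_add f a b)

theorem tr_zero {X Y : FinGSet G} (f : X →[G] Y) : tr f (0 : FreeObj M X) = 0 := by
  have h := tr_add f (0 : FreeObj M X) 0
  rwa [add_zero, left_eq_add] at h

theorem nm_mul {X Y : FinGSet G} (f : X →[G] Y) (x y : FreeObj M X) :
    nm f (x * y) = nm f x * nm f y := by
  induction x using Quot.ind with | _ a
  induction y using Quot.ind with | _ b
  exact Quot.sound (FreeRel.nm_mul f a b)

theorem mackey_tr {X' Y' X Y : FinGSet G} {f' : X' →[G] Y'} {x : X' →[G] X} {y : Y' →[G] Y}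
    {f : X →[G] Y} (h : IsPullbackSq f' x y f) (t : FreeObj M Y') :
    res f (tr y t) = tr x (res f' t) := by
  induction t using Quot.ind with | _ a
  exact Quot.sound (FreeRel.mackey_tr h a)

theorem res_id {X : FinGSet G} (t : FreeObj M X) : res (MulActionHom.id G) t = t := by
  induction t using Quot.ind with | _ a
  exact Quot.sound (FreeRel.res_id a)

theorem tr_id {X : FinGSet G} (t : FreeObj M X) : tr (MulActionHom.id G) t = t := by
  induction t using Quot.ind with | _ a
  exact Quot.sound (FreeRel.tr_id a)

theorem eq_zero (X : FinGSet G) (h : IsEmpty X) (t : FreeObj M X) : t = 0 := by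
  induction t using Quot.ind with | _ a
  exact Quot.sound (FreeRel.additive_empty h a)

theorem additive_sum (X Y : FinGSet G) :
    Function.Bijective fun t : FreeObj M (sum X Y) => (res (inl X Y) t, res (inr X Y) t) := by
  have h0 : ∀ z : FreeObj M (empty G), z = 0 := fun z => eq_zero _ inferInstance z
  have hs : ∀ x : FreeObj M (sum X Y),
      x = tr (inl X Y) (res (inl X Y) x) + tr (inr X Y) (res (inr X Y) x) := fun x => by
    induction x using Quot.ind with | _ a
    exact Quot.sound (FreeRel.additive_sum a)
  refine ⟨fun x y h => ?_, fun z => ⟨tr (inl X Y) z.1 + tr (inr X Y) z.2, Prod.ext ?_ ?_⟩⟩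
  · have e1 := congrArg Prod.fst h
    have e2 := congrArg Prod.snd h
    dsimp only at e1 e2
    rw [hs x, hs y, e1, e2]
  · change res _ _ = _
    rw [res_add, mackey_tr (isPullbackSq_inl X Y), mackey_tr (isPullbackSq_inl_inr X Y),
      h0 (res _ z.2), tr_zero, add_zero, res_id, tr_id]
  · change res _ _ = _
    rw [res_add, mackey_tr (isPullbackSq_inr X Y), mackey_tr (isPullbackSq_inl_inr X Y).symm,
      h0 (res _ z.1), tr_zero, zero_add, res_id, tr_id]

end FreeObj

/-- The Tambara functor `Ω[M]`. -/
def free (M : SemiMackey G) : Tambara G where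
  obj := FreeObj M
  res f := RingHom.mk' ⟨⟨FreeObj.res f, Quot.sound (FreeRel.res_one f)⟩, FreeObj.res_mul f⟩
    (FreeObj.res_add f)
  tr f := AddMonoidHom.mk' (FreeObj.tr f) (FreeObj.tr_add f)
  nm f := ⟨⟨FreeObj.nm f, Quot.sound (FreeRel.nm_one f)⟩, FreeObj.nm_mul f⟩
  res_id := FreeObj.res_id
  res_comp g f t := by
    induction t using Quot.ind with | _ a
    exact Quot.sound (FreeRel.res_comp g f a)
  tr_id := FreeObj.tr_id
  tr_comp g f t := by
    induction t using Quot.ind with | _ a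
    exact Quot.sound (FreeRel.tr_comp g f a)
  nm_id t := by
    induction t using Quot.ind with | _ a
    exact Quot.sound (FreeRel.nm_id a)
  nm_comp g f t := by
    induction t using Quot.ind with | _ a
    exact Quot.sound (FreeRel.nm_comp g f a)
  additive_empty X h := ⟨fun x y => (FreeObj.eq_zero X h x).trans (FreeObj.eq_zero X h y).symm⟩
  additive_sum := FreeObj.additive_sum
  mackey_tr := FreeObj.mackey_tr
  mackey_nm h t := by
    induction t using Quot.ind with | _ a
    exact Quot.sound (FreeRel.mackey_nm h a)
  distributive h t := by
    induction t using Quot.ind with | _ a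
    exact Quot.sound (FreeRel.distributive h a)

/-- The element of `Ω[M](X)` given by an element of `M(X)`. -/
def gen (M : SemiMackey G) {X : FinGSet G} (m : M.obj X) : (free M).obj X :=
  FreeObj.mk (FreeTerm.of m)

theorem gen_one (M : SemiMackey G) (X : FinGSet G) : gen M (1 : M.obj X) = 1 :=
  Quot.sound FreeRel.of_one

theorem gen_mul (M : SemiMackey G) {X : FinGSet G} (m n : M.obj X) :
    gen M (m * n) = gen M m * gen M n :=
  Quot.sound (FreeRel.of_mul m n)

theorem gen_res (M : SemiMackey G) {X Y : FinGSet G} (f : X →[G] Y) (m : M.obj Y) :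
    gen M (M.res f m) = (free M).res f (gen M m) :=
  Quot.sound (FreeRel.of_res f m)

theorem gen_tr (M : SemiMackey G) {X Y : FinGSet G} (f : X →[G] Y) (m : M.obj X) :
    gen M (M.tr f m) = (free M).nm f (gen M m) :=
  Quot.sound (FreeRel.of_tr f m)

/-- The morphism of semi-Mackey functors `M → Ω[M]^μ`. -/
def freeUnit (M : SemiMackey G) : M ⟶ (free M).mul where
  app X :=
    { toFun := gen M
      map_one' := gen_one M X
      map_mul' := gen_mul M }
  res := gen_res M
  tr := gen_tr M

/-- The value of an expression in a Tambara functor. -/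
def freeEval {M : SemiMackey G} {T : Tambara G} (φ : M ⟶ T.mul) :
    ∀ {X : FinGSet G}, FreeTerm M X → T.obj X
  | _, FreeTerm.of m => φ.app _ m
  | _, FreeTerm.zero => 0
  | _, FreeTerm.one => 1
  | _, FreeTerm.neg a => -freeEval φ a
  | _, FreeTerm.add a b => freeEval φ a + freeEval φ b
  | _, FreeTerm.mul a b => freeEval φ a * freeEval φ b
  | _, FreeTerm.res f a => T.res f (freeEval φ a)
  | _, FreeTerm.tr f a => T.tr f (freeEval φ a)
  | _, FreeTerm.nm f a => T.nm f (freeEval φ a)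

theorem eq_tr_res_add (T : Tambara G) {X Y : FinGSet G} (t : T.obj (sum X Y)) :
    t = T.tr (inl X Y) (T.res (inl X Y) t) + T.tr (inr X Y) (T.res (inr X Y) t) := by
  change t = T.pair (T.res (inl X Y) t) (T.res (inr X Y) t)
  apply sum_ext <;> simp

theorem freeEval_rel {M : SemiMackey G} {T : Tambara G} (φ : M ⟶ T.mul) {X : FinGSet G}
    {a b : FreeTerm M X} (h : FreeRel M a b) : freeEval φ a = freeEval φ b := by
  induction h with
  | neg_congr _ ih => exact congrArg (-·) ih
  | add_congr_left b _ ih => exact congrArg (· + freeEval φ b) ih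
  | add_congr_right a _ ih => exact congrArg (freeEval φ a + ·) ih
  | mul_congr_left b _ ih => exact congrArg (· * freeEval φ b) ih
  | mul_congr_right a _ ih => exact congrArg (freeEval φ a * ·) ih
  | res_congr f _ ih => exact congrArg (T.res f) ih
  | tr_congr f _ ih => exact congrArg (T.tr f) ih
  | nm_congr f _ ih => exact congrArg (T.nm f) ih
  | add_assoc a b c => exact add_assoc _ _ _
  | zero_add a => exact zero_add _
  | neg_add a => exact neg_add_cancel _
  | add_comm a b => exact add_comm _ _
  | mul_assoc a b c => exact mul_assoc _ _ _
  | one_mul a => exact one_mul _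
  | mul_comm a b => exact mul_comm _ _
  | mul_add a b c => exact mul_add _ _ _
  | res_add f a b => exact map_add _ _ _
  | res_mul f a b => exact map_mul _ _ _
  | res_one f => exact map_one _
  | tr_add f a b => exact map_add _ _ _
  | nm_mul f a b => exact map_mul _ _ _
  | nm_one f => exact map_one _
  | res_id a => exact T.res_id _
  | res_comp g f a => exact T.res_comp _ _ _
  | tr_id a => exact T.tr_id _
  | tr_comp g f a => exact T.tr_comp _ _ _
  | nm_id a => exact T.nm_id _
  | nm_comp g f a => exact T.nm_comp _ _ _
  | additive_empty h a => exact (T.additive_empty _ h).elim _ _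
  | additive_sum a => exact eq_tr_res_add T _
  | mackey_tr h a => exact T.mackey_tr h _
  | mackey_nm h a => exact T.mackey_nm h _
  | distributive h a => exact T.distributive h _
  | of_one => exact map_one (φ.app _)
  | of_mul m n => exact map_mul (φ.app _) m n
  | of_res f m => exact φ.res f m
  | of_tr f m => exact φ.tr f m

/-- The morphism `Ω[M] → T` corresponding to `M → T^μ`. -/
def freeLift {M : SemiMackey G} {T : Tambara G} (φ : M ⟶ T.mul) : free M ⟶ T where
  app X :=
    { toFun := Quot.lift (freeEval φ) fun _ _ h => freeEval_rel φ h
      map_one' := rfl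
      map_mul' x y := by
        induction x using Quot.ind with | _ a
        induction y using Quot.ind with | _ b
        rfl
      map_zero' := rfl
      map_add' x y := by
        induction x using Quot.ind with | _ a
        induction y using Quot.ind with | _ b
        rfl }
  res f x := by
    induction x using Quot.ind with | _ a
    rfl
  tr f x := by
    induction x using Quot.ind with | _ a
    rfl
  nm f x := by
    induction x using Quot.ind with | _ a
    rfl

theorem freeLift_gen {M : SemiMackey G} {T : Tambara G} (φ : M ⟶ T.mul) {X : FinGSet G}
    (m : M.obj X) : (freeLift φ).app X (gen M m) = φ.app X m := rfl

theorem free_hom_ext {M : SemiMackey G} {T : Tambara G} {φ ψ : free M ⟶ T}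
    (h : ∀ (X : FinGSet G) (m : M.obj X), φ.app X (gen M m) = ψ.app X (gen M m)) : φ = ψ := by
  refine hom_ext fun X x => ?_
  induction x using Quot.ind with | _ a
  induction a with
  | of m => exact h _ m
  | zero => exact (map_zero (φ.app _)).trans (map_zero (ψ.app _)).symm
  | one => exact (map_one (φ.app _)).trans (map_one (ψ.app _)).symm
  | neg a ih =>
    exact (map_neg (φ.app _) _).trans ((congrArg _ ih).trans (map_neg (ψ.app _) _).symm)
  | add a b iha ihb =>
    exact (map_add (φ.app _) _ _).trans ((congrArg₂ _ iha ihb).trans (map_add (ψ.app _) _ _).symm)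
  | mul a b iha ihb =>
    exact (map_mul (φ.app _) _ _).trans ((congrArg₂ _ iha ihb).trans (map_mul (ψ.app _) _ _).symm)
  | res f a ih => exact (φ.res f _).trans ((congrArg _ ih).trans (ψ.res f _).symm)
  | tr f a ih => exact (φ.tr f _).trans ((congrArg _ ih).trans (ψ.tr f _).symm)
  | nm f a ih => exact (φ.nm f _).trans ((congrArg _ ih).trans (ψ.nm f _).symm)

/-- The adjunction property of `Ω[M]`. -/
def freeEquiv (M : SemiMackey G) (T : Tambara G) : (free M ⟶ T) ≃ (M ⟶ T.mul) where
  toFun φ := freeUnit M ≫ (mulFunctor G).map φ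
  invFun := freeLift
  left_inv _ := free_hom_ext fun _ _ => rfl
  right_inv _ := rfl

/-- The morphism `Ω[M] → Ω[N]` induced by a morphism `M → N`. -/
def freeMap {M N : SemiMackey G} (φ : M ⟶ N) : free M ⟶ free N := freeLift (φ ≫ freeUnit N)

theorem freeMap_gen {M N : SemiMackey G} (φ : M ⟶ N) {X : FinGSet G} (m : M.obj X) :
    (freeMap φ).app X (gen M m) = gen N (φ.app X m) := rfl

/-- The Tambarization functor `M ↦ Ω[M]`. -/
def tambarization (G : Type u) [Group G] : SemiMackey G ⥤ Tambara G where
  obj := free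
  map := freeMap
  map_id _ := free_hom_ext fun _ _ => rfl
  map_comp _ _ := free_hom_ext fun _ _ => rfl

/-- Tambarization is left adjoint to taking multiplicative parts. -/
def tambarizationAdj (G : Type u) [Group G] : tambarization G ⊣ mulFunctor G :=
  Adjunction.mkOfHomEquiv
    { homEquiv := freeEquiv
      homEquiv_naturality_left_symm := fun _ _ => free_hom_ext fun _ _ => rfl
      homEquiv_naturality_right := fun _ _ => rfl }

end Tambara

namespace SemiMackey

variable {G : Type u} [Group G]

/-- The zero semi-Mackey functor. -/
def zero (G : Type u) [Group G] : SemiMackey G where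
  obj _ := PUnit
  res _ := 1
  tr _ := 1
  res_id _ := rfl
  res_comp _ _ _ := rfl
  tr_id _ := rfl
  tr_comp _ _ _ := rfl
  additive_empty _ _ := inferInstance
  additive_sum _ _ := ⟨fun _ _ _ => rfl, fun _ => ⟨PUnit.unit, rfl⟩⟩
  mackey _ _ := rfl

/-- The direct sum `M ⊕ N`. -/
def prod (M N : SemiMackey G) : SemiMackey G where
  obj X := M.obj X × N.obj X
  res f := (M.res f).prodMap (N.res f)
  tr f := (M.tr f).prodMap (N.tr f)
  res_id m := Prod.ext (M.res_id m.1) (N.res_id m.2)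
  res_comp g f m := Prod.ext (M.res_comp g f m.1) (N.res_comp g f m.2)
  tr_id m := Prod.ext (M.tr_id m.1) (N.tr_id m.2)
  tr_comp g f m := Prod.ext (M.tr_comp g f m.1) (N.tr_comp g f m.2)
  additive_empty X h := ⟨fun m n => Prod.ext ((M.additive_empty X h).elim _ _)
    ((N.additive_empty X h).elim _ _)⟩
  additive_sum X Y := by
    refine ⟨fun m n h => ?_, fun z => ?_⟩
    · have h1 : (M.res (inl X Y) m.1, N.res (inl X Y) m.2) =
          (M.res (inl X Y) n.1, N.res (inl X Y) n.2) := congrArg Prod.fst h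
      have h2 : (M.res (inr X Y) m.1, N.res (inr X Y) m.2) =
          (M.res (inr X Y) n.1, N.res (inr X Y) n.2) := congrArg Prod.snd h
      rw [Prod.mk.injEq] at h1 h2
      refine Prod.ext ((M.additive_sum X Y).1 ?_) ((N.additive_sum X Y).1 ?_)
      · exact Prod.ext h1.1 h2.1
      · exact Prod.ext h1.2 h2.2
    · obtain ⟨m, hm⟩ := (M.additive_sum X Y).2 (z.1.1, z.2.1)
      obtain ⟨n, hn⟩ := (N.additive_sum X Y).2 (z.1.2, z.2.2)
      obtain ⟨h1, h2⟩ := Prod.ext_iff.1 hm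
      obtain ⟨h3, h4⟩ := Prod.ext_iff.1 hn
      exact ⟨(m, n), Prod.ext (Prod.ext h1 h3) (Prod.ext h2 h4)⟩
  mackey h m := Prod.ext (M.mackey h m.1) (N.mackey h m.2)

/-- The inclusion `M → M ⊕ N`. -/
def prodInl (M N : SemiMackey G) : M ⟶ prod M N where
  app X := MonoidHom.inl (M.obj X) (N.obj X)
  res f _ := Prod.ext rfl (map_one (N.res f)).symm
  tr f _ := Prod.ext rfl (map_one (N.tr f)).symm

/-- The inclusion `N → M ⊕ N`. -/
def prodInr (M N : SemiMackey G) : N ⟶ prod M N where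
  app X := MonoidHom.inr (M.obj X) (N.obj X)
  res f _ := Prod.ext (map_one (M.res f)).symm rfl
  tr f _ := Prod.ext (map_one (M.tr f)).symm rfl

/-- The diagonal `M → M ⊕ M`. -/
def diag (M : SemiMackey G) : M ⟶ prod M M where
  app X := (MonoidHom.id (M.obj X)).prod (MonoidHom.id (M.obj X))
  res _ _ := rfl
  tr _ _ := rfl

/-- The zero morphism `M → 0`. -/
def toZero (M : SemiMackey G) : M ⟶ zero G where
  app _ := 1
  res _ _ := rfl
  tr _ _ := rfl

end SemiMackey

namespace Mackey

variable {G : Type u} [Group G] (M : Mackey G)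

/-- The inverse of an element of a Mackey functor. -/
def invElem {X : FinGSet G} (m : M.obj.obj X) : M.obj.obj X :=
  ((M.property X m).unit⁻¹ : (M.obj.obj X)ˣ)

theorem invElem_mul {X : FinGSet G} (m : M.obj.obj X) : invElem M m * m = 1 :=
  (M.property X m).val_inv_mul

theorem eq_invElem {X : FinGSet G} {m n : M.obj.obj X} (h : n * m = 1) : n = invElem M m :=
  left_inv_eq_right_inv h ((mul_comm _ _).trans (invElem_mul M m))

/-- The inverse morphism `M → M`. -/
def inv : M.obj ⟶ M.obj where
  app X :=
    { toFun := invElem M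
      map_one' := (eq_invElem M (mul_one 1)).symm
      map_mul' m n := (eq_invElem M (by
        rw [mul_mul_mul_comm, invElem_mul, invElem_mul, mul_one])).symm }
  res f m := (eq_invElem M (by
    change M.obj.res f (invElem M m) * _ = 1
    rw [← map_mul, invElem_mul, map_one])).symm
  tr f m := (eq_invElem M (by
    change M.obj.tr f (invElem M m) * _ = 1
    rw [← map_mul, invElem_mul, map_one])).symm

theorem hom_invElem {M N : Mackey G} (φ : M ⟶ N) {X : FinGSet G} (m : M.obj.obj X) :
    φ.hom.app X (invElem M m) = invElem N (φ.hom.app X m) :=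
  eq_invElem N (by rw [← map_mul, invElem_mul, map_one])

end Mackey

namespace Tambara

variable {G : Type u} [Group G]

/-- The Burnside Tambara functor `Ω`, which is `Ω[0]`. -/
def burnside (G : Type u) [Group G] : Tambara G := free (SemiMackey.zero G)

/-- The unique morphism `Ω → T`. -/
def fromBurnside (T : Tambara G) : burnside G ⟶ T :=
  freeLift (M := SemiMackey.zero G) ⟨fun _ => 1, fun f _ => (map_one (T.res f)).symm,
    fun f _ => (map_one (T.nm f)).symm⟩

/-- `Ω` is the initial Tambara functor. -/
def burnsideIsInitial (G : Type u) [Group G] : Limits.IsInitial (burnside G) :=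
  Limits.IsInitial.ofUniqueHom fromBurnside fun T φ =>
    free_hom_ext (M := SemiMackey.zero G) fun X m => by
      have h : gen (SemiMackey.zero G) m = 1 := gen_one _ X
      rw [h]
      exact (map_one (φ.app X)).trans (map_one ((fromBurnside T).app X)).symm

/-- The canonical isomorphism `Ω ⊗ T → T`. -/
def leftUnitor (T : Tambara G) : tensor (burnside G) T ⟶ T := tensorDesc (fromBurnside T) (𝟙 T)

/-- The canonical isomorphism `T ⊗ Ω → T`. -/
def rightUnitor (T : Tambara G) : tensor T (burnside G) ⟶ T := tensorDesc (𝟙 T) (fromBurnside T)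

/-- The multiplication morphism `∇ : T ⊗ T → T`. -/
def nabla (T : Tambara G) : tensor T T ⟶ T := tensorDesc (𝟙 T) (𝟙 T)

end Tambara

open Tambara

/-- A Hopf Tambara functor. -/
structure HopfTambara (G : Type u) [Group G] where
  toTambara : Tambara G
  comul : toTambara ⟶ tensor toTambara toTambara
  counit : toTambara ⟶ burnside G
  antipode : toTambara ⟶ toTambara
  coassoc : comul ≫ tensorMap comul (𝟙 toTambara) ≫ tensorAssoc toTambara toTambara toTambara =
    comul ≫ tensorMap (𝟙 toTambara) comul
  counit_left : comul ≫ tensorMap counit (𝟙 toTambara) ≫ leftUnitor toTambara = 𝟙 toTambara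
  counit_right : comul ≫ tensorMap (𝟙 toTambara) counit ≫ rightUnitor toTambara = 𝟙 toTambara
  antipode_left : comul ≫ tensorMap antipode (𝟙 toTambara) ≫ nabla toTambara =
    counit ≫ fromBurnside toTambara
  antipode_right : comul ≫ tensorMap (𝟙 toTambara) antipode ≫ nabla toTambara =
    counit ≫ fromBurnside toTambara

namespace HopfTambara

variable {G : Type u} [Group G]

/-- A morphism of Hopf Tambara functors. -/
@[ext]
structure Hom (H K : HopfTambara G) where
  hom : H.toTambara ⟶ K.toTambara
  comul : hom ≫ K.comul = H.comul ≫ tensorMap hom hom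
  counit : hom ≫ K.counit = H.counit
  antipode : hom ≫ K.antipode = H.antipode ≫ hom

theorem tensorMap_id (T S : Tambara G) : tensorMap (𝟙 T) (𝟙 S) = 𝟙 (tensor T S) :=
  hom_ext fun X x => by
    induction x using tensor_ind with | _ A p t s
    exact tensorMap_tmk _ _ _ _ _

theorem tensorMap_comp {T S T' S' T'' S'' : Tambara G} (φ : T ⟶ T') (ψ : S ⟶ S')
    (φ' : T' ⟶ T'') (ψ' : S' ⟶ S'') :
    tensorMap (φ ≫ φ') (ψ ≫ ψ') = tensorMap φ ψ ≫ tensorMap φ' ψ' :=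
  hom_ext fun X x => by
    induction x using tensor_ind with | _ A p t s
    rw [comp_app, tensorMap_tmk, tensorMap_tmk, tensorMap_tmk]
    rfl

instance : Category (HopfTambara G) where
  Hom := Hom
  id H := ⟨𝟙 _, by rw [tensorMap_id, Category.id_comp, Category.comp_id],
    Category.id_comp _, by rw [Category.id_comp, Category.comp_id]⟩
  comp φ ψ := ⟨φ.hom ≫ ψ.hom,
    by rw [Category.assoc, ψ.comul, ← Category.assoc, φ.comul, Category.assoc, tensorMap_comp],
    by rw [Category.assoc, ψ.counit, φ.counit],
    by rw [Category.assoc, ψ.antipode, ← Category.assoc, φ.antipode, Category.assoc]⟩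

/-- The functor forgetting the Hopf structure. -/
def forget (G : Type u) [Group G] : HopfTambara G ⥤ Tambara G where
  obj := toTambara
  map φ := φ.hom

/-- Group-like elements: `Δ_X(m) = [m ⊗ m]_{(X, id)}` and `ε_X(m) = 1`. -/
def IsGroupLike (H : HopfTambara G) (X : FinGSet G) (m : H.toTambara.obj X) : Prop :=
  H.comul.app X m = tmk H.toTambara H.toTambara (MulActionHom.id G) m m ∧
    H.counit.app X m = 1

end HopfTambara

namespace Tambara

variable {G : Type u} [Group G]

theorem tmk_id (T S : Tambara G) {X : FinGSet G} (t : T.obj X) (s : S.obj X) :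
    tmk T S (MulActionHom.id G) t s = (tensorInl T S).app X t * (tensorInr T S).app X s := by
  rw [tmk_eq_mul, Tambara.tr_id]

/-- The morphism `Ω[M ⊕ N] → Ω[M] ⊗ Ω[N]` that sends `(m, n)` to `[m ⊗ n]`. -/
def freeProdInv (M N : SemiMackey G) : free (M.prod N) ⟶ tensor (free M) (free N) :=
  freeLift (M := M.prod N)
    { app X :=
        { toFun m := (tensorInl (free M) (free N)).app X (gen M m.1) *
            (tensorInr (free M) (free N)).app X (gen N m.2)
          map_one' := by
            refine (congrArg₂ (· * ·) ?_ ?_).trans (mul_one 1)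
            · exact (congrArg _ (gen_one M X)).trans (map_one _)
            · exact (congrArg _ (gen_one N X)).trans (map_one _)
          map_mul' m n := by
            refine (congrArg₂ (· * ·) ?_ ?_).trans (mul_mul_mul_comm _ _ _ _)
            · exact (congrArg _ (gen_mul M m.1 n.1)).trans (map_mul _ _ _)
            · exact (congrArg _ (gen_mul N m.2 n.2)).trans (map_mul _ _ _) }
      res f m := by
        refine (congrArg₂ (· * ·) ?_ ?_).trans (map_mul ((tensor (free M) (free N)).res f) _ _).symm
        · exact (congrArg _ (gen_res M f m.1)).trans ((tensorInl _ _).res f _)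
        · exact (congrArg _ (gen_res N f m.2)).trans ((tensorInr _ _).res f _)
      tr f m := by
        refine (congrArg₂ (· * ·) ?_ ?_).trans (map_mul ((tensor (free M) (free N)).nm f) _ _).symm
        · exact (congrArg _ (gen_tr M f m.1)).trans ((tensorInl _ _).nm f _)
        · exact (congrArg _ (gen_tr N f m.2)).trans ((tensorInr _ _).nm f _) }

theorem freeProdInv_gen (M N : SemiMackey G) {X : FinGSet G} (m : M.obj X) (n : N.obj X) :
    (freeProdInv M N).app X (gen (M.prod N) (X := X) (m, n)) =
      tmk (free M) (free N) (MulActionHom.id G) (gen M m) (gen N n) :=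
  (tmk_id _ _ _ _).symm

/-- The isomorphism `c : Ω[M] ⊗ Ω[N] ≅ Ω[M ⊕ N]` arising from the inclusions of `M` and `N` in
`M ⊕ N`. -/
def freeProdIso (M N : SemiMackey G) : tensor (free M) (free N) ≅ free (M.prod N) where
  hom := tensorDesc (freeMap (M.prodInl N)) (freeMap (M.prodInr N))
  inv := freeProdInv M N
  hom_inv_id := by
    refine tensor_hom_ext ?_ ?_
    · rw [← Category.assoc, tensorInl_desc, Category.comp_id]
      refine free_hom_ext fun X m => ?_
      refine (freeProdInv_gen M N m 1).trans ((tmk_id _ _ _ _).trans ?_)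
      rw [gen_one, map_one, mul_one]
    · rw [← Category.assoc, tensorInr_desc, Category.comp_id]
      refine free_hom_ext fun X n => ?_
      refine (freeProdInv_gen M N 1 n).trans ((tmk_id _ _ _ _).trans ?_)
      rw [gen_one, map_one, one_mul]
  inv_hom_id := by
    refine free_hom_ext fun X m => ?_
    refine (congrArg ((tensorDesc (freeMap (M.prodInl N)) (freeMap (M.prodInr N))).app X)
      (freeProdInv_gen M N m.1 m.2)).trans ?_
    refine (tensorDesc_tmk _ _ _ _ _).trans ((Tambara.tr_id _ _).trans ?_)
    refine (gen_mul (M.prod N) (X := X) (m.1, 1) (1, m.2)).symm.trans ?_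
    refine congrArg (gen (M.prod N)) (Prod.ext ?_ ?_)
    · exact mul_one m.1
    · exact one_mul m.2

/-- The comultiplication `Δ_M : Ω[M] → Ω[M ⊕ M] ≅ Ω[M] ⊗ Ω[M]` induced by the diagonal. -/
def freeComul (M : SemiMackey G) : free M ⟶ tensor (free M) (free M) :=
  freeMap M.diag ≫ (freeProdIso M M).inv

/-- The counit `ε_M : Ω[M] → Ω[0] = Ω` induced by the zero morphism. -/
def freeCounit (M : SemiMackey G) : free M ⟶ burnside G := freeMap M.toZero

theorem freeComul_gen (M : SemiMackey G) {X : FinGSet G} (m : M.obj X) :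
    (freeComul M).app X (gen M m) =
      tmk (free M) (free M) (MulActionHom.id G) (gen M m) (gen M m) :=
  freeProdInv_gen M M m m

theorem freeCounit_gen (M : SemiMackey G) {X : FinGSet G} (m : M.obj X) :
    (freeCounit M).app X (gen M m) = 1 :=
  gen_one (SemiMackey.zero G) X

theorem freeMap_comul {M N : SemiMackey G} (φ : M ⟶ N) :
    freeMap φ ≫ freeComul N = freeComul M ≫ tensorMap (freeMap φ) (freeMap φ) :=
  free_hom_ext fun X m => by
    rw [comp_app, comp_app, freeComul_gen, tensorMap_tmk, freeMap_gen, freeComul_gen]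

theorem freeMap_counit {M N : SemiMackey G} (φ : M ⟶ N) :
    freeMap φ ≫ freeCounit N = freeCounit M :=
  free_hom_ext fun X m => by
    rw [comp_app, freeCounit_gen, freeMap_gen, freeCounit_gen]

theorem tensorAssoc_tmk (T S R : Tambara G) {X : FinGSet G} (t : T.obj X) (s : S.obj X)
    (r : R.obj X) :
    (tensorAssoc T S R).app X
      (tmk (tensor T S) R (MulActionHom.id G) (tmk T S (MulActionHom.id G) t s) r) =
    tmk T (tensor S R) (MulActionHom.id G) t (tmk S R (MulActionHom.id G) s r) := by
  rw [tensorAssoc, tensorDesc_tmk, tensorDesc_tmk, Tambara.tr_id, Tambara.tr_id, tmk_id, tmk_id,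
    map_mul, mul_assoc]
  rfl

end Tambara

namespace Mackey

variable {G : Type u} [Group G]

/-- The Hopf Tambara functor `Ω[M]` of a Mackey functor `M`, with `Δ_M`, `ε_M` and `η_M` induced by
the diagonal of `M`, the zero morphism of `M` and the inverse of `M`. -/
def hopf (M : Mackey G) : HopfTambara G where
  toTambara := free M.obj
  comul := freeComul M.obj
  counit := freeCounit M.obj
  antipode := freeMap (inv M)
  coassoc := free_hom_ext fun X m => by
    simp only [comp_app]
    rw [freeComul_gen, tensorMap_tmk, tensorMap_tmk, freeComul_gen, tensorAssoc_tmk]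
    rfl
  counit_left := free_hom_ext fun X m => by
    simp only [comp_app]
    rw [freeComul_gen, tensorMap_tmk, freeCounit_gen, leftUnitor, tensorDesc_tmk, Tambara.tr_id,
      map_one, one_mul]
    rfl
  counit_right := free_hom_ext fun X m => by
    simp only [comp_app]
    rw [freeComul_gen, tensorMap_tmk, freeCounit_gen, rightUnitor, tensorDesc_tmk, Tambara.tr_id,
      map_one, mul_one]
    rfl
  antipode_left := free_hom_ext fun X m => by
    simp only [comp_app]
    rw [freeComul_gen, tensorMap_tmk, freeCounit_gen, nabla, tensorDesc_tmk, Tambara.tr_id,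
      map_one, freeMap_gen]
    refine (gen_mul M.obj (invElem M m) m).symm.trans ?_
    rw [invElem_mul, gen_one]
  antipode_right := free_hom_ext fun X m => by
    simp only [comp_app]
    rw [freeComul_gen, tensorMap_tmk, freeCounit_gen, nabla, tensorDesc_tmk, Tambara.tr_id,
      map_one, freeMap_gen]
    refine (gen_mul M.obj m (invElem M m)).symm.trans ?_
    rw [mul_comm, invElem_mul, gen_one]

/-- The functor `Ω[-]` from Mackey functors to Hopf Tambara functors. -/
def hopfFunctor (G : Type u) [Group G] : Mackey G ⥤ HopfTambara G where
  obj := hopf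
  map {_ N} φ :=
    { hom := freeMap φ.hom
      comul := freeMap_comul φ.hom
      counit := freeMap_counit φ.hom
      antipode := free_hom_ext fun _ m =>
        congrArg (gen N.obj) (hom_invElem φ m).symm }
  map_id _ := HopfTambara.Hom.ext ((tambarization G).map_id _)
  map_comp φ ψ := HopfTambara.Hom.ext ((tambarization G).map_comp φ.hom ψ.hom)

end Mackey

end

/-! The statements about group-like elements are formal. The element `[m ⊗ m]` over the identity is
the product of the images of `m` under the two coprojections of `H ⊗ H`, and these coprojections,
`Δ` and `ε` are all morphisms of Tambara functors. Hence the two conditions on `m` survive products,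
restrictions and norms (`isGroupLike_iff`, `IsGroupLike.mul`, `IsGroupLike.res`, `IsGroupLike.nm`).
Evaluating the antipode axiom at a group-like `m` gives `m * η(m) = 1`, and any inverse of a
group-like element is group-like because inverses in a commutative ring are unique
(`IsGroupLike.mul_antipode`, `IsGroupLike.of_mul_eq_one`). This gives the Mackey functor of the
first part. The morphism of the third part is the adjoint of the inclusion. For the second part,
generators of `Ω[M]` are group-like because `Δ_M` comes from the diagonal.

What is not formal is that `M → Ω[M]` is injective. Since `Ω[M]` is a quotient of formal
expressions, nothing can be read off from it directly. By the universal property it is enough to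
find one Tambara functor `T` with an injective morphism `M → T^μ`.

Such a `T` is `ghost M`. An element at `X` assigns to each `v : V → X` an element of the monoid
algebra `𝔽₂[M(V)]`, multiplicatively in disjoint unions of `V`; no other compatibility between
different `V` is imposed. The product is pointwise, restriction is composition, the additive
transfer along `f` sums over all lifts of `v` along `f`, and the norm evaluates at the pull-back and
then applies the ring homomorphism induced by the transfer of `M`. A family is determined by its
values on orbits (`Ghost.ext_transitive`), where addition is pointwise. Values on all `V` are
nevertheless recorded, because the pull-back of an orbit need not be an orbit. Distributivity is the
universal property of the exponential diagram: lifts of `V` to `Π_f(A)` are sections of `A` over `V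
×_Y X` (`Ghost.distributive`).

An element `m` of `M(X)` gives the family of basis elements `[v^* m]`. It is compatible with norms
by the Mackey formula, and its value at the identity of `X` recovers `m` (`toGhost_injective`,
`gen_injective`). -/

noncomputable section

/-! ### Finite `G`-sets: disjoint unions, orbits and lifts -/

namespace FinGSet

variable {G : Type u} [Group G]

/-- The maps `i : A → V` and `j : B → V` exhibit `V` as the disjoint union of `A` and `B`. -/
structure IsCoprod {A B V : FinGSet G} (i : A →[G] V) (j : B →[G] V) : Prop where
  injL : Function.Injective i
  injR : Function.Injective j
  disj : ∀ a b, i a ≠ j b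
  cover : ∀ v, (∃ a, i a = v) ∨ ∃ b, j b = v

/-- An isomorphism counts as a disjoint union with empty second part. Multiplicativity over disjoint
unions therefore already contains invariance under isomorphism. -/
theorem isCoprod_empty {V' V : FinGSet G} {e : V' →[G] V} (he : Function.Bijective e) :
    IsCoprod e (fromEmpty V) :=
  ⟨he.1, fun z => z.elim, fun _ z => z.elim, fun v => Or.inl (he.2 v)⟩

theorem IsCoprod.copair_bijective {A B V : FinGSet G} {i : A →[G] V} {j : B →[G] V}
    (h : IsCoprod i j) : Function.Bijective (copair i j) := by
  constructor
  · rintro (a | a) (b | b) e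
    · exact congrArg Sum.inl (h.injL e)
    · exact (h.disj a b e).elim
    · exact (h.disj b a e.symm).elim
    · exact congrArg Sum.inr (h.injR e)
  · intro v
    rcases h.cover v with ⟨a, rfl⟩ | ⟨b, rfl⟩
    · exact ⟨Sum.inl a, rfl⟩
    · exact ⟨Sum.inr b, rfl⟩

theorem IsCoprod.isPullbackSq_left {A B V : FinGSet G} {i : A →[G] V} {j : B →[G] V}
    (h : IsCoprod i j) : IsPullbackSq (MulActionHom.id G) (MulActionHom.id G) i i :=
  ⟨fun _ => rfl, fun a _ e => ⟨a, ⟨rfl, h.injL e⟩, fun _ hw => hw.1⟩⟩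

theorem IsCoprod.symm {A B V : FinGSet G} {i : A →[G] V} {j : B →[G] V} (h : IsCoprod i j) :
    IsCoprod j i :=
  ⟨h.injR, h.injL, fun b a e => h.disj a b e.symm, fun v => (h.cover v).symm⟩

theorem IsCoprod.isPullbackSq_empty {A B V : FinGSet G} {i : A →[G] V} {j : B →[G] V}
    (h : IsCoprod i j) : IsPullbackSq (fromEmpty B) (fromEmpty A) j i :=
  ⟨fun z => z.elim, fun a b e => (h.disj a b e).elim⟩

/-- Maps out of a disjoint union can be glued. -/
theorem IsCoprod.exists_glue {A B V X : FinGSet G} {i : A →[G] V} {j : B →[G] V}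
    (h : IsCoprod i j) (x : A →[G] X) (y : B →[G] X) :
    ∃ z : V →[G] X, (∀ a, z (i a) = x a) ∧ ∀ b, z (j b) = y b := by
  -- The value at `v` is chosen together with what it must be on either part, so that equivariance
  -- can be read off from this property after the choice.
  have key : ∀ v, ∃ t : X, (∀ a, i a = v → t = x a) ∧ ∀ b, j b = v → t = y b := by
    intro v
    rcases h.cover v with ⟨a, rfl⟩ | ⟨b, rfl⟩
    · exact ⟨x a, fun a' e => by rw [h.injL e], fun b e => (h.disj a b e.symm).elim⟩
    · exact ⟨y b, fun a e => (h.disj a b e).elim, fun b' e => by rw [h.injR e]⟩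
  choose z hz1 hz2 using key
  refine ⟨⟨z, fun g v => ?_⟩, fun a => hz1 _ a rfl, fun b => hz2 _ b rfl⟩
  rcases h.cover v with ⟨a, rfl⟩ | ⟨b, rfl⟩
  · rw [hz1 _ a rfl, hz1 _ (g • a) (map_smul i g a), map_smul]; rfl
  · rw [hz2 _ b rfl, hz2 _ (g • b) (map_smul j g b), map_smul]; rfl

/-- The map of pull-backs induced by a map `i : A → V`. -/
def pbMap {A V X Y : FinGSet G} (i : A →[G] V) (y : V →[G] Y) (f : X →[G] Y) :
    pb (y.comp i) f →[G] pb y f :=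
  pbLift y f (i.comp (pbFst (y.comp i) f)) (pbSnd (y.comp i) f) fun z => z.2

/-- Disjoint unions are stable under pull-back. This is what keeps the norm of a multiplicative
family multiplicative. -/
theorem IsCoprod.pbMap {A B V X Y : FinGSet G} {i : A →[G] V} {j : B →[G] V}
    (h : IsCoprod i j) (y : V →[G] Y) (f : X →[G] Y) :
    IsCoprod (FinGSet.pbMap i y f) (FinGSet.pbMap j y f) where
  injL z w e := pb_ext (h.injL (congrArg (pbFst y f) e)) (congrArg (pbSnd y f) e)
  injR z w e := pb_ext (h.injR (congrArg (pbFst y f) e)) (congrArg (pbSnd y f) e)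
  disj z w e := h.disj _ _ (congrArg (pbFst y f) e)
  cover := by
    rintro ⟨⟨v, x⟩, e⟩
    rcases h.cover v with ⟨a, rfl⟩ | ⟨b, rfl⟩
    · exact Or.inl ⟨⟨(a, x), e⟩, rfl⟩
    · exact Or.inr ⟨⟨(b, x), e⟩, rfl⟩

/-- A finite `G`-set is transitive if it consists of exactly one orbit. -/
def IsTransitive (V : FinGSet G) : Prop :=
  Nonempty V ∧ ∀ a b : V, ∃ g : G, g • a = b

/-- The action preserves both summands, so the summand that contains the image of one point contains
the image of the whole orbit. -/
theorem IsTransitive.factors {V X Y : FinGSet G} (hV : IsTransitive V) (v : V →[G] sum X Y) :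
    (∃ w : V →[G] X, v = (inl X Y).comp w) ∨ ∃ w : V →[G] Y, v = (inr X Y).comp w := by
  obtain ⟨⟨v₀⟩, ht⟩ := hV
  rcases h : v v₀ with x | y
  · left
    have key : ∀ a, ∃ x', v a = Sum.inl x' := fun a => by
      obtain ⟨g, rfl⟩ := ht v₀ a
      exact ⟨g • x, by rw [map_smul, h]; rfl⟩
    choose w hw using key
    refine ⟨⟨w, fun g a => Sum.inl_injective (β := Y) ?_⟩, MulActionHom.ext hw⟩
    rw [← hw, map_smul, hw]; rfl
  · right
    have key : ∀ a, ∃ y', v a = Sum.inr y' := fun a => by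
      obtain ⟨g, rfl⟩ := ht v₀ a
      exact ⟨g • y, by rw [map_smul, h]; rfl⟩
    choose w hw using key
    refine ⟨⟨w, fun g a => Sum.inr_injective (α := X) ?_⟩, MulActionHom.ext hw⟩
    rw [← hw, map_smul, hw]; rfl

/-- An invariant subset of a finite `G`-set. -/
def sub (V : FinGSet G) (P : V → Prop) (hP : ∀ (g : G) v, P v → P (g • v)) : FinGSet G where
  carrier := {v : V // P v}
  action :=
    { smul := fun g v => ⟨g • v.1, hP g _ v.2⟩
      one_smul := fun v => Subtype.ext (one_smul G v.1)
      mul_smul := fun g h v => Subtype.ext (mul_smul g h v.1) }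

def subIncl (V : FinGSet G) (P : V → Prop) (hP : ∀ (g : G) v, P v → P (g • v)) :
    sub V P hP →[G] V :=
  ⟨fun v => v.1, fun _ _ => rfl⟩

/-- Induction on finite `G`-sets by splitting off orbits. -/
theorem orbit_induction {P : FinGSet G → Prop} (empty : ∀ V : FinGSet G, IsEmpty V → P V)
    (transitive : ∀ V : FinGSet G, IsTransitive V → P V)
    (coprod : ∀ {A B V : FinGSet G} (i : A →[G] V) (j : B →[G] V), IsCoprod i j → P A → P B → P V)
    (V : FinGSet G) : P V := by
  induction hn : Nat.card V using Nat.strong_induction_on generalizing V with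
  | _ n ih =>
  rcases isEmpty_or_nonempty V with h | ⟨⟨v₀⟩⟩
  · exact empty V h
  -- The orbit of `v₀` and its complement are both invariant, and `V` is their disjoint union.
  have hP : ∀ (g : G) (v : V), (∃ k : G, k • v₀ = v) → ∃ k : G, k • v₀ = g • v := by
    rintro g _ ⟨k, rfl⟩
    exact ⟨g * k, mul_smul _ _ _⟩
  have hQ : ∀ (g : G) (v : V), ¬(∃ k : G, k • v₀ = v) → ¬∃ k : G, k • v₀ = g • v := by
    rintro g v h ⟨k, hk⟩
    exact h ⟨g⁻¹ * k, by rw [mul_smul, hk, inv_smul_smul]⟩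
  refine coprod (subIncl V _ hP) (subIncl V _ hQ) ⟨Subtype.val_injective, Subtype.val_injective,
    ?_, ?_⟩ (transitive _ ⟨⟨⟨v₀, 1, one_smul _ _⟩⟩, ?_⟩) (ih _ ?_ _ rfl)
  · rintro ⟨a, ha⟩ ⟨b, hb⟩ (rfl : a = b)
    exact hb ha
  · intro v
    by_cases h : ∃ k : G, k • v₀ = v
    · exact Or.inl ⟨⟨v, h⟩, rfl⟩
    · exact Or.inr ⟨⟨v, h⟩, rfl⟩
  · rintro ⟨_, k, rfl⟩ ⟨_, l, rfl⟩
    refine ⟨l * k⁻¹, Subtype.ext ?_⟩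
    change (l * k⁻¹) • k • v₀ = l • v₀
    rw [mul_smul, inv_smul_smul]
  · rw [← hn]
    -- The complement misses `v₀`, so it is strictly smaller and the induction hypothesis applies to
    -- it.
    exact Finite.card_subtype_lt (x := v₀) fun h => h ⟨1, one_smul _ _⟩

/-- The lifts of `y : V → Y` along `f : X → Y`. -/
def Lift {V X Y : FinGSet G} (f : X →[G] Y) (y : V →[G] Y) : Type u :=
  {x : V →[G] X // ∀ v, f (x v) = y v}

/-- Equivariant maps inject into the functions between two finite sets. The additive transfer of
families is a sum over this type. -/
instance {V X Y : FinGSet G} (f : X →[G] Y) (y : V →[G] Y) : Fintype (Lift f y) :=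
  have : Finite (V →[G] X) := DFunLike.finite _
  Fintype.ofFinite {x : V →[G] X // ∀ v, f (x v) = y v}

theorem Lift.ext {V X Y : FinGSet G} {f : X →[G] Y} {y : V →[G] Y} {s t : Lift f y}
    (h : ∀ v, s.1 v = t.1 v) : s = t :=
  Subtype.ext (MulActionHom.ext h)

end FinGSet

open FinGSet

/-! ### Semi-Mackey functors on disjoint unions -/

namespace SemiMackey

variable {G : Type u} [Group G]

section Coprod

variable (M : SemiMackey G)

theorem tr_res_of_bijective {X Y : FinGSet G} {e : X →[G] Y} (he : Function.Bijective e)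
    (m : M.obj Y) : M.tr e (M.res e m) = m := by
  have h : IsPullbackSq e e (MulActionHom.id G) (MulActionHom.id G : Y →[G] Y) :=
    isPullbackSq_of_bijective (fun _ => rfl) he Function.bijective_id
  have := M.mackey h m
  rw [M.tr_id, M.res_id] at this
  exact this.symm

/-- Transport along the bijection from the canonical disjoint union reduces this to the additivity
axiom. -/
theorem coprod_ext {A B V : FinGSet G} {i : A →[G] V} {j : B →[G] V} (h : IsCoprod i j)
    {m n : M.obj V} (h1 : M.res i m = M.res i n) (h2 : M.res j m = M.res j n) : m = n := by
  rw [← M.tr_res_of_bijective h.copair_bijective m, ← M.tr_res_of_bijective h.copair_bijective n]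
  congr 1
  refine (M.additive_sum A B).1 (Prod.ext ?_ ?_)
  · dsimp only
    rw [← M.res_comp, ← M.res_comp]
    exact h1
  · dsimp only
    rw [← M.res_comp, ← M.res_comp]
    exact h2

theorem res_tr_left {A B V : FinGSet G} {i : A →[G] V} {j : B →[G] V} (h : IsCoprod i j)
    (m : M.obj A) : M.res i (M.tr i m) = m := by
  rw [M.mackey h.isPullbackSq_left, M.tr_id, M.res_id]

/-- The two parts meet in the empty set, so the Mackey formula passes through a trivial monoid. -/
theorem res_tr_disjoint {A B V : FinGSet G} {i : A →[G] V} {j : B →[G] V} (h : IsCoprod i j)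
    (m : M.obj B) : M.res i (M.tr j m) = 1 := by
  have := M.additive_empty (FinGSet.empty G) inferInstance
  rw [M.mackey h.isPullbackSq_empty, Subsingleton.elim (M.res (fromEmpty B) m) 1, map_one]

/-- Restricted to either part, one factor returns the restriction of `m` and the other becomes `1`.
This identity makes the family of restrictions of an element of `M(X)` multiplicative over disjoint
unions. -/
theorem tr_res_mul_tr_res {A B V : FinGSet G} {i : A →[G] V} {j : B →[G] V} (h : IsCoprod i j)
    (m : M.obj V) : M.tr i (M.res i m) * M.tr j (M.res j m) = m := by
  refine M.coprod_ext h ?_ ?_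
  · rw [map_mul, M.res_tr_left h, M.res_tr_disjoint h, mul_one]
  · rw [map_mul, M.res_tr_left h.symm, M.res_tr_disjoint h.symm, one_mul]

end Coprod

/-! ### Monoid algebras over `𝔽₂` -/

variable {M : SemiMackey G}

variable (M) in
/-- The monoid algebra `𝔽₂[M(V)]`. -/
abbrev MonAlg (V : FinGSet G) : Type (u + 1) := MonoidAlgebra (ZMod 2) (M.obj V)

/-- Characteristic two is the reason for the coefficients `𝔽₂`. The negative of a multiplicative
family would in general need a sign depending on the number of orbits of `V`; here the identity
serves as negation. -/
theorem MonAlg.add_self {V : FinGSet G} (a : MonAlg M V) : a + a = 0 := by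
  rw [← two_smul (ZMod 2), show (2 : ZMod 2) = 0 from rfl, zero_smul]

/-- The ring homomorphism `𝔽₂[M(A)] → 𝔽₂[M(V)]` induced by the transfer. -/
def push {A V : FinGSet G} (i : A →[G] V) : MonAlg M A →+* MonAlg M V :=
  MonoidAlgebra.mapDomainRingHom (ZMod 2) (M.tr i)

theorem push_of {A V : FinGSet G} (i : A →[G] V) (m : M.obj A) :
    push i (MonoidAlgebra.of (ZMod 2) _ m) = MonoidAlgebra.of (ZMod 2) _ (M.tr i m) := by
  rw [push, MonoidAlgebra.mapDomainRingHom_apply, MonoidAlgebra.of_apply,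
    MonoidAlgebra.mapDomain_single, MonoidAlgebra.of_apply]

theorem push_comp {A B V : FinGSet G} (i : B →[G] V) (j : A →[G] B) (a : MonAlg M A) :
    push (i.comp j) a = push i (push j a) := by
  have h : M.tr (i.comp j) = (M.tr i).comp (M.tr j) := MonoidHom.ext (M.tr_comp i j)
  rw [push, h, MonoidAlgebra.mapDomainRingHom_comp]
  rfl

theorem push_id {A : FinGSet G} (a : MonAlg M A) : push (MulActionHom.id G) a = a := by
  have h : M.tr (MulActionHom.id G : A →[G] A) = MonoidHom.id _ := MonoidHom.ext M.tr_id
  rw [push, h, MonoidAlgebra.mapDomainRingHom_id]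
  rfl

/-! ### Multiplicative families and their operations -/

variable (M) in
/-- The families of elements of `𝔽₂[M(V)]`, for the finite `G`-sets `V` over `X`, that are
multiplicative for disjoint unions. -/
@[ext]
structure Ghost (X : FinGSet G) where
  val : ∀ (V : FinGSet G) (_ : V →[G] X), MonAlg M V
  val_empty : ∀ (V : FinGSet G) (v : V →[G] X), IsEmpty V → val V v = 1
  val_coprod : ∀ {A B V : FinGSet G} (i : A →[G] V) (j : B →[G] V), IsCoprod i j →
    ∀ v : V →[G] X, val V v = push i (val A (v.comp i)) * push j (val B (v.comp j))

namespace Ghost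

/-- Multiplicativity rebuilds every value from the values on orbits. Identities that involve sums
are checked only there, since addition is pointwise on orbits but not in general. -/
theorem ext_transitive {X : FinGSet G} {c d : Ghost M X}
    (h : ∀ (V : FinGSet G) (v : V →[G] X), IsTransitive V → c.val V v = d.val V v) : c = d := by
  refine Ghost.ext (funext fun V => ?_)
  induction V using orbit_induction with
  | empty V hV => exact funext fun v => by rw [c.val_empty V v hV, d.val_empty V v hV]
  | transitive V hV => exact funext fun v => h V v hV
  | coprod i j hij h1 h2 =>
    exact funext fun v => by rw [c.val_coprod i j hij, d.val_coprod i j hij, h1, h2]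

/-- This is multiplicativity for a disjoint union whose second part is empty and contributes `1`. -/
theorem val_of_bijective {X V V' : FinGSet G} (c : Ghost M X) {e : V' →[G] V}
    (he : Function.Bijective e) (v : V →[G] X) : c.val V v = push e (c.val V' (v.comp e)) := by
  rw [c.val_coprod e (fromEmpty V) (isCoprod_empty he), c.val_empty (FinGSet.empty G) _ inferInstance,
    map_one, mul_one]

instance (X : FinGSet G) : One (Ghost M X) :=
  ⟨{  val _ _ := 1
      val_empty _ _ _ := rfl
      val_coprod _ _ _ _ := by rw [map_one, map_one, mul_one] }⟩

instance (X : FinGSet G) : Mul (Ghost M X) :=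
  ⟨fun c d =>
    { val V v := c.val V v * d.val V v
      val_empty V v h := by rw [c.val_empty V v h, d.val_empty V v h, mul_one]
      val_coprod i j h v := by
        rw [c.val_coprod i j h, d.val_coprod i j h, map_mul, map_mul, mul_mul_mul_comm] }⟩

theorem mul_val {X V : FinGSet G} (c d : Ghost M X) (v : V →[G] X) :
    (c * d).val V v = c.val V v * d.val V v := rfl

instance (X : FinGSet G) : CommMonoid (Ghost M X) where
  mul_assoc c d e := Ghost.ext (funext fun V => funext fun v => mul_assoc _ _ _)
  one_mul c := Ghost.ext (funext fun V => funext fun v => one_mul _)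
  mul_one c := Ghost.ext (funext fun V => funext fun v => mul_one _)
  mul_comm c d := Ghost.ext (funext fun V => funext fun v => mul_comm _ _)

/-- Restriction of families. -/
def res {X Y : FinGSet G} (f : X →[G] Y) (c : Ghost M Y) : Ghost M X where
  val V v := c.val V (f.comp v)
  val_empty V _ h := c.val_empty V _ h
  val_coprod i j h v := c.val_coprod i j h (f.comp v)

/-- The additive transfer of families: the sum over all lifts. -/
def tr {X Y : FinGSet G} (f : X →[G] Y) (c : Ghost M X) : Ghost M Y where
  val V v := ∑ x : Lift f v, c.val V x.1
  val_empty V v h := by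
    -- The empty set has exactly one lift, so the sum has one term, equal to `1`.
    let x₀ : Lift f v := ⟨⟨fun a => (h.false a).elim, fun _ a => (h.false a).elim⟩,
      fun a => (h.false a).elim⟩
    have : Unique (Lift f v) := ⟨⟨x₀⟩, fun x => Lift.ext fun a => (h.false a).elim⟩
    rw [Fintype.sum_unique, c.val_empty V _ h]
  val_coprod {A B V} i j h v := by
    -- The product of the two sums expands over pairs of lifts on the two parts, and such pairs are
    -- the same as lifts on the whole of `V`.
    rw [map_sum, map_sum, Fintype.sum_mul_sum, ← Fintype.sum_prod_type']
    refine Fintype.sum_bijective (fun x : Lift f v =>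
      ((⟨x.1.comp i, fun a => x.2 (i a)⟩, ⟨x.1.comp j, fun a => x.2 (j a)⟩) :
        Lift f (v.comp i) × Lift f (v.comp j))) ⟨fun x y e => ?_, fun y => ?_⟩ _ _
      fun x => c.val_coprod i j h x.1
    · have e1 := congrArg (fun z : Lift f (v.comp i) × Lift f (v.comp j) => z.1.1) e
      have e2 := congrArg (fun z : Lift f (v.comp i) × Lift f (v.comp j) => z.2.1) e
      refine Lift.ext fun a => ?_
      rcases h.cover a with ⟨a, rfl⟩ | ⟨b, rfl⟩
      · exact DFunLike.congr_fun e1 a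
      · exact DFunLike.congr_fun e2 b
    · obtain ⟨z, hz1, hz2⟩ := h.exists_glue y.1.1 y.2.1
      refine ⟨⟨z, fun a => ?_⟩, Prod.ext (Lift.ext hz1) (Lift.ext hz2)⟩
      rcases h.cover a with ⟨a, rfl⟩ | ⟨b, rfl⟩
      · rw [hz1]; exact y.1.2 a
      · rw [hz2]; exact y.2.2 b

/-- The multiplicative transfer of families: restriction to the pull-back, followed by the transfer
in `M`. -/
def nm {X Y : FinGSet G} (f : X →[G] Y) (c : Ghost M X) : Ghost M Y where
  val V v := push (pbFst v f) (c.val (pb v f) (pbSnd v f))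
  val_empty V v h := by
    rw [c.val_empty _ _ ⟨fun z => h.false (pbFst v f z)⟩, map_one]
  val_coprod i j h v := by
    rw [c.val_coprod _ _ (h.pbMap v f), map_mul, ← push_comp, ← push_comp, ← push_comp,
      ← push_comp]
    rfl

theorem res_val {X Y V : FinGSet G} (f : X →[G] Y) (c : Ghost M Y) (v : V →[G] X) :
    (res f c).val V v = c.val V (f.comp v) := rfl

theorem tr_val {X Y V : FinGSet G} (f : X →[G] Y) (c : Ghost M X) (v : V →[G] Y) :
    (tr f c).val V v = ∑ x : Lift f v, c.val V x.1 := rfl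

/-- Invariance under isomorphism allows any pull-back in place of the canonical one, so that later
computations can use the most convenient model. -/
theorem nm_val {X Y V U : FinGSet G} {f : X →[G] Y} {v : V →[G] Y} {b : U →[G] X} {a : U →[G] V}
    (h : IsPullbackSq b a f v) (c : Ghost M X) : (nm f c).val V v = push a (c.val U b) := by
  change push (pbFst v f) (c.val (pb v f) (pbSnd v f)) = _
  rw [c.val_of_bijective h.pbLift_bijective, ← push_comp]
  rfl

theorem nm_mul {X Y : FinGSet G} (f : X →[G] Y) (c d : Ghost M X) :
    nm f (c * d) = nm f c * nm f d :=
  Ghost.ext (funext fun _ => funext fun _ => map_mul (push _) _ _)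

theorem nm_one {X Y : FinGSet G} (f : X →[G] Y) : nm f (1 : Ghost M X) = 1 :=
  Ghost.ext (funext fun _ => funext fun _ => map_one (push _))

/-! ### The ring structure on families -/

/-- A constant family `0` would violate the normalisation on the empty set. The transfer from the
empty set has value `1` there and `0` on every nonempty `V`, which has no lifts. -/
instance (X : FinGSet G) : Zero (Ghost M X) := ⟨tr (fromEmpty X) 1⟩

/-- The identity is a negation because the monoid algebras have characteristic two. -/
instance (X : FinGSet G) : Neg (Ghost M X) := ⟨id⟩

/-- A pointwise sum is not multiplicative, since the product of two sums has cross terms. The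
product of the two norms is the family on `X ⨿ X` that restricts to `c` and to `d`; its transfer
along the fold map sums over all splittings of `V` into two invariant parts, with `c` used on one
and `d` on the other. -/
instance (X : FinGSet G) : Add (Ghost M X) :=
  ⟨fun c d => tr (copair (MulActionHom.id G) (MulActionHom.id G : X →[G] X))
    (nm (inl X X) c * nm (inr X X) d)⟩

theorem zero_val {X V : FinGSet G} (hV : IsTransitive V) (v : V →[G] X) :
    (0 : Ghost M X).val V v = 0 := by
  have : IsEmpty (Lift (fromEmpty X) v) := ⟨fun x => (x.1 hV.1.some).elim⟩
  exact Fintype.sum_empty _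

/-- A map that lands in the first summand has `V` itself as its pull-back along `inl`. -/
theorem nm_inl_val_inl {X Y V : FinGSet G} (c : Ghost M X) (v : V →[G] X) :
    (nm (inl X Y) c).val V ((inl X Y).comp v) = c.val V v := by
  refine (nm_val (a := MulActionHom.id G) (b := v) ⟨fun _ => rfl, fun a b h => ⟨a, ⟨rfl, ?_⟩,
    fun _ hw => hw.1⟩⟩ c).trans (push_id _)
  exact Sum.inl_injective h

theorem nm_inr_val_inr {X Y V : FinGSet G} (c : Ghost M Y) (v : V →[G] Y) :
    (nm (inr X Y) c).val V ((inr X Y).comp v) = c.val V v := by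
  refine (nm_val (a := MulActionHom.id G) (b := v) ⟨fun _ => rfl, fun a b h => ⟨a, ⟨rfl, ?_⟩,
    fun _ hw => hw.1⟩⟩ c).trans (push_id _)
  exact Sum.inr_injective h

/-- The summands are disjoint, so the pull-back is empty and the family takes the value `1` on it.
-/
theorem nm_inl_val_inr {X Y V : FinGSet G} (c : Ghost M X) (v : V →[G] Y) :
    (nm (inl X Y) c).val V ((inr X Y).comp v) = 1 := by
  refine (nm_val (a := fromEmpty V) (b := fromEmpty X) ⟨fun z => z.elim, fun a b h => ?_⟩ c).trans ?_
  · exact (Sum.inr_ne_inl h).elim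
  · rw [c.val_empty _ _ inferInstance, map_one]

theorem nm_inr_val_inl {X Y V : FinGSet G} (c : Ghost M Y) (v : V →[G] X) :
    (nm (inr X Y) c).val V ((inl X Y).comp v) = 1 := by
  refine (nm_val (a := fromEmpty V) (b := fromEmpty Y) ⟨fun z => z.elim, fun a b h => ?_⟩ c).trans ?_
  · exact (Sum.inl_ne_inr h).elim
  · rw [c.val_empty _ _ inferInstance, map_one]

/-- An orbit cannot be split, so it has exactly two lifts through the fold map, one into each copy
of `X`. -/
theorem add_val {X V : FinGSet G} (hV : IsTransitive V) (c d : Ghost M X) (v : V →[G] X) :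
    (c + d).val V v = c.val V v + d.val V v := by
  let f := copair (MulActionHom.id G) (MulActionHom.id G : X →[G] X)
  let l : Lift f v := ⟨(inl X X).comp v, fun _ => rfl⟩
  let r : Lift f v := ⟨(inr X X).comp v, fun _ => rfl⟩
  -- A point of `V` tells the two lifts apart, and transitivity shows that there are no others.
  have hb : Function.Bijective (fun b : Bool => cond b l r) := by
    obtain ⟨v₀⟩ := hV.1
    have hlr : l ≠ r := fun e => Sum.inl_ne_inr (DFunLike.congr_fun (congrArg Subtype.val e) v₀)
    refine ⟨?_, fun x => ?_⟩
    · rintro (_ | _) (_ | _) e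
      · rfl
      · exact (hlr e.symm).elim
      · exact (hlr e).elim
      · rfl
    · obtain ⟨x, hx⟩ := x
      rcases hV.factors x with ⟨w, rfl⟩ | ⟨w, rfl⟩
      · exact ⟨true, Lift.ext fun a => congrArg Sum.inl (hx a).symm⟩
      · exact ⟨false, Lift.ext fun a => congrArg Sum.inr (hx a).symm⟩
  refine (Fintype.sum_bijective _ hb _ _ fun _ => rfl).symm.trans ?_
  rw [Fintype.sum_bool]
  change (nm (inl X X) c).val V ((inl X X).comp v) * (nm (inr X X) d).val V ((inl X X).comp v) +
    (nm (inl X X) c).val V ((inr X X).comp v) * (nm (inr X X) d).val V ((inr X X).comp v) = _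
  -- In each of the two terms the norm from the wrong summand contributes `1`.
  rw [nm_inl_val_inl, nm_inr_val_inl, nm_inl_val_inr, nm_inr_val_inr, mul_one, one_mul]

/-- On orbits both operations are those of the commutative rings `𝔽₂[M(V)]`, so every axiom
involving sums is inherited from them. -/
instance (X : FinGSet G) : CommRing (Ghost M X) where
  add_assoc c d e := ext_transitive fun V v h => by simp only [add_val h, add_assoc]
  zero_add c := ext_transitive fun V v h => by rw [add_val h, zero_val h, zero_add]
  add_zero c := ext_transitive fun V v h => by rw [add_val h, zero_val h, add_zero]
  add_comm c d := ext_transitive fun V v h => by rw [add_val h, add_val h, add_comm]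
  neg_add_cancel c := ext_transitive fun V v h => by
    rw [add_val h, zero_val h]
    exact MonAlg.add_self _
  nsmul := nsmulRec
  zsmul := zsmulRec
  left_distrib c d e := ext_transitive fun V v h => by simp only [add_val h, mul_val, mul_add]
  right_distrib c d e := ext_transitive fun V v h => by simp only [add_val h, mul_val, add_mul]
  zero_mul c := ext_transitive fun V v h => by rw [mul_val, zero_val h, zero_mul]
  mul_zero c := ext_transitive fun V v h => by rw [mul_val, zero_val h, mul_zero]
  mul_assoc := mul_assoc
  one_mul := one_mul
  mul_one := mul_one
  mul_comm := mul_comm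

/-! ### The Tambara identities for families -/

theorem res_add {X Y : FinGSet G} (f : X →[G] Y) (c d : Ghost M Y) :
    res f (c + d) = res f c + res f d :=
  ext_transitive fun V v h => by simp only [add_val h, res_val]

theorem tr_add {X Y : FinGSet G} (f : X →[G] Y) (c d : Ghost M X) :
    tr f (c + d) = tr f c + tr f d :=
  ext_transitive fun V v h => by simp only [add_val h, tr_val, Finset.sum_add_distrib]

theorem tr_id {X : FinGSet G} (c : Ghost M X) : tr (MulActionHom.id G) c = c := by
  refine Ghost.ext (funext fun V => funext fun v => ?_)
  let _ : Unique (Lift (MulActionHom.id G : X →[G] X) v) := ⟨⟨v, fun _ => rfl⟩, fun x => Lift.ext x.2⟩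
  exact Fintype.sum_unique fun x : Lift (MulActionHom.id G : X →[G] X) v => c.val V x.1

/-- A lift along the composite amounts to a lift along `g` together with a lift of that lift along
`f`, so the sum can be taken in two stages. -/
theorem tr_comp {X Y Z : FinGSet G} (g : Y →[G] Z) (f : X →[G] Y) (c : Ghost M X) :
    tr (g.comp f) c = tr g (tr f c) := by
  refine Ghost.ext (funext fun V => funext fun v => ?_)
  simp only [tr_val]
  rw [← Fintype.sum_sigma' (fun (y : Lift g v) (x : Lift f y.1) => c.val V x.1)]
  refine Fintype.sum_bijective (fun x : Lift (g.comp f) v =>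
    (⟨⟨f.comp x.1, x.2⟩, ⟨x.1, fun _ => rfl⟩⟩ : Σ y : Lift g v, Lift f y.1))
    ⟨fun x y e => ?_, ?_⟩ _ _ fun _ => rfl
  · exact Subtype.ext (congrArg (fun z : Σ y : Lift g v, Lift f y.1 => z.2.1) e)
  · rintro ⟨⟨y, hy⟩, ⟨x, hx⟩⟩
    obtain rfl : f.comp x = y := MulActionHom.ext hx
    exact ⟨⟨x, hy⟩, rfl⟩

theorem nm_id {X : FinGSet G} (c : Ghost M X) : nm (MulActionHom.id G) c = c := by
  refine Ghost.ext (funext fun V => funext fun v => ?_)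
  refine (nm_val (a := MulActionHom.id G) (b := v) ⟨fun _ => rfl, fun a b h => ⟨a, ⟨rfl, h⟩,
    fun _ hw => hw.1⟩⟩ c).trans (push_id _)

/-- Pull-backs paste: the pull-back of `v` along the composite is obtained by pulling back along `g`
and then along `f`, and the two pushes compose. -/
theorem nm_comp {X Y Z : FinGSet G} (g : Y →[G] Z) (f : X →[G] Y) (c : Ghost M X) :
    nm (g.comp f) c = nm g (nm f c) := by
  refine Ghost.ext (funext fun V => funext fun v => ?_)
  let U := pb (pbSnd v g) f
  refine (nm_val (U := U) (a := (pbFst v g).comp (pbFst (pbSnd v g) f))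
    (b := pbSnd (pbSnd v g) f) ⟨fun z => ?_, fun a b h => ?_⟩ c).trans (push_comp _ _ _)
  · exact (pbFst (pbSnd v g) f z).2.trans (congrArg g z.2)
  · refine ⟨⟨(⟨(a, f b), h⟩, b), rfl⟩, ⟨rfl, rfl⟩, ?_⟩
    rintro ⟨⟨⟨⟨a', y⟩, h1⟩, b'⟩, h2⟩ ⟨e1, e2⟩
    obtain rfl : a' = a := e1
    obtain rfl : b' = b := e2
    obtain rfl : y = f b' := h2
    rfl

/-- By the universal property of the pull-back, lifts of `v` along `x` correspond to lifts of `f ∘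
v` along `y`. The two sums then agree term by term. -/
theorem mackey_tr {X' Y' X Y : FinGSet G} {f' : X' →[G] Y'} {x : X' →[G] X} {y : Y' →[G] Y}
    {f : X →[G] Y} (h : IsPullbackSq f' x y f) (c : Ghost M Y') :
    res f (tr y c) = tr x (res f' c) := by
  refine Ghost.ext (funext fun V => funext fun v => ?_)
  let e : Lift x v → Lift y (f.comp v) := fun z =>
    ⟨f'.comp z.1, fun a => (h.1 _).symm.trans (congrArg f (z.2 a))⟩
  refine (Fintype.sum_bijective e ⟨fun z w e => ?_, fun w => ?_⟩ _ _ fun _ => rfl).symm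
  · refine Lift.ext fun a => h.ext ((z.2 a).trans (w.2 a).symm) ?_
    exact DFunLike.congr_fun (congrArg Subtype.val e) a
  · obtain ⟨z, h1, h2⟩ := h.exists_lift v w.1 fun a => (w.2 a).symm
    exact ⟨⟨z, h1⟩, Lift.ext h2⟩

/-- Pasting of squares makes the pull-back of `v` along `x` also a pull-back of `f ∘ v` along `y`,
so both sides evaluate the family on the same set. -/
theorem mackey_nm {X' Y' X Y : FinGSet G} {f' : X' →[G] Y'} {x : X' →[G] X} {y : Y' →[G] Y}
    {f : X →[G] Y} (h : IsPullbackSq f' x y f) (c : Ghost M Y') :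
    res f (nm y c) = nm x (res f' c) := by
  refine Ghost.ext (funext fun V => funext fun v => ?_)
  refine nm_val (U := pb v x) (a := pbFst v x) (b := f'.comp (pbSnd v x))
    ⟨fun z => ?_, fun a b e => ?_⟩ c
  · exact (congrArg f z.2).trans (h.1 _)
  · obtain ⟨z, h1, h2⟩ := h.exists (v a) b e
    refine ⟨⟨(a, z), h1.symm⟩, ⟨rfl, h2⟩, fun w hw => pb_ext hw.1 (h.ext ?_ (hw.2.trans h2.symm))⟩
    refine Eq.trans w.2.symm (Eq.trans ?_ h1.symm)
    exact congrArg v hw.1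

/-- The push is additive, so the left side is a sum over lifts of `V ×_Y X → X` to `A`, and the
right side is a sum over lifts of `V → Y` to `B`. These sets correspond because `B` is the set of
sections of `p` over the fibres of `f`: a lift `b` goes to the composite of its base change `V ×_Y X
→ Z` with `l`. Corresponding terms are equal because `V ×_Y X` is also the pull-back of `b` along
`r`. -/
theorem distributive {X Y A Z B : FinGSet G} {f : X →[G] Y} {p : A →[G] X} {l : Z →[G] A}
    {r : Z →[G] B} {q : B →[G] Y} (h : IsExponential f p l r q) (c : Ghost M A) :
    nm f (tr p c) = tr q (nm r (res l c)) := by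
  refine Ghost.ext (funext fun V => funext fun v => ?_)
  have hpb := h.isPullbackSq
  -- `k b` is the base change of `b` to a map from `V ×_Y X` to `Z`, where `Z` is the pull-back of
  -- `X` and `B` over `Y`.
  choose k hk1 hk2 using fun b : Lift q v =>
    hpb.exists_lift (pbSnd v f) (b.1.comp (pbFst v f)) fun w => w.2.symm.trans (b.2 _).symm
  have hk : ∀ b : Lift q v, IsPullbackSq (k b) (pbFst v f) r b.1 := fun b => by
    refine ⟨fun w => (hk2 b w).symm, fun a z e => ?_⟩
    have hz : v a = f (p (l z)) := by
      rw [← b.2, e]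
      exact (hpb.1 z).symm
    refine ⟨⟨(a, p (l z)), hz⟩, ⟨rfl, hpb.ext (hk1 b _) ((hk2 b _).trans e)⟩, ?_⟩
    rintro w ⟨h1, h2⟩
    exact pb_ext h1 ((hk1 b w).symm.trans (congrArg (fun z => p (l z)) h2))
  have hr : ∀ b : Lift q v, (nm r (res l c)).val V b.1 =
      push (pbFst v f) (c.val (pb v f) (l.comp (k b))) := fun b => nm_val (hk b) _
  change push (pbFst v f) (∑ x : Lift p (pbSnd v f), c.val (pb v f) x.1) =
    ∑ b : Lift q v, (nm r (res l c)).val V b.1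
  rw [map_sum]
  simp only [hr]
  let e : Lift q v → Lift p (pbSnd v f) := fun b => ⟨l.comp (k b), hk1 b⟩
  refine (Fintype.sum_bijective e ⟨fun b b' e => Lift.ext fun a => ?_, fun s => ?_⟩ _ _ fun _ => rfl).symm
  · have e' : ∀ w, l (k b w) = l (k b' w) := DFunLike.congr_fun (congrArg Subtype.val e)
    -- A point of `B` is determined by its section. Every point of `Z` over `b a` or `b' a` comes
    -- from `V ×_Y X`, where the two composites with `l` agree by assumption.
    refine h.inj ((b.2 a).trans (b'.2 a).symm) fun z z' hz hz' hzz => ?_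
    obtain ⟨w, h1, rfl⟩ := (hk b).exists a z hz.symm
    obtain ⟨w', h1', rfl⟩ := (hk b').exists a z' hz'.symm
    rw [e' w]
    congr 2
    exact pb_ext (h1.trans h1'.symm)
      (((hk1 b w).symm.trans hzz).trans (hk1 b' w'))
  -- For each `a`, the restriction of `s` to the fibre over `a` is a section of `p` over the fibre
  -- of `f` at `v a`, and hence comes from a point of `B`.
  · choose b hb1 hb2 using fun a : V =>
      h.surj (v a) (fun x hx => s.1 ⟨(a, x), hx.symm⟩) fun x hx => s.2 _
    have hb3 : ∀ (w : pb v f) z, r z = b (pbFst v f w) → p (l z) = pbSnd v f w → l z = s.1 w :=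
      fun w z hz hx => hb2 _ z _ w.2.symm hz hx
    -- The points were chosen one at a time, so equivariance has to be proved. The points `b (g •
    -- a)` and `g • b a` have the same image in `Y`, so it suffices to compare their sections. A
    -- point over `g • b a` is moved back by `g⁻¹` to lie over `b a`, and the equivariance of `s`
    -- gives the comparison.
    let b' : V →[G] B := ⟨b, fun g a => by
      refine h.inj ?_ fun z z' hz hz' hzz => ?_
      · rw [hb1, map_smul, map_smul, hb1]; rfl
      · have hz2 : r (g⁻¹ • z') = b a := by
          rw [map_smul, hz']
          exact inv_smul_smul _ _
        have hw : v a = f (p (l (g⁻¹ • z'))) := by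
          rw [← hb1, ← hz2]
          exact (hpb.1 _).symm
        let w : pb v f := ⟨(a, p (l (g⁻¹ • z'))), hw⟩
        have h1 : l (g⁻¹ • z') = s.1 w := hb3 w _ hz2 rfl
        have h2 : l z = s.1 (g • w) := hb3 (g • w) z hz (by
          rw [map_smul, hzz]
          change _ = g • p (l (g⁻¹ • z'))
          rw [map_smul, map_smul, smul_inv_smul])
        rw [h2, map_smul, ← h1, map_smul, smul_inv_smul]⟩
    refine ⟨⟨b', hb1⟩, Lift.ext fun w => ?_⟩
    exact hb3 w _ (hk2 _ w) (hk1 _ w)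

/-- An orbit over `X ⨿ Y` lies over one of the summands, which gives injectivity. The product of the
two norms is a preimage, since the norm from the other summand restricts to `1`. -/
theorem additive_sum (X Y : FinGSet G) :
    Function.Bijective fun c : Ghost M (sum X Y) => (res (inl X Y) c, res (inr X Y) c) := by
  refine ⟨fun c d h => ext_transitive fun V v hV => ?_, fun z => ⟨nm (inl X Y) z.1 * nm (inr X Y) z.2,
    Prod.ext ?_ ?_⟩⟩
  · rcases hV.factors v with ⟨w, rfl⟩ | ⟨w, rfl⟩
    · exact congrArg (fun e : Ghost M X × Ghost M Y => e.1.val V w) h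
    · exact congrArg (fun e : Ghost M X × Ghost M Y => e.2.val V w) h
  · refine Ghost.ext (funext fun V => funext fun v => ?_)
    change _ * _ = _
    rw [nm_inl_val_inl, nm_inr_val_inl, mul_one]
  · refine Ghost.ext (funext fun V => funext fun v => ?_)
    change _ * _ = _
    rw [nm_inl_val_inr, nm_inr_val_inr, one_mul]

end Ghost

/-- The Tambara functor of multiplicative families in the monoid algebras of `M`. -/
def ghost (M : SemiMackey G) : Tambara G where
  obj := Ghost M
  res f := RingHom.mk' ⟨⟨Ghost.res f, rfl⟩, fun _ _ => rfl⟩ (Ghost.res_add f)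
  tr f := AddMonoidHom.mk' (Ghost.tr f) (Ghost.tr_add f)
  nm f := ⟨⟨Ghost.nm f, Ghost.nm_one f⟩, Ghost.nm_mul f⟩
  res_id _ := rfl
  res_comp _ _ _ := rfl
  tr_id := Ghost.tr_id
  tr_comp := Ghost.tr_comp
  nm_id := Ghost.nm_id
  nm_comp := Ghost.nm_comp
  -- No orbit maps to the empty set, so there are no values left to compare.
  additive_empty _ h := ⟨fun _ _ => Ghost.ext_transitive fun _ v hV =>
    (h.false (v hV.1.some)).elim⟩
  additive_sum := Ghost.additive_sum
  mackey_tr := Ghost.mackey_tr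
  mackey_nm := Ghost.mackey_nm
  distributive := Ghost.distributive

/-! ### The embedding of `M` and the injectivity of the unit -/

/-- The family of the restrictions of an element of `M(X)`. -/
def toGhostElem {X : FinGSet G} (m : M.obj X) : Ghost M X where
  val V v := MonoidAlgebra.of (ZMod 2) _ (M.res v m)
  val_empty V v h := by
    have := M.additive_empty V h
    rw [Subsingleton.elim (M.res v m) 1, map_one]
  val_coprod i j h v := by
    rw [push_of, push_of, ← map_mul, M.res_comp, M.res_comp, M.tr_res_mul_tr_res h]

/-- The morphism of semi-Mackey functors from `M` to the multiplicative part of `ghost M`. -/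
def toGhost (M : SemiMackey G) : M ⟶ M.ghost.mul where
  app X :=
    { toFun := toGhostElem
      map_one' := Ghost.ext (funext fun V => funext fun v => by
        change MonoidAlgebra.of (ZMod 2) _ (M.res v 1) = 1
        rw [map_one, map_one])
      map_mul' m n := Ghost.ext (funext fun V => funext fun v => by
        change MonoidAlgebra.of (ZMod 2) _ (M.res v (m * n)) = _
        rw [map_mul, map_mul]
        rfl) }
  res f m := Ghost.ext (funext fun V => funext fun v =>
    congrArg (MonoidAlgebra.of (ZMod 2) _) (M.res_comp f v m).symm)
  tr f m := Ghost.ext (funext fun V => funext fun v => by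
    change MonoidAlgebra.of (ZMod 2) _ (M.res v (M.tr f m)) =
      push (pbFst v f) (MonoidAlgebra.of (ZMod 2) _ (M.res (pbSnd v f) m))
    -- The norm of families is shaped on the Mackey formula for `M`, so that formula is exactly what
    -- is needed here.
    rw [push_of, M.mackey (pb_isPullbackSq v f)])

/-- The value of the family at the identity of `X` is the basis element of `m`, and different
elements of a monoid have different basis elements in the monoid algebra over a nontrivial ring. -/
theorem toGhost_injective (M : SemiMackey G) (X : FinGSet G) :
    Function.Injective (M.toGhost.app X)  := fun _ _ h => by
  have h' := congrArg (fun c : Ghost M X => c.val X (MulActionHom.id G)) h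
  have := MonoidAlgebra.of_injective (R := ZMod 2) h'
  rwa [M.res_id, M.res_id] at this

end SemiMackey

/-- The unit `M → Ω[M]` is injective. -/
theorem Tambara.gen_injective {G : Type u} [Group G] (M : SemiMackey G) (X : FinGSet G) :
    Function.Injective (Tambara.gen M (X := X)) := fun _ _ h =>
  -- The extension of `M.toGhost` to `Ω[M]` takes a generator back to the family of its element by
  -- definition, so an equality of generators becomes an equality of families.
  M.toGhost_injective X (congrArg ((Tambara.freeLift M.toGhost).app X) h)

open FinGSet Tambara

/-! ### Closure properties of group-like elements -/

namespace HopfTambara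

variable {G : Type u} [Group G] (H : HopfTambara G)

/-- In this form the condition involves only values of morphisms of Tambara functors and a product,
so any operation that is multiplicative and preserved by such morphisms preserves it. -/
theorem isGroupLike_iff {X : FinGSet G} {m : H.toTambara.obj X} :
    H.IsGroupLike X m ↔
      H.comul.app X m = (tensorInl H.toTambara H.toTambara).app X m *
        (tensorInr H.toTambara H.toTambara).app X m ∧ H.counit.app X m = 1 := by
  rw [IsGroupLike, tmk_id]

theorem IsGroupLike.one (X : FinGSet G) : H.IsGroupLike X 1 :=
  H.isGroupLike_iff.2 ⟨by simp only [map_one, mul_one], map_one _⟩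

variable {H}

theorem IsGroupLike.mul {X : FinGSet G} {m n : H.toTambara.obj X} (hm : H.IsGroupLike X m)
    (hn : H.IsGroupLike X n) : H.IsGroupLike X (m * n) := by
  rw [isGroupLike_iff] at hm hn ⊢
  refine ⟨?_, ?_⟩
  · rw [map_mul, map_mul, map_mul, hm.1, hn.1, mul_mul_mul_comm]
  · rw [map_mul, hm.2, hn.2, mul_one]

theorem IsGroupLike.res {X Y : FinGSet G} (f : X →[G] Y) {m : H.toTambara.obj Y}
    (hm : H.IsGroupLike Y m) : H.IsGroupLike X (H.toTambara.res f m) := by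
  rw [isGroupLike_iff] at hm ⊢
  refine ⟨?_, ?_⟩
  · rw [H.comul.res, hm.1, map_mul, Hom.res, Hom.res]
  · rw [H.counit.res, hm.2, map_one]

/-- The norm is multiplicative and commutes with `Δ`, `ε` and both coprojections. This makes norms
the covariant part of the functor of group-like elements. -/
theorem IsGroupLike.nm {X Y : FinGSet G} (f : X →[G] Y) {m : H.toTambara.obj X}
    (hm : H.IsGroupLike X m) : H.IsGroupLike Y (H.toTambara.nm f m) := by
  rw [isGroupLike_iff] at hm ⊢
  refine ⟨?_, ?_⟩
  · rw [H.comul.nm, hm.1, map_mul, Hom.nm, Hom.nm]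
  · rw [H.counit.nm, hm.2, map_one]

/-- This is the right antipode axiom evaluated at `m`: one side becomes `m` times its antipode, and
the other is the image of `ε(m) = 1`. -/
theorem IsGroupLike.mul_antipode {X : FinGSet G} {m : H.toTambara.obj X}
    (hm : H.IsGroupLike X m) : m * H.antipode.app X m = 1 := by
  have h := congrArg (fun φ : H.toTambara ⟶ H.toTambara => φ.app X m) H.antipode_right
  simp only [comp_app] at h
  rw [hm.1, hm.2, tensorMap_tmk, nabla, tensorDesc_tmk, Tambara.tr_id, map_one] at h
  exact h

/-- Both `Δ(n)` and the product of the coprojections of `n` are inverse to `Δ(m)`, so they coincide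
by uniqueness of inverses. No compatibility between comultiplication and antipode is needed. -/
theorem IsGroupLike.of_mul_eq_one {X : FinGSet G} {m n : H.toTambara.obj X}
    (hm : H.IsGroupLike X m) (h : m * n = 1) : H.IsGroupLike X n := by
  rw [isGroupLike_iff] at hm ⊢
  -- The relation `m * n = 1` is carried along every morphism; it is used below for `Δ`, for the two
  -- coprojections and for `ε`.
  have key : ∀ {S : Tambara G} (φ : H.toTambara ⟶ S), φ.app X m * φ.app X n = 1 := fun φ => by
    rw [← map_mul, h, map_one]
  constructor
  · refine left_inv_eq_right_inv (a := H.comul.app X m) ((mul_comm _ _).trans (key _)) ?_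
    rw [hm.1, mul_mul_mul_comm, key, key, mul_one]
  · have := key H.counit
    rwa [hm.2, one_mul] at this

theorem IsGroupLike.map {H K : HopfTambara G} (φ : H ⟶ K) {X : FinGSet G}
    {m : H.toTambara.obj X} (hm : H.IsGroupLike X m) : K.IsGroupLike X (φ.hom.app X m) := by
  constructor
  · have h := congrArg (fun ψ : H.toTambara ⟶ tensor K.toTambara K.toTambara => ψ.app X m) φ.comul
    simp only [comp_app] at h
    rw [h, hm.1, tensorMap_tmk]
  · have h := congrArg (fun ψ : H.toTambara ⟶ burnside G => ψ.app X m) φ.counit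
    simp only [comp_app] at h
    rw [h, hm.2]

/-! ### The Mackey functor of group-like elements and the natural morphisms -/

variable (H)

/-- The monoid of group-like elements at `X`. -/
def groupLikeSubmonoid (X : FinGSet G) : Submonoid (H.toTambara.obj X) where
  carrier := {m | H.IsGroupLike X m}
  one_mem' := IsGroupLike.one H X
  mul_mem' := IsGroupLike.mul

/-- The semi-Mackey functor of group-like elements. -/
def groupLikeSemiMackey : SemiMackey G where
  obj X := H.groupLikeSubmonoid X
  res f := ((H.toTambara.res f).toMonoidHom.domRestrict _).codRestrict _ fun m => m.2.res f
  tr f := ((H.toTambara.nm f).domRestrict _).codRestrict _ fun m => m.2.nm f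
  res_id m := Subtype.ext (H.toTambara.res_id _)
  res_comp g f m := Subtype.ext (H.toTambara.res_comp g f _)
  tr_id _ := Subtype.ext (H.toTambara.nm_id _)
  tr_comp g f m := Subtype.ext (H.toTambara.nm_comp g f _)
  additive_empty X h := by
    have := H.toTambara.additive_empty X h
    exact inferInstanceAs (Subsingleton (H.groupLikeSubmonoid X))
  additive_sum X Y := by
    refine ⟨fun m n h => Subtype.ext (sum_ext _ ?_ ?_), fun z => ?_⟩
    · exact congrArg (fun z : H.groupLikeSubmonoid X × H.groupLikeSubmonoid Y => z.1.1) h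
    · exact congrArg (fun z : H.groupLikeSubmonoid X × H.groupLikeSubmonoid Y => z.2.1) h
    · refine ⟨⟨H.toTambara.pair z.1.1 z.2.1, ?_⟩, Prod.ext (Subtype.ext ?_) (Subtype.ext ?_)⟩
      -- The glued element is defined by additive transfers, which need not preserve group-like
      -- elements. Written as a product of norms it is visibly group-like.
      · rw [pair_eq_nm]
        exact (z.1.2.nm _).mul (z.2.2.nm _)
      · exact res_inl_pair _ _ _
      · exact res_inr_pair _ _ _
  mackey h m := Subtype.ext (H.toTambara.mackey_nm h _)

/-- The Mackey functor of group-like elements. -/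
def groupLikeMackey : Mackey G where
  obj := H.groupLikeSemiMackey
  property X m :=
    -- The antipode supplies an inverse in the ring, and this inverse is itself group-like, so `m`
    -- is invertible in the monoid of group-like elements.
    .of_mul_eq_one ⟨H.antipode.app X m.1, m.2.of_mul_eq_one m.2.mul_antipode⟩
      (Subtype.ext m.2.mul_antipode)

/-- The functor of group-like elements. -/
def groupLikeFunctor (G : Type u) [Group G] : HopfTambara G ⥤ Mackey G where
  obj := groupLikeMackey
  map {H K} φ := ObjectProperty.homMk
    { app X := ((φ.hom.app X).toMonoidHom.domRestrict (H.groupLikeSubmonoid X)).codRestrict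
        (K.groupLikeSubmonoid X) fun m => m.2.map φ
      res f _ := Subtype.ext (φ.hom.res f _)
      tr f _ := Subtype.ext (φ.hom.nm f _) }
  map_id _ := rfl
  map_comp _ _ := rfl

/-- The inclusion of the group-like elements into the multiplicative part. -/
def groupLikeIncl (G : Type u) [Group G] :
    groupLikeFunctor G ⋙ (SemiMackey.isMackey G).ι ⟶ HopfTambara.forget G ⋙ mulFunctor G where
  app H :=
    { app X := (H.groupLikeSubmonoid X).subtype
      res _ _ := rfl
      tr _ _ := rfl }
  naturality _ _ _ := rfl

/-- The diagonal sends `m` to the pair `(m, m)`, which corresponds to `[m ⊗ m]`, and the zero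
morphism sends `m` to `1`. -/
theorem isGroupLike_gen (M : Mackey G) {X : FinGSet G} (m : M.obj.obj X) :
    (Mackey.hopf M).IsGroupLike X (gen M.obj m) :=
  ⟨freeComul_gen M.obj m, freeCounit_gen M.obj m⟩

/-- The morphism from a Mackey functor `M` to the group-like elements of `Ω[M]`. -/
def toGroupLike (G : Type u) [Group G] :
    𝟭 (Mackey G) ⟶ Mackey.hopfFunctor G ⋙ groupLikeFunctor G where
  app M := ObjectProperty.homMk
    { app X :=
        ((freeUnit M.obj).app X).codRestrict ((Mackey.hopf M).groupLikeSubmonoid X)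
          fun m => isGroupLike_gen M m
      res f m := Subtype.ext (gen_res M.obj f m)
      tr f m := Subtype.ext (gen_tr M.obj f m) }
  naturality _ _ _ := rfl

/-- The morphism from the Tambarization of the group-like elements of `H` to `H`. -/
def groupLikeCounit (G : Type u) [Group G] :
    groupLikeFunctor G ⋙ (SemiMackey.isMackey G).ι ⋙ tambarization G ⟶ HopfTambara.forget G where
  app H := freeLift (M := H.groupLikeSemiMackey) ((groupLikeIncl G).app H)
  -- Morphisms out of `Ω[-]` are compared on generators, where both composites apply the given
  -- morphism to a group-like element.
  naturality H _ _ := free_hom_ext (M := H.groupLikeSemiMackey) fun _ _ => rfl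

end HopfTambara

/-! ### The theorem -/

open HopfTambara in
theorem mainTheorem7 (G : Type u) [Group G] [Finite G] :
    ∃ (𝓜 : HopfTambara G ⥤ Mackey G)
      (i : 𝓜 ⋙ (SemiMackey.isMackey G).ι ⟶ HopfTambara.forget G ⋙ Tambara.mulFunctor G),
      (∀ (H : HopfTambara G) (X : FinGSet G),
        Function.Injective ((i.app H).app X) ∧
          Set.range ((i.app H).app X) = {m | H.IsGroupLike X m}) ∧
      (∃ j : 𝟭 (Mackey G) ⟶ Mackey.hopfFunctor G ⋙ 𝓜,
        ∀ (M : Mackey G) (X : FinGSet G),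
          Function.Injective ((j.app M).hom.app X) ∧
            ∀ m : M.obj.obj X,
              (i.app ((Mackey.hopfFunctor G).obj M)).app X ((j.app M).hom.app X m) =
                ((Tambara.tambarizationAdj G).unit.app M.obj).app X m) ∧
      ∃ k : 𝓜 ⋙ (SemiMackey.isMackey G).ι ⋙ Tambara.tambarization G ⟶ HopfTambara.forget G,
        ∀ H : HopfTambara G,
          k.app H = ((Tambara.tambarizationAdj G).homEquiv (𝓜.obj H).obj H.toTambara).symm (i.app H) := by
  refine ⟨groupLikeFunctor G, groupLikeIncl G, fun H X => ⟨Subtype.val_injective, ?_⟩,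
    ⟨toGroupLike G, fun M X => ⟨fun m n h => ?_, fun m => rfl⟩⟩, groupLikeCounit G,
    fun H => free_hom_ext (M := H.groupLikeSemiMackey) fun _ _ => rfl⟩
  · exact Subtype.range_coe
  -- After the inclusion of group-like elements, the morphism from `M` is the unit of the
  -- adjunction, so its injectivity is that of the unit.
  · exact gen_injective M.obj X (congrArg Subtype.val h)

end
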